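/- **Setting.** Let $[1]=[2]=0$, $[3]=1$ and $c\in\mathbb C\setminus\{0\}$; put $g(u,v)=\frac{c}{u-v}$, $f(u,v)=1+g(u,v)$, $h(u,v)=\frac{f(u,v)}{g(u,v)}=\frac{u-v+c}{c}$. The super-Yangian $Y(\mathfrak{gl}(2|1))$ is the unital associative $\mathbb C$-superalgebra generated by $T^{(p)}_{ij}$ ($1\le i,j\le 3$, $p\ge 0$), of parity $[i]+[j]$, subject to the relations that the series $T_{ij}(u)=\delta_{ij}+\sum_{p\ge0}T^{(p)}_{ij}(c/u)^{p+1}$ satisfy $$T_{ij}(z)T_{kl}(w)-(-1)^{([i]+[j])([k]+[l])}T_{kl}(w)T_{ij}(z)=(-1)^{[l]([i]+[j])+[i][j]}g(z,w)\bigl(T_{il}(z)T_{kj}(w)-T_{il}(w)T_{kj}(z)\bigr),$$ that is, the $RTT$ relation with $R_{12}(u,v)=1+g(u,v)P_{12}$, $P=\sum_{i,j}(-1)^{[j]}E_{ij}\otimes E_{ji}$, in the graded tensor product. Let $\Omega$ be a vector of a $Y(\mathfrak{gl}(2|1))$-module with $T_{ii}(u)\Omega=\lambda_i(u)\Omega$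 and $T_{ij}(u)\Omega=0$ for $i>j$, where $\lambda_i(u)=1+\sum_{p\ge0}\lambda_i^{(p)}(c/u)^{p+1}$. For ordered families $\bar u=(u_1,\dots,u_a)$, $\bar v=(v_1,\dots,v_b)$ of parameters ($a,b\ge0$) put $H(\bar v)=\prod_{1\le k<j\le b}h(v_j,v_k)$ and define the Bethe vector by $$\Phi_{a,b}(\bar u,\bar v)=\frac{(-1)^b}{H(\bar v)}\,\mathrm{str}_{1\cdots a+b}\Bigl[T_1(u_1)\cdots T_a(u_a)T_{a+1}(v_1)\cdots T_{a+b}(v_b)\,\mathbb R\;E_{21}^{(1)}\cdots E_{21}^{(a)}E_{32}^{(a+1)}\cdots E_{32}^{(a+b)}\Bigr]\Omega .$$ Here $\mathbb R=(R_{a+1,a}\cdots R_{a+1,1})(R_{a+2,a}\cdots R_{a+2,1})\cdots(R_{a+b,a}\cdots R_{a+b,1})$ with $R_{a+j,k}=R_{a+j,k}(v_j,u_k)$, $T_p(x)=\sum_{i,j}E^{(p)}_{ij}\otimes T_{ij}(x)$, everything is computed in the graded tensor product of $a+b$ copies of $\mathrm{End}(\mathbb C^{2|1})$ and the algebra of the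 $T_{ij}$ (in this order), and the super-trace is over the $a+b$ auxiliary spaces, $\mathrm{str}\,E_{ij}=(-1)^{[j]}\delta_{ij}$. **Notation.** For families $\bar x,\bar y$ and a function $\varphi$, $\varphi(\bar x,\bar y)=\prod_{j,k}\varphi(x_j,y_k)$; $\lambda_2(\bar x)=\prod_j\lambda_2(x_j)$; $T_{12}(\bar x)=T_{12}(x_1)T_{12}(x_2)\cdots$. For $\#\bar x=\ell$ and $(i,j)\in\{(1,3),(2,3)\}$, $\mathbb T_{ij}(\bar x)=H(\bar x)^{-1}T_{ij}(x_1)\cdots T_{ij}(x_\ell)$. For $\#\bar v=\#\bar u=\ell$, $$K_\ell(\bar v|\bar u)=\prod_{j>k}g(v_j,v_k)\prod_{j>k}g(u_k,u_j)\;h(\bar v,\bar u)\;\det_{1\le j,k\le\ell}\left(\frac{g(v_j,u_k)}{h(v_j,u_k)}\right).$$ **Proposition.** For all $a,b\ge0$, $$\Phi_{a,b}(\bar u,\bar v)=\sum g(\bar v_{\rm I},\bar u_{\rm I})\,f(\bar u_{\rm I},\bar u_{\rm II})\,g(\bar v_{\rm II},\bar v_{\rm I})\,h(\bar u_{\rm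 I},\bar u_{\rm I})\;\mathbb T_{13}(\bar u_{\rm I})\,T_{12}(\bar u_{\rm II})\,\mathbb T_{23}(\bar v_{\rm II})\,\lambda_2(\bar v_{\rm I})\,\Omega,$$ $$\Phi_{a,b}(\bar u,\bar v)=\sum K_\ell(\bar v_{\rm I}|\bar u_{\rm I})\,f(\bar u_{\rm I},\bar u_{\rm II})\,g(\bar v_{\rm II},\bar v_{\rm I})\;\mathbb T_{13}(\bar v_{\rm I})\,\mathbb T_{23}(\bar v_{\rm II})\,T_{12}(\bar u_{\rm II})\,\lambda_2(\bar u_{\rm I})\,\Omega .$$ Both sums run over all partitions $\bar u\Rightarrow\{\bar u_{\rm I},\bar u_{\rm II}\}$, $\bar v\Rightarrow\{\bar v_{\rm I},\bar v_{\rm II}\}$ into subfamilies, each with the induced order, such that $\#\bar u_{\rm I}=\#\bar v_{\rm I}=\ell$, $\ell=0,1,\dots,\min(a,b)$. The two identities hold in both of the following senses. 1. *Formal parameters.* $u_1,\dots,u_a,v_1,\dots,v_b$ are independent formal variables; the identities are between series in their inverses with coefficients in the module, rational functions of the parameters being expanded for $|u_1|\gg\dots\gg|u_a|\gg|v_1|\gg\dots\gg|v_b|$.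 2. *Complex parameters.* $T_{ij}(u)$ are elements, of parity $[i]+[j]$, of a superalgebra over $\mathbb C$ depending on a parameter $u$ in some domain, that satisfy the displayed relation at any two distinct values of the parameter; $\Omega$ is a vector of a module over it with $T_{ii}(u)\Omega=\lambda_i(u)\Omega$ and $T_{ij}(u)\Omega=0$ for $i>j$, $\lambda_i(u)\in\mathbb C$; and $u_1,\dots,u_a,v_1,\dots,v_b$ are in the domain, pairwise distinct, and no two of them differ by $\pm c$. -/

import Mathlib

noncomputable section

namespace SuperBethe

/-! ### The grading of `{1,2,3}` for `gl(2|1)` -/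

/-- `[1] = [2] = 0`, `[3] = 1`; the indices `1, 2, 3` are `0, 1, 2 : Fin 3`. Parities are
recorded as natural numbers and only ever used as exponents of `-1` or of an involution. -/
def par : Fin 3 → ℕ := ![0, 0, 1]

/-! ### Spectral parameters and monodromy matrices -/

/-- The data entering the formulas for Bethe vectors: spectral points `P` with values `z` in a
field `F`, the constant `c`, a superalgebra `A` over `F` (structure map `scal`, and the `ℤ/2`-grading
encoded by its grading involution `grade`, which is `(-1)^k` on elements of degree `k`), and the
entries `T x i j` of the monodromy matrix at the point `x`. The laws are not part of the data: they
hold by construction for the super-Yangian (`yangianData`), and are the predicate `IsMonodromy` in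
general. -/
structure MonodromyData (P F A : Type*) [Field F] [Ring A] where
  c : F
  z : P → F
  scal : F →+* A
  grade : A →+* A
  T : P → Fin 3 → Fin 3 → A

/-- The predicate that `M` is, on the set `D` of points, an even `3 × 3` monodromy matrix with
entries in the `F`-superalgebra `A` that satisfies the `RTT` relation of `Y(gl(2|1))`, written in
components. -/
structure MonodromyData.IsMonodromy {P F A : Type*} [Field F] [Ring A]
    (M : MonodromyData P F A) (D : Set P) : Prop where
  scal_central : ∀ s y, M.scal s * y = y * M.scal s
  grade_scal : ∀ s, M.grade (M.scal s) = M.scal s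
  grade_grade : ∀ y, M.grade (M.grade y) = y
  grade_T : ∀ x ∈ D, ∀ i j, M.grade (M.T x i j) = (-1) ^ (par i + par j) * M.T x i j
  rtt : ∀ x ∈ D, ∀ y ∈ D, M.z x ≠ M.z y → ∀ i j k l,
    M.T x i j * M.T y k l
        - (-1) ^ ((par i + par j) * (par k + par l)) * (M.T y k l * M.T x i j)
      = (-1) ^ (par l * (par i + par j) + par i * par j) *
          (M.scal (M.c / (M.z x - M.z y)) * (M.T x i l * M.T y k j - M.T y i l * M.T x k j))

namespace MonodromyData

variable {P F A : Type*} [Field F] [Ring A] (M : MonodromyData P F A)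

/-! ### The functions `g`, `f`, `h` and their products over ordered families -/

def g (x y : P) : F := M.c / (M.z x - M.z y)

def f (x y : P) : F := 1 + M.g x y

def h (x y : P) : F := (M.z x - M.z y + M.c) / M.c

/-- `φ(x̄, ȳ)`: the double product of `φ` over two families. -/
def dprod {m n : ℕ} (φ : P → P → F) (x : Fin m → P) (y : Fin n → P) : F :=
  ∏ i, ∏ j, φ (x i) (y j)

/-- `H(v̄) = ∏_{k < j} h(v_j, v_k)`. -/
def H {n : ℕ} (v : Fin n → P) : F :=
  ∏ j, ∏ k ∈ Finset.univ.filter (· < j), M.h (v j) (v k)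

/-! ### The graded tensor product `End(ℂ^{2|1})^{⊗ n} ⊗ A` -/

/-- Elements of `End(ℂ^{2|1})^{⊗ n} ⊗ A`: the entry `X I J` is the coefficient, written to the
right, of `E_{I₁J₁}^{(1)} E_{I₂J₂}^{(2)} ⋯ E_{IₙJₙ}^{(n)}`. -/
@[nolint unusedArguments]
def Aux (_ : MonodromyData P F A) (n : ℕ) : Type _ := (Fin n → Fin 3) → (Fin n → Fin 3) → A

variable {n : ℕ}

/-- The multiplication rule of the graded tensor product. Moving the factor `E_{J_q L_q}^{(q)}` of
the second element to the left past `E_{I_p J_p}^{(p)}` with `p > q` costs the sign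
`(-1)^{([I_p]+[J_p])([J_q]+[L_q])}`; moving all of them past `X I J ∈ A` applies the grading involution
`∑_q ([J_q]+[L_q])` times. -/
instance : Mul (M.Aux n) where
  mul X Y := fun I L => ∑ J : Fin n → Fin 3,
    (-1) ^ (∑ p, ∑ q ∈ Finset.univ.filter (· < p),
        (par (I p) + par (J p)) * (par (J q) + par (L q))) *
      ((M.grade)^[∑ q, (par (J q) + par (L q))] (X I J) * Y J L)

instance : One (M.Aux n) where
  one := fun I J => if I = J then 1 else 0

instance : AddCommGroup (M.Aux n) :=
  inferInstanceAs (AddCommGroup ((Fin n → Fin 3) → (Fin n → Fin 3) → A))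

/-- Multiplication of all coefficients by a scalar. -/
def auxScale (s : F) (X : M.Aux n) : M.Aux n := fun I J => M.scal s * X I J

/-- `E_{ij}^{(p)}`, the elementary matrix in the `p`-th auxiliary space. -/
def E (p : Fin n) (i j : Fin 3) : M.Aux n := fun I J =>
  if I p = i ∧ J p = j ∧ ∀ q, q ≠ p → I q = J q then 1 else 0

/-- `T_p(x) = ∑_{ij} E_{ij}^{(p)} ⊗ T_{ij}(x)`. -/
def TAux (p : Fin n) (x : P) : M.Aux n := fun I J =>
  if ∀ q, q ≠ p → I q = J q then M.T x (I p) (J p) else 0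

/-- The graded permutation `P_{pq} = ∑_{ij} (-1)^{[j]} E_{ij}^{(p)} E_{ji}^{(q)}`. -/
def perm (p q : Fin n) : M.Aux n :=
  ∑ i : Fin 3, ∑ j : Fin 3, ((-1 : ℤ) ^ par j) • (M.E p i j * M.E q j i)

/-- `R_{pq}(x, y) = 1 + g(x, y) P_{pq}`. -/
def R (p q : Fin n) (x y : P) : M.Aux n := 1 + M.auxScale (M.g x y) (M.perm p q)

/-- The super-trace over all `n` auxiliary spaces. -/
def str (X : M.Aux n) : A := ∑ I : Fin n → Fin 3, (-1) ^ (∑ p, par (I p)) * X I I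

/-- The ordered product `X₁ X₂ ⋯ X_m`. -/
def oprod {B : Type*} [Mul B] [One B] {m : ℕ} (X : Fin m → B) : B := (List.ofFn X).prod

/-! ### Bethe vectors -/

variable {a b : ℕ}

/-- `(R_{a+1,a} ⋯ R_{a+1,1}) (R_{a+2,a} ⋯ R_{a+2,1}) ⋯ (R_{a+b,a} ⋯ R_{a+b,1})` with
`R_{a+j,k} = R_{a+j,k}(v_j, u_k)`. -/
def RR (u : Fin a → P) (v : Fin b → P) : M.Aux (a + b) :=
  oprod fun j : Fin b => oprod fun k : Fin a =>
    M.R (Fin.natAdd a j) (Fin.castAdd b k.rev) (v j) (u k.rev)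

/-- The operator in front of `Ω` in the super-trace formula. -/
def betheOperator (u : Fin a → P) (v : Fin b → P) : A :=
  M.scal ((-1) ^ b / M.H v) *
    M.str
      ((oprod fun k : Fin a => M.TAux (Fin.castAdd b k) (u k)) *
        (oprod fun j : Fin b => M.TAux (Fin.natAdd a j) (v j)) *
        M.RR u v *
        (oprod fun k : Fin a => M.E (Fin.castAdd b k) 1 0) *
        (oprod fun j : Fin b => M.E (Fin.natAdd a j) 2 1))

variable {V : Type*} [AddCommGroup V] [Module A V]

/-- The Bethe vector `Φ_{a,b}(ū, v̄)`. -/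
def betheVector (u : Fin a → P) (v : Fin b → P) (Ω : V) : V := M.betheOperator u v • Ω

/-! ### The explicit expressions -/

/-- `T_{ij}(w₁) T_{ij}(w₂) ⋯`. -/
def TT (i j : Fin 3) (w : Fin n → P) : A := oprod fun p => M.T (w p) i j

/-- `𝕋_{ij}(w̄) = H(w̄)⁻¹ T_{ij}(w₁) T_{ij}(w₂) ⋯`. -/
def TTn (i j : Fin 3) (w : Fin n → P) : A := M.scal (M.H w)⁻¹ * M.TT i j w

/-- `K_ℓ(v̄|ū) = Δ_ℓ(v̄) Δ'_ℓ(ū) h(v̄, ū) det (g(v_j, u_k) / h(v_j, u_k))`. -/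
def K {ℓ : ℕ} (v u : Fin ℓ → P) : F :=
  (∏ j, ∏ k ∈ Finset.univ.filter (· < j), M.g (v j) (v k)) *
    (∏ j, ∏ k ∈ Finset.univ.filter (· < j), M.g (u k) (u j)) *
    dprod M.h v u *
    (Matrix.of fun j k => M.g (v j) (u k) / M.h (v j) (u k)).det

/-- The part `w̄_I` of `w̄` at the positions in `S`, in the order induced from `w̄`. -/
def part {m ℓ : ℕ} (w : Fin m → P) (S : {S : Finset (Fin m) // S.card = ℓ}) : Fin ℓ → P :=
  fun p => w (S.1.orderEmbOfFin S.2 p)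

/-- The complementary part `w̄_II`, in the order induced from `w̄`. -/
def compl {m ℓ : ℕ} (w : Fin m → P) (S : {S : Finset (Fin m) // S.card = ℓ}) :
    Fin (S.1ᶜ).card → P :=
  fun p => w ((S.1ᶜ).orderEmbOfFin rfl p)

/-- `∑ g(v̄_I,ū_I) f(ū_I,ū_II) g(v̄_II,v̄_I) h(ū_I,ū_I) 𝕋₁₃(ū_I) T₁₂(ū_II) 𝕋₂₃(v̄_II) λ₂(v̄_I) Ω`. -/
def explicitVector₁ (lam₂ : P → F) (u : Fin a → P) (v : Fin b → P) (Ω : V) : V :=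
  ∑ ℓ ∈ Finset.range (min a b + 1),
    ∑ S : {S : Finset (Fin a) // S.card = ℓ}, ∑ R : {R : Finset (Fin b) // R.card = ℓ},
      (M.scal (dprod M.g (part v R) (part u S) * dprod M.f (part u S) (compl u S) *
          dprod M.g (compl v R) (part v R) * dprod M.h (part u S) (part u S)) *
        (M.TTn 0 2 (part u S) * M.TT 0 1 (compl u S) * M.TTn 1 2 (compl v R)) *
        M.scal (∏ p, lam₂ (part v R p))) • Ω

/-- `∑ K_ℓ(v̄_I|ū_I) f(ū_I,ū_II) g(v̄_II,v̄_I) 𝕋₁₃(v̄_I) 𝕋₂₃(v̄_II) T₁₂(ū_II) λ₂(ū_I) Ω`. -/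
def explicitVector₂ (lam₂ : P → F) (u : Fin a → P) (v : Fin b → P) (Ω : V) : V :=
  ∑ ℓ ∈ Finset.range (min a b + 1),
    ∑ S : {S : Finset (Fin a) // S.card = ℓ}, ∑ R : {R : Finset (Fin b) // R.card = ℓ},
      (M.scal (M.K (part v R) (part u S) * dprod M.f (part u S) (compl u S) *
          dprod M.g (compl v R) (part v R)) *
        (M.TTn 0 2 (part v R) * M.TTn 1 2 (compl v R) * M.TT 0 1 (compl u S)) *
        M.scal (∏ p, lam₂ (part u S p))) • Ω

/-- `Ω` is a singular vector with weights `lam` at the points of `D`. -/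
def IsSingularOn (D : Set P) (lam : Fin 3 → P → F) (Ω : V) : Prop :=
  ∀ x ∈ D, (∀ i, M.T x i i • Ω = M.scal (lam i x) • Ω) ∧ ∀ i j, j < i → M.T x i j • Ω = 0

end MonodromyData

/-! ### The super-Yangian `Y(gl(2|1))` -/

/-- The generators `T_{ij}^{(p)}`, `p ≥ 0`. -/
abbrev Gen : Type := Fin 3 × Fin 3 × ℕ

/-- The coefficient of `(c/u)^r` in `T_{ij}(u) = δ_{ij} + ∑_{p ≥ 0} T_{ij}^{(p)} (c/u)^{p+1}`, in the
free algebra on the generators. -/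
def freeT (i j : Fin 3) : ℕ → FreeAlgebra ℂ Gen
  | 0 => if i = j then 1 else 0
  | p + 1 => FreeAlgebra.ι ℂ (i, j, p)

/-- The graded commutator of two coefficients. -/
def freeBracket (i j k l : Fin 3) (r s : ℕ) : FreeAlgebra ℂ Gen :=
  freeT i j r * freeT k l s -
    (-1) ^ ((par i + par j) * (par k + par l)) * (freeT k l s * freeT i j r)

/-- The defining relations: the coefficient of `(c/z)^r (c/w)^s` in
`((z-w)/c) [T_{ij}(z), T_{kl}(w)} = (-1)^{[l]([i]+[j])+[i][j]} (T_{il}(z) T_{kj}(w) - T_{il}(w) T_{kj}(z))`. -/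
inductive YangianRel : FreeAlgebra ℂ Gen → FreeAlgebra ℂ Gen → Prop
  | rtt (i j k l : Fin 3) (r s : ℕ) :
    YangianRel
      (freeBracket i j k l (r + 1) s - freeBracket i j k l r (s + 1))
      ((-1) ^ (par l * (par i + par j) + par i * par j) *
        (freeT i l r * freeT k j s - freeT i l s * freeT k j r))

/-- The super-Yangian `Y(gl(2|1))`. -/
abbrev Yangian : Type := RingQuot YangianRel

namespace Yangian

/-- The coefficient of `(c/u)^r` in `T_{ij}(u)`. -/
def coeffT (i j : Fin 3) (r : ℕ) : Yangian := RingQuot.mkAlgHom ℂ YangianRel (freeT i j r)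

/-- The automorphism `T_{ij}^{(p)} ↦ (-1)^{[i]+[j]} T_{ij}^{(p)}` of the free algebra. -/
def freeGrade : FreeAlgebra ℂ Gen →ₐ[ℂ] FreeAlgebra ℂ Gen :=
  FreeAlgebra.lift ℂ fun x => (-1) ^ (par x.1 + par x.2.1) * FreeAlgebra.ι ℂ x

theorem freeGrade_freeT (i j : Fin 3) (r : ℕ) :
    freeGrade (freeT i j r) = (-1) ^ (par i + par j) * freeT i j r := by
  cases r with
  | zero =>
    by_cases h : i = j
    · subst h
      simp [freeT, ← two_mul]
    · simp [freeT, h]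
  | succ p => simp [freeT, freeGrade]

theorem freeGrade_mul_freeT (i j k l : Fin 3) (r s : ℕ) :
    freeGrade (freeT i j r * freeT k l s) =
      (-1) ^ (par i + par j + par k + par l) * (freeT i j r * freeT k l s) := by
  rw [map_mul, freeGrade_freeT, freeGrade_freeT]
  rcases neg_one_pow_eq_or (FreeAlgebra ℂ Gen) (par i + par j) with h | h <;>
  rcases neg_one_pow_eq_or (FreeAlgebra ℂ Gen) (par k + par l) with h' | h' <;>
  simp [h, h', add_assoc (par i + par j), pow_add _ (par i + par j)]

/-- Both sides of a defining relation have the same parity. -/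
theorem freeGrade_rel (x y : FreeAlgebra ℂ Gen) (hxy : YangianRel x y) :
    ∃ d : ℕ, freeGrade x = (-1) ^ d * x ∧ freeGrade y = (-1) ^ d * y := by
  obtain ⟨i, j, k, l, r, s⟩ := hxy
  have hneg : ∀ m : ℕ, freeGrade ((-1) ^ m) = (-1) ^ m := fun m => by simp
  refine ⟨par i + par j + par k + par l, ?_, ?_⟩
  · simp only [freeBracket, map_sub, map_mul freeGrade ((-1) ^ _), hneg, freeGrade_mul_freeT]
    rw [show par k + par l + par i + par j = par i + par j + par k + par l by ring]
    rcases neg_one_pow_eq_or (FreeAlgebra ℂ Gen) (par i + par j + par k + par l) with h | h <;>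
    simp [h] <;> abel
  · simp only [map_sub, map_mul freeGrade ((-1) ^ _), hneg, freeGrade_mul_freeT]
    rw [show par i + par l + par k + par j = par i + par j + par k + par l by ring]
    generalize (-1 : FreeAlgebra ℂ Gen) ^ (par l * (par i + par j) + par i * par j) = e
    rcases neg_one_pow_eq_or (FreeAlgebra ℂ Gen) (par i + par j + par k + par l) with h | h <;>
    (rw [h]; noncomm_ring)

theorem grade_aux ⦃x y : FreeAlgebra ℂ Gen⦄ (hxy : YangianRel x y) :
    ((RingQuot.mkAlgHom ℂ YangianRel).comp freeGrade) x =
      ((RingQuot.mkAlgHom ℂ YangianRel).comp freeGrade) y := by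
  obtain ⟨d, hx, hy⟩ := freeGrade_rel x y hxy
  simp only [AlgHom.comp_apply, hx, hy, map_mul, RingQuot.mkAlgHom_rel ℂ hxy]

/-- The grading involution `T_{ij}^{(p)} ↦ (-1)^{[i]+[j]} T_{ij}^{(p)}` of the super-Yangian. -/
def grade : Yangian →ₐ[ℂ] Yangian :=
  RingQuot.liftAlgHom ℂ ⟨(RingQuot.mkAlgHom ℂ YangianRel).comp freeGrade, grade_aux⟩

end Yangian

/-- `Ω` is a singular (highest weight) vector with weights
`λ_i(u) = 1 + ∑_{p ≥ 0} λ_i^{(p)} (c/u)^{p+1}`, where `wt i p = λ_i^{(p)}`: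
`T_{ii}(u) Ω = λ_i(u) Ω`, and `T_{ij}(u) Ω = 0` for `i > j`. -/
def IsSingular {V : Type*} [AddCommGroup V] [Module Yangian V] (wt : Fin 3 → ℕ → ℂ) (Ω : V) :
    Prop :=
  ∀ p, (∀ i, Yangian.coeffT i i (p + 1) • Ω = algebraMap ℂ Yangian (wt i p) • Ω) ∧
    ∀ i j, j < i → Yangian.coeffT i j (p + 1) • Ω = 0

/-! ### Formal spectral parameters -/

/-- Exponents of monomials in `w₁⁻¹, …, wₙ⁻¹`, ordered lexicographically. -/
abbrev Expo (n : ℕ) : Type := Lex (Fin n → ℤ)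

/-- `p ↦` the exponent of `w_k^{-p}`. -/
def expoEmb {n : ℕ} (k : Fin n) : ℕ ↪o Expo n :=
  OrderEmbedding.ofStrictMono (fun p => toLex (Pi.single k (p : ℤ))) (by
    intro p q h
    apply Pi.toLex_strictMono
    exact Pi.single_strictMono k (by exact_mod_cast h))

/-- The series `∑_r f_r w_k^{-r}` in the formal variable `w_k`, as a series in all the variables. -/
def seriesAt {n : ℕ} {R : Type*} [Semiring R] (k : Fin n) (f : ℕ → R) : HahnSeries (Expo n) R :=
  HahnSeries.embDomain (expoEmb k) (HahnSeries.toPowerSeries.symm (PowerSeries.mk f))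

/-- A ring homomorphism applied to all coefficients of a series. -/
def mapSeries {n : ℕ} {R S : Type*} [Ring R] [Ring S] (φ : R →+* S) :
    HahnSeries (Expo n) R →+* HahnSeries (Expo n) S where
  toFun x := x.map φ
  map_one' := by
    ext e
    by_cases h : e = 0 <;> simp [HahnSeries.coeff_one, h]
  map_mul' x y := HahnSeries.map_mul φ.toNonUnitalRingHom
  map_zero' := by ext; simp
  map_add' x y := by ext; simp

/-- The universal monodromy matrix of the super-Yangian at `n` independent formal spectral
parameters `w₁, …, wₙ`: `w_k` is the monomial with exponent `-1` at `k`, scalars are the field of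
(Hahn) series in `w₁⁻¹, …, wₙ⁻¹` over `ℂ`, in which rational functions of the parameters are
expanded for `|w₁| ≫ |w₂| ≫ ⋯ ≫ |wₙ|`, operators are the series over the super-Yangian, and
`T_{ij}(w_k) = δ_{ij} + ∑_{p ≥ 0} T_{ij}^{(p)} (c/w_k)^{p+1}`. -/
def yangianData (c : ℂ) (n : ℕ) :
    MonodromyData (Fin n) (HahnSeries (Expo n) ℂ) (HahnSeries (Expo n) Yangian) where
  c := HahnSeries.C c
  z k := HahnSeries.single (toLex (Pi.single k (-1))) 1
  scal := mapSeries (algebraMap ℂ Yangian)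
  grade := mapSeries Yangian.grade.toRingHom
  T k i j := seriesAt k fun r => (c ^ r) • Yangian.coeffT i j r

/-- `λ(w_k) = 1 + ∑_{p ≥ 0} λ^{(p)} (c/w_k)^{p+1}`. -/
def weightSeries (c : ℂ) {n : ℕ} (wt : ℕ → ℂ) (k : Fin n) : HahnSeries (Expo n) ℂ :=
  seriesAt k fun
    | 0 => 1
    | p + 1 => c ^ (p + 1) * wt p

/-- Series over a `Yangian`-module `V`, as a module over series over the super-Yangian; `Ω ∈ V` is
regarded as a constant series. -/
abbrev SeriesModule (n : ℕ) (V : Type*) [AddCommGroup V] [Module Yangian V] : Type _ :=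
  HahnModule (Expo n) Yangian V

def constVector (n : ℕ) {V : Type*} [AddCommGroup V] [Module Yangian V] (Ω : V) :
    SeriesModule n V :=
  HahnModule.of Yangian (HahnSeries.single 0 Ω)

end SuperBethe

end

/-! Let the graded tensor product act on `V`-valued functions of words of labels, with Jordan–Wigner
signs. The matrix units at the end of the super-trace send the word 1^a 2^b to 2^a 3^b and kill all
other words, so the trace collapses to one matrix element: the component at 1^a 2^b of
T(u_1)⋯T(u_a)T(v_1)⋯T(v_b)ℝ applied to Ω placed at 2^a 3^b (`betheVector_eq`).

First identity. The label 1 does not occur in 2^a 3^b and R-matrices only permute labels, so each R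
may be truncated to the labels 2, 3. Operators at different sites commute, hence the factors can be
regrouped around each v_j: T(v_j) together with its R-matrices is a nested monodromy matrix with
quantum space V ⊗ (the u-sites), and only its creation operator contributes
(`prod_monOp_mul_prod_rOp_apply`). Now peel off the site of u_1. A site can be raised at most once,
so the product of creation operators acting on the vacuum is a term in which the site is untouched
plus a sum over the one v_j that raises it (`sprod_nestB_apply_vacuum`). This gives
(`nestedVector_cons`) Φ(u, v) = T_12(u_1) Φ(u∖u_1, v) + T_13(u_1) ∑_j (scalar)_j Φ(u∖u_1, v∖v_j).
The sum over partitions obeys the same recursion (`partitionSum₁_insert`). Moving T_12(u_1) to the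
right of the T_13's produces the terms with u_1 in part II and also unwanted terms. The terms with
u_1 in part I are decomposed into partial fractions in u_1: the poles at the u_k are exactly the
unwanted terms, and the poles at the v_j form the T_13 sum.

Second identity. The RTT relation moves ℝ to the left and interchanges the T(u)'s with the T(v)'s.
All labels of 1^a 2^b are even, so to the left of the T's the product ℝ acts by ungraded
permutations. Transposing the matrix element therefore gives, up to (-1)^b, an ungraded element of
the same shape with u and v interchanged and transposed monodromy matrices
(`prod_rOp_mul_prod_monOp_apply`). The transposed matrices need not satisfy an ungraded RTT
relation, but the nesting argument only uses the exchange relations of one row, which here are those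
of T_12 and T_22. Now the v-sites are peeled off, and the recursion of the second sum rests on
partial fractions of K in one v-argument (`kernelF_mul_prod_fF`): the poles at the remaining v's are
only apparent, because there the determinant has two equal rows.

The argument works over any field of scalars, for parameters whose differences avoid 0 and c.
Complex parameters are the case of ℂ. For formal parameters the field consists of Hahn series in the
inverse variables, and what remains is to read the defining relations of the super-Yangian as the
RTT relation between series. -/

noncomputable section
namespace SuperBethe

/-! ### Ordered products over finite sets and exchange relations -/

section Exchange

set_option linter.unusedSectionVars false

variable {κ F R : Type*} [LinearOrder κ] [Field F] [Ring R] [Algebra F R]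

/-- The product of `B k` over `k ∈ W` in increasing order. -/
def sprod (B : κ → R) (W : Finset κ) : R := ((W.sort (· ≤ ·)).map B).prod

@[simp] theorem sprod_empty (B : κ → R) : sprod B ∅ = 1 := by simp [sprod]

theorem sprod_insert_min (B : κ → R) {k : κ} {W : Finset κ} (h : ∀ w ∈ W, k < w) :
    sprod B (insert k W) = B k * sprod B W := by
  rw [sprod, Finset.sort_insert (r := (· ≤ ·)) (fun b hb => (h b hb).le)
    (fun hk => lt_irrefl _ (h k hk))]
  simp [sprod]

theorem erase_insert_min {k j : κ} {W : Finset κ} (h : ∀ w ∈ W, k < w) (hj : j ∈ W) :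
    (insert k W).erase j = insert k (W.erase j) :=
  Finset.erase_insert_of_ne (h j hj).ne

/-- The coefficient with which the `j`-th factor is extracted from an ordered product. -/
def exchCoeff (σ : F) (G : κ → κ → F) (j : κ) (W : Finset κ) : F :=
  ∏ k ∈ W.erase j, if k < j then σ + G k j else 1 + G k j

theorem exchCoeff_insert_self (σ : F) (G : κ → κ → F) {m : κ} {W : Finset κ}
    (h : ∀ w ∈ W, m < w) : exchCoeff σ G m (insert m W) = ∏ k ∈ W, (1 + G k m) := by
  rw [exchCoeff, Finset.erase_insert (fun hk => lt_irrefl _ (h m hk))]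
  exact Finset.prod_congr rfl fun k hk => if_neg (h k hk).not_gt

theorem exchCoeff_insert (σ : F) (G : κ → κ → F) {m j : κ} {W : Finset κ}
    (h : ∀ w ∈ W, m < w) (hj : j ∈ W) :
    exchCoeff σ G j (insert m W) = (σ + G m j) * exchCoeff σ G j W := by
  rw [exchCoeff, erase_insert_min h hj, Finset.prod_insert, if_pos (h j hj), exchCoeff]
  exact fun hk => lt_irrefl _ (h m (Finset.mem_of_mem_erase hk))

/-- The identity satisfied by `G k l = c / (z_k - z_l)`. -/
def IsCross (G : κ → κ → F) : Prop :=
  ∀ x m j, x ≠ m → m ≠ j → x ≠ j → G x m * G m j + G m x * G x j = G x j * G m j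

theorem isCross_div (c : F) (z : κ → F) (hz : Function.Injective z) :
    IsCross fun k l => c / (z k - z l) := by
  intro x m j h1 h2 h3
  have e1 := sub_ne_zero.2 (hz.ne h1)
  have e2 := sub_ne_zero.2 (hz.ne h2)
  have e3 := sub_ne_zero.2 (hz.ne h3)
  have e4 := sub_ne_zero.2 (hz.ne h1.symm)
  field_simp
  ring

/-- The commutation relations of two off-diagonal and diagonal entries `B`, `D` of a row or a
column of a monodromy matrix. -/
structure IsExchange (σ τ : F) (G : κ → κ → F) (B D : κ → R) : Prop where
  BB : ∀ k l, k ≠ l → (1 + G k l) • (B k * B l) = (σ + G k l) • (B l * B k)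
  DB : ∀ k l, k ≠ l → D k * B l = τ • ((1 + G l k) • (B l * D k) + G k l • (B k * D l))

/-- The standard computation of the algebraic Bethe ansatz, by induction on the smallest index `m`
of `W`. A term ending in `D j` arises twice: from `D x` after passing `B m`, and from the `D m`
created in that step. The first has `B m * B x` in front; the factor `1 + G m x` it carries is what
`BB` requires to reorder them without division. The two coefficients then add up by `IsCross`. -/
theorem IsExchange.mul_sprod {σ τ : F} {G : κ → κ → F} {B D : κ → R}
    (hE : IsExchange σ τ G B D) (hG : IsCross G) (W : Finset κ) :
    ∀ x ∉ W, D x * sprod B W = τ ^ W.card • ((∏ k ∈ W, (1 + G k x)) • (sprod B W * D x) +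
      ∑ j ∈ W, (G x j * exchCoeff σ G j W) • (B x * sprod B (W.erase j) * D j)) := by
  induction W using Finset.induction_on_min with
  | empty => intro x _; simp
  | insert m W hm ih =>
    intro x hx
    have hmW : m ∉ W := fun hk => lt_irrefl _ (hm m hk)
    have hxm : x ≠ m := fun h => hx (by simp [h])
    have hxW : x ∉ W := fun h => hx (by simp [h])
    rw [sprod_insert_min B hm, ← mul_assoc, hE.DB x m hxm, Finset.card_insert_of_notMem hmW,
      Finset.prod_insert hmW, Finset.sum_insert hmW, exchCoeff_insert_self σ G hm,
      Finset.erase_insert hmW]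
    have hsum : ∑ j ∈ W, (G x j * exchCoeff σ G j (insert m W)) •
          (B x * sprod B ((insert m W).erase j) * D j) =
        ∑ j ∈ W, (G x j * (σ + G m j) * exchCoeff σ G j W) •
          (B x * (B m * sprod B (W.erase j)) * D j) := by
      refine Finset.sum_congr rfl fun j hj => ?_
      rw [exchCoeff_insert σ G hm hj, erase_insert_min hm hj,
        sprod_insert_min B fun w hw => hm w (Finset.mem_of_mem_erase hw), mul_assoc (G x j)]
    rw [hsum, smul_mul_assoc, add_mul, smul_mul_assoc, smul_mul_assoc, mul_assoc (B m),
      mul_assoc (B x), ih x hxW, ih m hmW]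
    have hterm : ∀ j ∈ W, (G x j * (σ + G m j) * exchCoeff σ G j W) •
          (B x * (B m * sprod B (W.erase j)) * D j) =
        (1 + G m x) • (G x j * exchCoeff σ G j W) • (B m * (B x * sprod B (W.erase j) * D j)) +
          G x m • (G m j * exchCoeff σ G j W) • (B x * (B m * sprod B (W.erase j) * D j)) := by
      intro j hj
      have hmj : m ≠ j := fun h => hmW (h ▸ hj)
      have hxj : x ≠ j := fun h => hxW (h ▸ hj)
      have e := hE.BB m x hxm.symm
      have e' : (1 + G m x) • (B m * (B x * sprod B (W.erase j) * D j)) =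
          (σ + G m x) • (B x * (B m * sprod B (W.erase j) * D j)) := by
        have := congrArg (· * (sprod B (W.erase j) * D j)) e
        simpa only [smul_mul_assoc, mul_assoc] using this
      rw [smul_comm (1 + G m x), e', mul_assoc (B x) (B m * _), smul_smul, smul_smul, ← add_smul]
      congr 1
      linear_combination (-exchCoeff σ G j W) * hG x m j hxm hmj hxj
    rw [Finset.sum_congr rfl hterm, Finset.sum_add_distrib, ← Finset.smul_sum, ← Finset.smul_sum,
      pow_succ']
    simp only [mul_smul_comm, mul_add, Finset.mul_sum, smul_add, smul_smul, mul_assoc,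
      Finset.smul_sum]
    simp only [mul_left_comm _ (τ ^ W.card)]
    abel

/-- `H(W) = ∏_{k < j} h(j, k)` over a finite set. -/
def setH (h : κ → κ → F) (W : Finset κ) : F := ∏ j ∈ W, ∏ k ∈ W with k < j, h j k

theorem setH_insert_min (h : κ → κ → F) {m : κ} {W : Finset κ} (hm : ∀ w ∈ W, m < w) :
    setH h (insert m W) = (∏ k ∈ W, h k m) * setH h W := by
  have hmW : m ∉ W := fun hk => lt_irrefl _ (hm m hk)
  rw [setH, Finset.prod_insert hmW]
  have h1 : (insert m W).filter (· < m) = ∅ := by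
    ext k
    simp only [Finset.mem_filter, Finset.mem_insert, Finset.notMem_empty, iff_false]
    rintro ⟨rfl | hk, hlt⟩
    · exact lt_irrefl _ hlt
    · exact lt_asymm hlt (hm k hk)
  rw [h1, Finset.prod_empty, one_mul, setH, ← Finset.prod_mul_distrib]
  refine Finset.prod_congr rfl fun j hj => ?_
  rw [Finset.filter_insert, if_pos (hm j hj), Finset.prod_insert]
  exact fun hk => hmW (Finset.mem_of_mem_filter _ hk)

/-- The factors of `H` that contain `j` keep the larger index first, so their form depends on the
position of each `k` relative to `j`, just as in `exchCoeff`. -/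
theorem setH_erase (h : κ → κ → F) (W : Finset κ) :
    ∀ j ∈ W, setH h W = (∏ k ∈ W.erase j, if k < j then h j k else h k j) *
      setH h (W.erase j) := by
  induction W using Finset.induction_on_min with
  | empty => simp
  | insert m W hm ih =>
    have hmW : m ∉ W := fun hk => lt_irrefl _ (hm m hk)
    intro j hj
    rcases Finset.mem_insert.1 hj with rfl | hj
    · rw [setH_insert_min h hm, Finset.erase_insert hmW]
      congr 1
      exact Finset.prod_congr rfl fun k hk => (if_neg (hm k hk).not_gt).symm
    · rw [setH_insert_min h hm, erase_insert_min hm hj,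
        setH_insert_min h fun w hw => hm w (Finset.mem_of_mem_erase hw), Finset.prod_insert
        (fun hk => hmW (Finset.mem_of_mem_erase hk)), if_pos (hm j hj), ih j hj,
        ← Finset.mul_prod_erase W (fun k => h k m) hj]
      ring

/-- The normalised ordered product. -/
def nprod (h : κ → κ → F) (B : κ → R) (W : Finset κ) : R := (setH h W)⁻¹ • sprod B W

theorem setH_ne_zero {h : κ → κ → F} (hh : ∀ k l, k ≠ l → h k l ≠ 0) (W : Finset κ) :
    setH h W ≠ 0 :=
  Finset.prod_ne_zero_iff.2 fun _ _ => Finset.prod_ne_zero_iff.2 fun _ hk =>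
    hh _ _ (Finset.mem_filter.1 hk).2.ne'

theorem mul_nprod_of_lt {h : κ → κ → F} (hh : ∀ k l, k ≠ l → h k l ≠ 0) (B : κ → R)
    {m : κ} {W : Finset κ} (hm : ∀ w ∈ W, m < w) :
    B m * nprod h B W = (∏ k ∈ W, h k m) • nprod h B (insert m W) := by
  have : ∏ k ∈ W, h k m ≠ 0 := Finset.prod_ne_zero_iff.2 fun k hk => hh _ _ (hm k hk).ne'
  rw [nprod, nprod, setH_insert_min h hm, sprod_insert_min B hm, mul_smul_comm, smul_smul]
  congr 1
  field_simp

/-- Under these relations a transposition of neighbours multiplies the ordered product and `H` by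
the same factor, so the normalised product does not depend on the order. A factor placed in front
therefore costs the same wherever its index belongs. -/
theorem mul_nprod {h : κ → κ → F} (hh : ∀ k l, k ≠ l → h k l ≠ 0) {B : κ → R}
    (hB : ∀ k l, k ≠ l → h k l • (B k * B l) = h l k • (B l * B k)) (W : Finset κ) :
    ∀ k ∉ W, B k * nprod h B W = (∏ w ∈ W, h w k) • nprod h B (insert k W) := by
  induction W using Finset.induction_on_min with
  | empty => intro k _; exact mul_nprod_of_lt hh B (by simp)
  | insert m W hm ih =>
    intro k hk
    have hmW : m ∉ W := fun hk => lt_irrefl _ (hm m hk)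
    have hkm : k ≠ m := fun h => hk (by simp [h])
    have hkW : k ∉ W := fun h => hk (by simp [h])
    rcases lt_or_gt_of_ne hkm with hlt | hlt
    · refine mul_nprod_of_lt hh B fun w hw => ?_
      rcases Finset.mem_insert.1 hw with rfl | hw
      exacts [hlt, hlt.trans (hm w hw)]
    have hm' : ∀ w ∈ insert k W, m < w := by
      intro w hw
      rcases Finset.mem_insert.1 hw with rfl | hw
      exacts [hlt, hm w hw]
    have hp : ∏ w ∈ W, h w m ≠ 0 := Finset.prod_ne_zero_iff.2 fun k hk => hh _ _ (hm k hk).ne'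
    have e1 : nprod h B (insert m W) = (∏ w ∈ W, h w m)⁻¹ • (B m * nprod h B W) := by
      rw [mul_nprod_of_lt hh B hm, smul_smul, inv_mul_cancel₀ hp, one_smul]
    have e2 : B k * B m = (h m k / h k m) • (B m * B k) := by
      rw [div_eq_inv_mul, mul_smul, ← hB k m hkm, smul_smul, inv_mul_cancel₀ (hh k m hkm),
        one_smul]
    rw [e1, mul_smul_comm, ← mul_assoc, e2, smul_mul_assoc, mul_assoc, ih k hkW, mul_smul_comm,
      mul_nprod_of_lt hh B hm', Finset.prod_insert hkW, Finset.prod_insert hmW,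
      Finset.insert_comm, smul_smul, smul_smul, smul_smul]
    congr 1
    have := hh k m hkm
    field_simp

/-- For σ = -1 one has `-1 + G k j = G k j * h j k` and `1 + G k j = G k j * h k j`. The `h`'s
collected in `exchCoeff` thus form the ratio of `H` of `W` and of `W.erase j`, and normalisation
leaves coefficients that no longer see the order. -/
theorem IsExchange.mul_nprod {τ : F} {G h : κ → κ → F} {B D : κ → R}
    (hE : IsExchange (-1) τ G B D) (hG : IsCross G) (hh : ∀ k l, k ≠ l → h k l ≠ 0)
    (hf : ∀ k l, k ≠ l → 1 + G k l = G k l * h k l) (hanti : ∀ k l, G k l = -G l k)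
    (W : Finset κ) (x : κ) (hx : x ∉ W) :
    D x * nprod h B W = τ ^ W.card • ((∏ k ∈ W, (1 + G k x)) • (nprod h B W * D x) +
      ∑ j ∈ W, (G x j * ∏ k ∈ W.erase j, G k j) • (B x * nprod h B (W.erase j) * D j)) := by
  rw [nprod, mul_smul_comm, hE.mul_sprod hG W x hx, smul_comm _ (τ ^ _), smul_add]
  congr 2
  · rw [smul_mul_assoc, smul_comm]
  · rw [Finset.smul_sum]
    refine Finset.sum_congr rfl fun j hj => ?_
    have h1 : exchCoeff (-1) G j W = (∏ k ∈ W.erase j, G k j) *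
        ∏ k ∈ W.erase j, if k < j then h j k else h k j := by
      rw [exchCoeff, ← Finset.prod_mul_distrib]
      refine Finset.prod_congr rfl fun k hk => ?_
      have hkj : k ≠ j := Finset.ne_of_mem_erase hk
      split_ifs
      · have := hf j k hkj.symm
        rw [hanti j k] at this
        linear_combination -this
      · exact hf k j hkj
    have h2 := setH_ne_zero hh W
    have h3 := setH_ne_zero hh (W.erase j)
    have h4 := setH_erase h W j hj
    rw [nprod, mul_smul_comm, smul_mul_assoc, smul_smul, smul_smul, h1]
    congr 1
    rw [h4] at h2 ⊢
    have h5 := left_ne_zero_of_mul h2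
    field_simp

end Exchange

end SuperBethe
end

noncomputable section
namespace SuperBethe

/-! ### Partial fractions -/

section PartialFractions

open Polynomial

variable {F : Type*} [Field F]

/-- Lagrange interpolation of `N` at the poles is exact because of the degree bound; dividing by the
nodal polynomial gives the claim. -/
theorem partial_fractions {ι : Type*} [DecidableEq ι] (s : Finset ι) (v : ι → F)
    (hv : Set.InjOn v s) (N : F[X]) (hN : N.degree < s.card) (y : F) (hy : ∀ i ∈ s, y ≠ v i) :
    N.eval y * ∏ i ∈ s, (y - v i)⁻¹ =
      ∑ i ∈ s, N.eval (v i) * (y - v i)⁻¹ * ∏ j ∈ s.erase i, (v i - v j)⁻¹ := by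
  have h0 : ∏ i ∈ s, (y - v i) ≠ 0 :=
    Finset.prod_ne_zero_iff.2 fun i hi => sub_ne_zero.2 (hy i hi)
  have h1 := Lagrange.eq_interpolate hv hN
  have h2 : N.eval y = _ := (congrArg (eval y) h1).trans
    (Lagrange.eval_interpolate_not_at_node (fun i => eval (v i) N) hy)
  rw [h2, Lagrange.eval_nodal, Finset.prod_inv_distrib, mul_right_comm, mul_inv_cancel₀ h0,
    one_mul]
  refine Finset.sum_congr rfl fun i _ => ?_
  rw [Lagrange.nodalWeight]
  ring

/-- `g(x, y) = c / (x - y)`. -/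
def gF (c x y : F) : F := c / (x - y)

/-- `f(x, y) = 1 + g(x, y)`. -/
def fF (c x y : F) : F := 1 + gF c x y

/-- `h(x, y) = (x - y + c) / c`. -/
def hF (c x y : F) : F := (x - y + c) / c

theorem gF_eq (c x y : F) : gF c x y = c * (x - y)⁻¹ := div_eq_mul_inv _ _

theorem gF_anti (c x y : F) : gF c x y = -gF c y x := by
  rw [gF_eq, gF_eq, ← neg_sub y x, inv_neg, mul_neg]

theorem fF_eq {c x y : F} (h : x ≠ y) : fF c x y = (x - y + c) * (x - y)⁻¹ := by
  have := sub_ne_zero.2 h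
  rw [fF, gF]; field_simp

theorem fF_eq_mul {c x y : F} (hc : c ≠ 0) (h : x ≠ y) : fF c x y = gF c x y * hF c x y := by
  have := sub_ne_zero.2 h
  rw [fF, gF, hF]; field_simp

theorem hF_self {c : F} (hc : c ≠ 0) (x : F) : hF c x x = 1 := by
  simp [hF, hc]

theorem degree_prod_X_add_C {ι : Type*} (s : Finset ι) (w : ι → F) :
    (∏ i ∈ s, (X + C (w i))).degree = (s.card : WithBot ℕ) := by
  rw [degree_prod_of_monic _ _ fun i _ => monic_X_add_C _]
  simp

/-- Partial fractions in `y`. The poles are simple, at the `v j` with `j ∈ R` and the `u k` with `k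
∈ Q`; the numerator has degree |Q| + |S|. The expression vanishes at infinity precisely because |R|
exceeds |S| by one. -/
theorem prod_gF_mul_fF_mul_hF {ι κ : Type*} [DecidableEq ι] [DecidableEq κ] {c : F}
    {u : ι → F} {v : κ → F} (hu : Function.Injective u) (hv : Function.Injective v)
    (huv : ∀ i j, u i ≠ v j) {R : Finset κ} {S Q : Finset ι} (hRS : R.card = S.card + 1) (y : F)
    (hyu : ∀ i ∈ Q, y ≠ u i) (hyv : ∀ j ∈ R, y ≠ v j) :
    (∏ j ∈ R, gF c (v j) y) * (∏ k ∈ Q, fF c y (u k)) * ∏ l ∈ S, hF c y (u l) =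
      (∑ k ∈ Q, gF c y (u k) * (∏ j ∈ R, gF c (v j) (u k)) *
        (∏ m ∈ Q.erase k, fF c (u k) (u m)) * ∏ l ∈ S, hF c (u k) (u l)) +
      ∑ j ∈ R, gF c (v j) y * (∏ i ∈ R.erase j, gF c (v i) (v j)) *
        (∏ k ∈ Q, fF c (v j) (u k)) * ∏ l ∈ S, hF c (v j) (u l) := by
  set N : F[X] := (∏ k ∈ Q, (X + C (c - u k))) * ∏ l ∈ S, (X + C (c - u l)) with hN
  have hdeg : N.degree < ((R.disjSum Q).card : WithBot ℕ) := by
    rw [hN, degree_mul, degree_prod_X_add_C, degree_prod_X_add_C, Finset.card_disjSum, hRS]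
    norm_cast
    omega
  have heval : ∀ x, N.eval x = (∏ k ∈ Q, (x - u k + c)) * ∏ l ∈ S, (x - u l + c) := by
    intro x
    rw [hN, eval_mul, eval_prod, eval_prod]
    congr 1 <;> exact Finset.prod_congr rfl fun i _ => by simp; ring
  have key := partial_fractions (R.disjSum Q) (Sum.elim v u)
    (by
      have : Function.Injective (Sum.elim v u) := hv.sumElim hu fun a b => (huv b a).symm
      exact this.injOn) N hdeg y (by
      intro i hi
      rcases i with i | i
      · exact hyv i (by simpa using hi)
      · exact hyu i (by simpa using hi))
  have er : ∀ j, (R.disjSum Q).erase (Sum.inl j) = (R.erase j).disjSum Q := by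
    intro j; ext x; rcases x with x | x <;> simp
  have er' : ∀ j, (R.disjSum Q).erase (Sum.inr j) = R.disjSum (Q.erase j) := by
    intro j; ext x; rcases x with x | x <;> simp
  simp only [Finset.sum_disjSum, er, er', Finset.prod_disjSum, Sum.elim_inl, Sum.elim_inr,
    heval] at key
  have hg : ∀ x y, gF c x y = -c * (y - x)⁻¹ := fun x y => by rw [gF_anti, gF_eq, neg_mul]
  have hh : ∀ x y, hF c x y = (x - y + c) * c⁻¹ := fun x y => div_eq_mul_inv _ _
  have e1 : (∏ j ∈ R, gF c (v j) y) * (∏ k ∈ Q, fF c y (u k)) * ∏ l ∈ S, hF c y (u l) =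
      (-c) ^ R.card * (c⁻¹) ^ S.card * (((∏ k ∈ Q, (y - u k + c)) * ∏ l ∈ S, (y - u l + c)) *
        ((∏ j ∈ R, (y - v j)⁻¹) * ∏ k ∈ Q, (y - u k)⁻¹)) := by
    rw [Finset.prod_congr rfl fun k hk => fF_eq (c := c) (hyu k hk)]
    simp only [hg, hh, Finset.prod_mul_distrib, Finset.prod_const]
    ring
  rw [e1, key, mul_add, add_comm, Finset.mul_sum, Finset.mul_sum]
  congr 1
  · refine Finset.sum_congr rfl fun k hk => ?_
    rw [gF_eq c y, Finset.prod_congr rfl fun m hm =>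
      fF_eq (c := c) (hu.ne (Finset.ne_of_mem_erase hm).symm),
      ← Finset.mul_prod_erase Q (fun m => u k - u m + c) hk]
    simp only [hg, hh, Finset.prod_mul_distrib, Finset.prod_const]
    ring
  · refine Finset.sum_congr rfl fun j hj => ?_
    rw [Finset.prod_congr rfl fun k (hk : k ∈ Q) => fF_eq (c := c) (huv k j).symm]
    simp only [hg, hh, Finset.prod_mul_distrib, Finset.prod_const]
    have : R.card = (R.erase j).card + 1 := (Finset.card_erase_add_one hj).symm
    rw [this]
    ring

end PartialFractions

/-! ### The kernel `K` -/

section Kernel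

open Polynomial

variable {F : Type*} [Field F]

theorem setH_map {κ κ' : Type*} [LinearOrder κ] [LinearOrder κ'] (h : κ' → κ' → F)
    (e : κ ↪o κ') (W : Finset κ) :
    setH h (W.map e.toEmbedding) = setH (fun k l => h (e k) (e l)) W := by
  rw [setH, setH, Finset.prod_map]
  refine Finset.prod_congr rfl fun j _ => ?_
  rw [Finset.filter_map, Finset.prod_map]
  refine Finset.prod_congr ?_ fun _ _ => rfl
  ext k
  simp

/-- `K_ℓ(v̄|ū)` as a function of elements of a field. -/
def kernelF (c : F) {ℓ : ℕ} (v u : Fin ℓ → F) : F :=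
  setH (fun j k => gF c (v j) (v k)) Finset.univ * setH (fun j k => gF c (u k) (u j)) Finset.univ *
    (∏ i, ∏ j, hF c (v i) (u j)) *
    (Matrix.of fun j k => gF c (v j) (u k) / hF c (v j) (u k)).det

theorem univ_erase_eq_map {m : ℕ} (p : Fin (m + 1)) :
    Finset.univ.erase p = Finset.univ.map p.succAboveOrderEmb.toEmbedding := by
  ext k
  simp only [Finset.mem_erase, Finset.mem_univ, and_true, Finset.mem_map, true_and]
  exact ⟨fun h => Fin.exists_succAbove_eq h, by rintro ⟨x, rfl⟩; exact Fin.succAbove_ne p x⟩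

theorem prod_erase_succAbove {m : ℕ} (p : Fin (m + 1)) (φ : Fin (m + 1) → F) :
    ∏ k ∈ Finset.univ.erase p, φ k = ∏ k, φ (p.succAbove k) := by
  rw [univ_erase_eq_map, Finset.prod_map]
  rfl

/-- The sign counts the indices below `p`, for which `g` occurs with its arguments in the opposite
order. It will cancel the sign of a cofactor. -/
theorem setH_succAbove (c : F) {m : ℕ} (s : Fin (m + 1) → F) (p : Fin (m + 1)) :
    setH (fun j k => gF c (s k) (s j)) Finset.univ =
      (-1) ^ (p : ℕ) * (∏ q, gF c (s p) (s (p.succAbove q))) *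
        setH (fun j k => gF c (s (p.succAbove k)) (s (p.succAbove j))) Finset.univ := by
  rw [setH_erase _ _ p (Finset.mem_univ p)]
  congr 1
  · rw [← prod_erase_succAbove p (fun q => gF c (s p) (s q))]
    have e : ∀ k ∈ Finset.univ.erase p,
        (if k < p then gF c (s k) (s p) else gF c (s p) (s k)) =
          (if k < p then -1 else 1) * gF c (s p) (s k) := by
      intro k _
      split_ifs
      · rw [gF_anti, neg_one_mul]
      · rw [one_mul]
    rw [Finset.prod_congr rfl e, Finset.prod_mul_distrib, Finset.prod_ite, Finset.prod_const,
      Finset.prod_const_one, mul_one]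
    congr 2
    have : (Finset.univ.erase p).filter (· < p) = Finset.Iio p := by
      ext k
      simp only [Finset.mem_filter, Finset.mem_erase, Finset.mem_univ, and_true, Finset.mem_Iio,
        and_iff_right_iff_imp]
      exact fun h => h.ne
    rw [this, Fin.card_Iio]
  · rw [univ_erase_eq_map, setH_map]
    rfl

/-- The numerator of the row expansion of the determinant in `K` along the first row. -/
def kernelNum (c : F) {m : ℕ} (r : Fin m → F) (s : Fin (m + 1) → F) : F[X] :=
  ∑ p : Fin (m + 1), C ((-1) ^ (p : ℕ) *
      (Matrix.of fun j k => gF c (r j) (s (p.succAbove k)) / hF c (r j) (s (p.succAbove k))).det) *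
    ((∏ q, (X + C (-s (p.succAbove q)))) * ∏ q, (X + C (c - s (p.succAbove q))))

theorem eval_kernelNum (c : F) {m : ℕ} (r : Fin m → F) (s : Fin (m + 1) → F) (y : F) :
    (kernelNum c r s).eval y = ∑ p : Fin (m + 1), (-1) ^ (p : ℕ) *
      (Matrix.of fun j k => gF c (r j) (s (p.succAbove k)) / hF c (r j) (s (p.succAbove k))).det *
      ((∏ q, (y - s (p.succAbove q))) * ∏ q, (y - s (p.succAbove q) + c)) := by
  rw [kernelNum, eval_finsetSum]
  refine Finset.sum_congr rfl fun p _ => ?_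
  simp only [eval_mul, eval_C, eval_prod, eval_add, eval_X]
  congr 2
  · exact Finset.prod_congr rfl fun q _ => by ring
  · exact Finset.prod_congr rfl fun q _ => by ring

/-- Every summand other than the `p`-th contains the factor that vanishes at `s p`. -/
theorem eval_kernelNum_self (c : F) {m : ℕ} (r : Fin m → F) (s : Fin (m + 1) → F)
    (p : Fin (m + 1)) :
    (kernelNum c r s).eval (s p) = (-1) ^ (p : ℕ) *
      (Matrix.of fun j k => gF c (r j) (s (p.succAbove k)) / hF c (r j) (s (p.succAbove k))).det *
      ((∏ q, (s p - s (p.succAbove q))) * ∏ q, (s p - s (p.succAbove q) + c)) := by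
  rw [eval_kernelNum, Finset.sum_eq_single p]
  · intro q _ hq
    obtain ⟨x, hx⟩ := Fin.exists_succAbove_eq hq.symm
    rw [Finset.prod_eq_zero (Finset.mem_univ x) (by rw [hx, sub_self]), zero_mul, mul_zero]
  · simp

theorem degree_kernelNum (c : F) {m : ℕ} (r : Fin m → F) (s : Fin (m + 1) → F) :
    (kernelNum c r s).degree < ((m + m + 1 : ℕ) : WithBot ℕ) := by
  rw [← mem_degreeLT]
  refine Submodule.sum_mem _ fun p _ => ?_
  rw [← smul_eq_C_mul]
  refine Submodule.smul_mem _ _ ?_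
  rw [mem_degreeLT, degree_mul, degree_prod_X_add_C, degree_prod_X_add_C]
  simp only [Finset.card_univ, Fintype.card_fin]
  norm_cast
  omega

/-- The first row has the entries c² / ((y - s p)(y - s p + c)), so clearing all these denominators
in the expansion along this row leaves a polynomial in `y`. -/
theorem det_cons_mul (c : F) (hc : c ≠ 0) {m : ℕ} (r : Fin m → F) (s : Fin (m + 1) → F) (y : F)
    (hy : ∀ p, y ≠ s p) (hy' : ∀ p, y - s p + c ≠ 0) :
    (Matrix.of fun j k => gF c ((Fin.cons y r : Fin (m + 1) → F) j) (s k) /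
        hF c ((Fin.cons y r : Fin (m + 1) → F) j) (s k)).det *
      ((∏ p, (y - s p)) * ∏ p, (y - s p + c)) = c ^ 2 * (kernelNum c r s).eval y := by
  rw [Matrix.det_succ_row_zero, eval_kernelNum, Finset.sum_mul, Finset.mul_sum]
  refine Finset.sum_congr rfl fun p _ => ?_
  rw [Fin.prod_univ_succAbove (fun q => y - s q) p, Fin.prod_univ_succAbove (fun q => y - s q + c) p]
  have e : (Matrix.of fun j k => gF c ((Fin.cons y r : Fin (m + 1) → F) j) (s k) /
        hF c ((Fin.cons y r : Fin (m + 1) → F) j) (s k)).submatrix Fin.succ p.succAbove =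
      Matrix.of fun j k => gF c (r j) (s (p.succAbove k)) / hF c (r j) (s (p.succAbove k)) := by
    ext j k
    simp
  rw [e]
  have h1 := sub_ne_zero.2 (hy p)
  have h2 := hy' p
  simp only [Matrix.of_apply, Fin.cons_zero, gF, hF]
  field_simp

theorem setH_cons (h : F → F → F) {m : ℕ} (y : F) (r : Fin m → F) :
    setH (fun j k => h ((Fin.cons y r : Fin (m + 1) → F) j) ((Fin.cons y r : Fin (m + 1) → F) k))
      Finset.univ = (∏ i, h (r i) y) * setH (fun j k => h (r j) (r k)) Finset.univ := by
  rw [setH, setH, Fin.prod_univ_succ, ← Finset.prod_mul_distrib]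
  have e0 : (Finset.univ : Finset (Fin (m + 1))).filter (· < 0) = ∅ := by
    ext k; simp
  rw [e0, Finset.prod_empty, one_mul]
  refine Finset.prod_congr rfl fun i _ => ?_
  have e1 : (Finset.univ : Finset (Fin (m + 1))).filter (· < i.succ) =
      insert 0 ((Finset.univ.filter (· < i)).map (Fin.succEmb m)) := by
    ext k
    refine Fin.cases ?_ (fun k => ?_) k <;> simp
  rw [e1, Finset.prod_insert (by simp), Finset.prod_map]
  simp

/-- The poles of the determinant at `y = s p - c` are cancelled by the zeros of h(y, s p). As a
function of its first argument, K can only have poles at the `s p` and, through the factors g(r i,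
y), at the `r i`. -/
theorem kernelF_cons (c : F) (hc : c ≠ 0) {m : ℕ} (r : Fin m → F) (s : Fin (m + 1) → F) (y : F)
    (hy : ∀ p, y ≠ s p) (hy' : ∀ p, y - s p + c ≠ 0) :
    kernelF c (Fin.cons y r : Fin (m + 1) → F) s =
      setH (fun j k => gF c (r j) (r k)) Finset.univ *
        setH (fun j k => gF c (s k) (s j)) Finset.univ * (∏ i, ∏ j, hF c (r i) (s j)) *
        ((-c) ^ m * c * (c⁻¹) ^ m) * ((kernelNum c r s).eval y *
          ((∏ p, (y - s p)⁻¹) * ∏ i, (y - r i)⁻¹)) := by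
  have h1 : ∏ p, (y - s p) ≠ 0 := Finset.prod_ne_zero_iff.2 fun p _ => sub_ne_zero.2 (hy p)
  have hdet := det_cons_mul c hc r s y hy hy'
  have e1 : ∏ i, gF c (r i) y = (-c) ^ m * ∏ i, (y - r i)⁻¹ := by
    simp [gF_anti c _ y, gF_eq c y, Finset.prod_mul_distrib, ← neg_mul]
  have e2 : ∏ p, hF c y (s p) = (∏ p, (y - s p + c)) * (c⁻¹) ^ (m + 1) := by
    simp [hF, div_eq_mul_inv, Finset.prod_mul_distrib]
  rw [kernelF, setH_cons (fun a b => gF c a b), e1, Fin.prod_univ_succ, Fin.cons_zero, e2]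
  simp only [Fin.cons_succ]
  generalize hd : Matrix.det (R := F) (n := Fin (m + 1)) _ = d at hdet ⊢
  simp only [Finset.prod_inv_distrib]
  have e3 : (∏ p, (y - s p + c)) * d = c ^ 2 * (kernelNum c r s).eval y * (∏ p, (y - s p))⁻¹ := by
    rw [← hdet]; field_simp
  have e4 : (c⁻¹) ^ (m + 1) * c ^ 2 = c * (c⁻¹) ^ m := by
    rw [pow_succ]; field_simp
  generalize (setH (fun j k => gF c (r j) (r k)) Finset.univ : F) = A₁
  generalize (setH (fun j k => gF c (s k) (s j)) Finset.univ : F) = A₂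
  generalize (∏ i, (y - r i))⁻¹ = A₃
  generalize ∏ i, ∏ j, hF c (r i) (s j) = A₄
  generalize (∏ p, (y - s p))⁻¹ = A₅ at *
  linear_combination (A₁ * A₂ * A₃ * (-c) ^ m * (c⁻¹) ^ (m + 1) * A₄) * e3 +
    (A₁ * A₂ * A₃ * (-c) ^ m * A₄ * (kernelNum c r s).eval y * A₅) * e4

/-- The coefficient at the pole `y = s p`. One cofactor survives, and it is the determinant of the
smaller kernel; its sign cancels against that of `setH_succAbove`. -/
theorem kernelF_residue (c : F) (hc : c ≠ 0) {m : ℕ} (r : Fin m → F) (s : Fin (m + 1) → F)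
    (hs : Function.Injective s) (hrs : ∀ i p, r i ≠ s p) (p : Fin (m + 1)) :
    setH (fun j k => gF c (r j) (r k)) Finset.univ *
        setH (fun j k => gF c (s k) (s j)) Finset.univ * (∏ i, ∏ j, hF c (r i) (s j)) *
        ((-c) ^ m * c * (c⁻¹) ^ m) * ((kernelNum c r s).eval (s p) *
          ((∏ q, (s p - s (p.succAbove q))⁻¹) * ∏ i, (s p - r i)⁻¹)) =
      c * ((∏ q, fF c (s p) (s (p.succAbove q))) * (∏ i, fF c (r i) (s p)) *
        kernelF c r (fun q => s (p.succAbove q))) := by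
  have e1 : ∏ q, fF c (s p) (s (p.succAbove q)) =
      (∏ q, (s p - s (p.succAbove q) + c)) * ∏ q, (s p - s (p.succAbove q))⁻¹ := by
    rw [← Finset.prod_mul_distrib]
    exact Finset.prod_congr rfl fun q _ => fF_eq (hs.ne (Fin.succAbove_ne p q).symm)
  have e2 : ∏ i, fF c (r i) (s p) = (-1) ^ m * (∏ i, (r i - s p + c)) * ∏ i, (s p - r i)⁻¹ := by
    have : (-1 : F) ^ m = ∏ _i : Fin m, (-1 : F) := by simp
    rw [this, ← Finset.prod_mul_distrib, ← Finset.prod_mul_distrib]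
    refine Finset.prod_congr rfl fun i _ => ?_
    rw [fF_eq (hrs i p), ← neg_sub (s p) (r i), inv_neg]
    ring
  have e3 : ∏ i, ∏ j, hF c (r i) (s j) = (∏ i, (r i - s p + c)) * (c⁻¹) ^ m *
      ∏ i, ∏ j, hF c (r i) (s (p.succAbove j)) := by
    simp_rw [fun i => Fin.prod_univ_succAbove (fun j => hF c (r i) (s j)) p]
    simp [Finset.prod_mul_distrib, hF, div_eq_mul_inv]
  have e4 : ∏ q, gF c (s p) (s (p.succAbove q)) = c ^ m * ∏ q, (s p - s (p.succAbove q))⁻¹ := by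
    simp [gF_eq, Finset.prod_mul_distrib]
  have e5 : (∏ q, (s p - s (p.succAbove q))) * ∏ q, (s p - s (p.succAbove q))⁻¹ = 1 := by
    rw [← Finset.prod_mul_distrib]
    exact Finset.prod_eq_one fun q _ =>
      mul_inv_cancel₀ (sub_ne_zero.2 (hs.ne (Fin.succAbove_ne p q).symm))
  have e6 : c ^ m * (c⁻¹) ^ m = 1 := by rw [← mul_pow, mul_inv_cancel₀ hc, one_pow]
  have e7 : ((-1 : F) ^ (p : ℕ)) * (-1) ^ (p : ℕ) = 1 := by
    rw [← mul_pow]; simp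
  have e8 : (-c) ^ m = (-1) ^ m * c ^ m := by rw [← mul_pow, neg_one_mul]
  rw [setH_succAbove c s p, eval_kernelNum_self, kernelF, e1, e2, e3, e4, e8]
  generalize Matrix.det (R := F) (n := Fin m) _ = d
  generalize (∏ i, ∏ j, hF c (r i) (s (p.succAbove j))) = h1
  generalize (∏ i, (r i - s p + c)) = h2 at *
  generalize ∏ q, (s p - s (p.succAbove q) + c) = h3 at *
  generalize ∏ i, (s p - r i)⁻¹ = h4 at *
  generalize ∏ q, (s p - s (p.succAbove q))⁻¹ = h5 at *
  generalize ∏ q, (s p - s (p.succAbove q)) = h6 at *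
  generalize (setH (fun j k => gF c (r j) (r k)) Finset.univ : F) = h7
  generalize (setH (fun j k => gF c (s (p.succAbove k)) (s (p.succAbove j))) Finset.univ : F) = h8
  generalize (-1 : F) ^ (p : ℕ) = e at *
  generalize (-1 : F) ^ m = e' at *
  generalize c ^ m = h9 at *
  generalize c⁻¹ ^ m = h10 at *
  calc _ = (e * e) * (h6 * h5) * (h9 * h10) ^ 2 *
        (c * (h3 * h5 * (e' * h2 * h4) * (h7 * h8 * h1 * d))) := by ring
    _ = _ := by rw [e5, e6, e7]; ring

/-- Partial fractions in `y` of the kernel times the product of f(v j, y). The poles at the `s p`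
reduce the size of the kernel by one, and the pole at `v j` replaces the argument `y` by `v j`. -/
theorem kernelF_mul_prod_fF {ι : Type*} [DecidableEq ι] (c : F) (hc : c ≠ 0) {m : ℕ}
    (r : Fin m → F) (s : Fin (m + 1) → F) (v : ι → F) (Q : Finset ι) (y : F)
    (hs : Function.Injective s) (hr : Function.Injective r) (hv : Function.Injective v)
    (hrs : ∀ i p, r i ≠ s p) (hrv : ∀ i, ∀ j ∈ Q, r i ≠ v j) (hsv : ∀ p, ∀ j, s p ≠ v j)
    (hys : ∀ p, y ≠ s p) (hys' : ∀ p, y - s p + c ≠ 0) (hyr : ∀ i, y ≠ r i)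
    (hyv : ∀ j ∈ Q, y ≠ v j)
    (hrs' : ∀ i p, r i - s p + c ≠ 0) (hvs' : ∀ j, ∀ p, v j - s p + c ≠ 0) :
    kernelF c (Fin.cons y r : Fin (m + 1) → F) s * ∏ j ∈ Q, fF c (v j) y =
      (∑ p, gF c y (s p) * (∏ q, fF c (s p) (s (p.succAbove q))) * (∏ j ∈ Q, fF c (v j) (s p)) *
        (∏ i, fF c (r i) (s p)) * kernelF c r (fun q => s (p.succAbove q))) -
      ∑ j ∈ Q, gF c y (v j) * (∏ i ∈ Q.erase j, fF c (v i) (v j)) *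
        kernelF c (Fin.cons (v j) r : Fin (m + 1) → F) s := by
  set A := setH (fun j k => gF c (r j) (r k)) Finset.univ *
        setH (fun j k => gF c (s k) (s j)) Finset.univ * (∏ i, ∏ j, hF c (r i) (s j)) *
        ((-c) ^ m * c * (c⁻¹) ^ m) with hA
  set N : F[X] := kernelNum c r s * ∏ j ∈ Q, (X + C (-v j - c)) with hN
  have heval : ∀ x, N.eval x = (kernelNum c r s).eval x * ∏ j ∈ Q, (x - v j - c) := by
    intro x
    rw [hN, eval_mul, eval_prod]
    congr 1
    exact Finset.prod_congr rfl fun i _ => by simp; ring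
  set nodes : Finset (Fin (m + 1) ⊕ (Fin m ⊕ ι)) :=
    Finset.univ.disjSum (Finset.univ.disjSum Q) with hnodes
  -- The numerator has degree at most 2m + |Q|, against 2m + 1 + |Q| nodes.
  have hdeg : N.degree < (nodes.card : WithBot ℕ) := by
    rw [hN, degree_mul, degree_prod_X_add_C, hnodes, Finset.card_disjSum, Finset.card_disjSum]
    have h1 := degree_kernelNum c r s
    rcases hd : (kernelNum c r s).degree with _ | d
    · exact (WithBot.bot_add _).trans_lt (WithBot.bot_lt_coe _)
    · rw [hd] at h1
      have h2 : d < m + m + 1 := WithBot.coe_lt_coe.1 h1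
      have h3 : d + Q.card < (Finset.univ : Finset (Fin (m + 1))).card +
          ((Finset.univ : Finset (Fin m)).card + Q.card) := by
        simp only [Finset.card_univ, Fintype.card_fin]
        omega
      exact WithBot.coe_lt_coe.2 h3
  have hinj : Set.InjOn (Sum.elim s (Sum.elim r v)) nodes := by
    rintro (a | a | a) ha (b | b | b) hb h <;>
      simp only [Sum.elim_inl, Sum.elim_inr, hnodes, Finset.mem_coe, Finset.inr_mem_disjSum]
        at h ha hb
    · rw [hs h]
    · exact absurd h.symm (hrs b a)
    · exact absurd h (hsv a b)
    · exact absurd h (hrs a b)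
    · rw [hr h]
    · exact absurd h (hrv a b hb)
    · exact absurd h.symm (hsv b a)
    · exact absurd h.symm (hrv b a ha)
    · rw [hv h]
  have hynode : ∀ i ∈ nodes, y ≠ Sum.elim s (Sum.elim r v) i := by
    rintro (a | a | a) ha
    · exact hys a
    · exact hyr a
    · exact hyv a (by simpa [hnodes] using ha)
  have key := partial_fractions nodes _ hinj N hdeg y hynode
  have er1 : ∀ p, nodes.erase (Sum.inl p) = (Finset.univ.erase p).disjSum
      ((Finset.univ : Finset (Fin m)).disjSum Q) := by
    intro j; ext x; rcases x with x | x | x <;> simp [hnodes]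
  have er2 : ∀ j, nodes.erase (Sum.inr (Sum.inr j)) =
      (Finset.univ : Finset (Fin (m + 1))).disjSum
        ((Finset.univ : Finset (Fin m)).disjSum (Q.erase j)) := by
    intro j; ext x; rcases x with x | x | x <;> simp [hnodes]
  -- The poles at the `r i` are only apparent: there the first row of the determinant repeats a
  -- later one.
  have hzero : ∀ i, N.eval (r i) = 0 := by
    intro i
    have hd := det_cons_mul c hc r s (r i) (hrs i) (hrs' i)
    rw [Matrix.det_zero_of_row_eq (i := 0) (j := i.succ) (Fin.succ_ne_zero i).symm
      (by ext k; simp), zero_mul] at hd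
    rw [heval, (mul_eq_zero.1 hd.symm).resolve_left (pow_ne_zero 2 hc), zero_mul]
  have hf : ∀ x j, x ≠ v j → fF c (v j) x = (x - v j - c) * (x - v j)⁻¹ := by
    intro x j hx
    rw [fF_eq hx.symm, ← neg_sub x (v j), inv_neg]
    ring
  have e1 : kernelF c (Fin.cons y r : Fin (m + 1) → F) s * ∏ j ∈ Q, fF c (v j) y =
      A * (N.eval y * ∏ i ∈ nodes, (y - Sum.elim s (Sum.elim r v) i)⁻¹) := by
    rw [kernelF_cons c hc r s y hys hys', Finset.prod_congr rfl fun j hj => hf y j (hyv j hj),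
      Finset.prod_mul_distrib, heval, hnodes]
    simp only [Finset.prod_disjSum, Sum.elim_inl, Sum.elim_inr]
    ring
  rw [e1, key, hnodes]
  simp only [Finset.sum_disjSum, Sum.elim_inl, Sum.elim_inr, hzero, zero_mul,
    Finset.sum_const_zero, zero_add]
  rw [← hnodes, mul_add, sub_eq_add_neg, Finset.mul_sum, Finset.mul_sum, ← Finset.sum_neg_distrib]
  congr 1
  · refine Finset.sum_congr rfl fun p _ => ?_
    have hres := kernelF_residue c hc r s hs hrs p
    rw [← hA] at hres
    rw [er1, Finset.prod_disjSum, Finset.prod_disjSum, heval,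
      Finset.prod_congr rfl fun j (_ : j ∈ Q) => hf (s p) j (hsv p j), Finset.prod_mul_distrib,
      gF_eq]
    simp only [Sum.elim_inl, Sum.elim_inr]
    rw [prod_erase_succAbove p fun q => (s p - s q)⁻¹]
    linear_combination ((y - s p)⁻¹ * (∏ j ∈ Q, (s p - v j - c)) * ∏ j ∈ Q, (s p - v j)⁻¹) * hres
  · refine Finset.sum_congr rfl fun j hj => ?_
    rw [er2, Finset.prod_disjSum, Finset.prod_disjSum, heval,
      Finset.prod_congr rfl fun i hi => hf (v j) i (hv.ne (Finset.ne_of_mem_erase hi).symm),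
      Finset.prod_mul_distrib, gF_eq, ← Finset.mul_prod_erase Q (fun i => v j - v i - c) hj,
      kernelF_cons c hc r s (v j) (fun p => (hsv p j).symm) (hvs' j)]
    simp only [Sum.elim_inl, Sum.elim_inr]
    ring

end Kernel

end SuperBethe
end

noncomputable section
namespace SuperBethe

/-! ### Sums over pairs of subsets -/

section PowersetSums

variable {κ M : Type*} [DecidableEq κ] [AddCommMonoid M]

/-- The bijection sends `(S, k)` with `k ∈ S` to `(k, S.erase k)`. Together with the next lemma it
brings sums over "one element leaves" and "one element joins" to the same index set. -/
theorem sum_powerset_sum_erase (U : Finset κ) (φ : κ → Finset κ → M) :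
    ∑ S ∈ U.powerset, ∑ k ∈ S, φ k (S.erase k) = ∑ k ∈ U, ∑ S ∈ (U.erase k).powerset, φ k S := by
  rw [Finset.sum_sigma', Finset.sum_sigma']
  refine Finset.sum_bij' (fun x _ => ⟨x.2, x.1.erase x.2⟩) (fun x _ => ⟨insert x.1 x.2, x.1⟩)
    ?_ ?_ ?_ ?_ ?_
  · rintro ⟨S, k⟩ h
    simp only [Finset.mem_sigma, Finset.mem_powerset] at h ⊢
    exact ⟨h.1 h.2, Finset.erase_subset_erase _ h.1⟩
  · rintro ⟨k, S⟩ h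
    simp only [Finset.mem_sigma, Finset.mem_powerset] at h ⊢
    exact ⟨Finset.insert_subset h.1 (h.2.trans (Finset.erase_subset _ _)),
      Finset.mem_insert_self _ _⟩
  · rintro ⟨S, k⟩ h
    simp only [Finset.mem_sigma, Finset.mem_powerset] at h
    simp [Finset.insert_erase h.2]
  · rintro ⟨k, S⟩ h
    simp only [Finset.mem_sigma, Finset.mem_powerset] at h
    have : k ∉ S := fun hk => Finset.notMem_erase k U (h.2 hk)
    simp [Finset.erase_insert this]
  · rintro ⟨S, k⟩ _
    rfl

theorem sum_powerset_sum_sdiff (U : Finset κ) (φ : κ → Finset κ → M) :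
    ∑ S ∈ U.powerset, ∑ k ∈ U \ S, φ k S = ∑ k ∈ U, ∑ S ∈ (U.erase k).powerset, φ k S := by
  refine Finset.sum_comm' fun S k => ?_
  simp only [Finset.mem_powerset, Finset.mem_sdiff, Finset.subset_erase]
  tauto

end PowersetSums

theorem erase_sdiff_erase {κ : Type*} [DecidableEq κ] {W R : Finset κ} {j : κ} (hj : j ∈ R) :
    W.erase j \ R.erase j = W \ R := by
  ext k
  simp only [Finset.mem_sdiff, Finset.mem_erase, not_and]
  constructor
  · rintro ⟨⟨h1, h2⟩, h3⟩
    exact ⟨h2, h3 h1⟩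
  · rintro ⟨h1, h2⟩
    have : k ≠ j := fun h => h2 (h ▸ hj)
    exact ⟨⟨this, h1⟩, fun _ => h2⟩

theorem insert_sdiff_insert_of_notMem {κ : Type*} [DecidableEq κ] {U S : Finset κ} {y : κ}
    (hy : y ∉ U) : insert y U \ insert y S = U \ S := by
  ext k
  simp only [Finset.mem_sdiff, Finset.mem_insert, not_or]
  constructor
  · rintro ⟨rfl | h, h1, h2⟩
    exacts [absurd rfl h1, ⟨h, h2⟩]
  · rintro ⟨h1, h2⟩
    exact ⟨Or.inr h1, fun h => hy (h ▸ h1), h2⟩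

section Explicit

variable {κ κ' F A V : Type*} [LinearOrder κ] [LinearOrder κ'] [Field F] [Ring A] [Algebra F A]
  [AddCommGroup V] [Module A V] [Module F V] [IsScalarTower F A V]

/-! ### The first explicit expression over finite sets -/

def coeff₁ (c : F) (zu : κ → F) (zv : κ' → F) (U S : Finset κ) (W R : Finset κ') : F :=
  (∏ j ∈ R, ∏ i ∈ S, gF c (zv j) (zu i)) * (∏ i ∈ S, ∏ k ∈ U \ S, fF c (zu i) (zu k)) *
    (∏ j ∈ W \ R, ∏ i ∈ R, gF c (zv j) (zv i)) * ∏ i ∈ S, ∏ k ∈ S, hF c (zu i) (zu k)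

/-- Up to a factor free of `zu y`, this is `prod_gF_mul_fF_mul_hF` with `Q = U \ S`. At the pole `zu
k` the index `k` takes the place of `y` in the first part; at the pole `zv j` the index `j` leaves
`R`. The factorisation f = g h lets the remaining products reassemble into coefficients of smaller
partitions. -/
theorem coeff₁_insert {c : F} (hc : c ≠ 0) {zu : κ → F} {zv : κ' → F}
    (hu : Function.Injective zu) (hv : Function.Injective zv) (huv : ∀ i j, zu i ≠ zv j)
    (huu : ∀ i j, i ≠ j → hF c (zu i) (zu j) ≠ 0) {U S : Finset κ} {W R : Finset κ'} {y : κ}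
    (hyU : y ∉ U) (hS : S ⊆ U) (hR : R ⊆ W) (hcard : R.card = S.card + 1) :
    coeff₁ c zu zv (insert y U) (insert y S) W R * (∏ l ∈ S, hF c (zu l) (zu y))⁻¹ =
      (∑ k ∈ U \ S, (gF c (zu y) (zu k) * ∏ l ∈ S, gF c (zu l) (zu k)) *
        coeff₁ c zu zv U (insert k S) W R) +
      ∑ j ∈ R, (gF c (zv j) (zu y) * (∏ k ∈ W.erase j, gF c (zv k) (zv j)) *
        ∏ i ∈ U, fF c (zv j) (zu i)) * coeff₁ c zu zv U S (W.erase j) (R.erase j) := by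
  have hyS : y ∉ S := fun h => hyU (hS h)
  set Cc := (∏ j ∈ R, ∏ i ∈ S, gF c (zv j) (zu i)) *
    (∏ i ∈ S, ∏ k ∈ U \ S, fF c (zu i) (zu k)) *
    (∏ j ∈ W \ R, ∏ i ∈ R, gF c (zv j) (zv i)) * ∏ i ∈ S, ∏ k ∈ S, hF c (zu i) (zu k) with hCc
  have key := prod_gF_mul_fF_mul_hF (c := c) hu hv huv hcard (Q := U \ S) (zu y)
    (fun i hi => hu.ne fun h => hyU (h ▸ (Finset.mem_sdiff.1 hi).1)) (fun j _ => huv y j)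
  have e1 : coeff₁ c zu zv (insert y U) (insert y S) W R * (∏ l ∈ S, hF c (zu l) (zu y))⁻¹ =
      Cc * ((∏ j ∈ R, gF c (zv j) (zu y)) * (∏ k ∈ U \ S, fF c (zu y) (zu k)) *
        ∏ l ∈ S, hF c (zu y) (zu l)) := by
    have hne : ∏ l ∈ S, hF c (zu l) (zu y) ≠ 0 :=
      Finset.prod_ne_zero_iff.2 fun l hl => huu _ _ fun h => hyS (h ▸ hl)
    rw [coeff₁, insert_sdiff_insert_of_notMem hyU]
    simp only [Finset.prod_insert hyS, Finset.prod_mul_distrib, hF_self hc, one_mul]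
    rw [hCc]
    field_simp
  rw [e1, key, mul_add, Finset.mul_sum, Finset.mul_sum]
  congr 1
  · refine Finset.sum_congr rfl fun k hk => ?_
    have hkS := (Finset.mem_sdiff.1 hk).2
    have hsd : U \ insert k S = (U \ S).erase k := by
      rw [Finset.sdiff_insert]
    have h1 : ∏ i ∈ S, ∏ m ∈ U \ S, fF c (zu i) (zu m) =
        (∏ l ∈ S, gF c (zu l) (zu k)) * (∏ l ∈ S, hF c (zu l) (zu k)) *
          ∏ i ∈ S, ∏ m ∈ (U \ S).erase k, fF c (zu i) (zu m) := by
      rw [← Finset.prod_mul_distrib, ← Finset.prod_mul_distrib]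
      refine Finset.prod_congr rfl fun i hi => ?_
      rw [← Finset.mul_prod_erase _ _ hk,
        fF_eq_mul hc (hu.ne (show i ≠ k from fun h => hkS (h ▸ hi)))]
    rw [coeff₁, hsd, hCc, h1]
    simp only [Finset.prod_insert hkS, Finset.prod_mul_distrib, hF_self hc, one_mul]
    ring
  · refine Finset.sum_congr rfl fun j hj => ?_
    have hsd := erase_sdiff_erase (W := W) hj
    have hWs : ∏ k ∈ W.erase j, gF c (zv k) (zv j) =
        (∏ k ∈ W \ R, gF c (zv k) (zv j)) * ∏ k ∈ R.erase j, gF c (zv k) (zv j) := by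
      rw [← hsd, Finset.prod_sdiff (Finset.erase_subset_erase j hR)]
    have hUs : ∏ i ∈ U, fF c (zv j) (zu i) = (∏ i ∈ U \ S, fF c (zv j) (zu i)) *
        ((∏ i ∈ S, gF c (zv j) (zu i)) * ∏ i ∈ S, hF c (zv j) (zu i)) := by
      rw [← Finset.prod_mul_distrib, ← Finset.prod_sdiff hS]
      congr 1
      exact Finset.prod_congr rfl fun i _ => fF_eq_mul hc (huv i j).symm
    have h1 : ∏ k ∈ W \ R, ∏ i ∈ R, gF c (zv k) (zv i) =
        (∏ k ∈ W \ R, gF c (zv k) (zv j)) * ∏ k ∈ W \ R, ∏ i ∈ R.erase j, gF c (zv k) (zv i) := by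
      rw [← Finset.prod_mul_distrib]
      exact Finset.prod_congr rfl fun k _ => (Finset.mul_prod_erase _ _ hj).symm
    rw [coeff₁, hsd, hCc, hWs, hUs, h1,
      ← Finset.mul_prod_erase R (fun j => ∏ i ∈ S, gF c (zv j) (zu i)) hj]
    ring

/-- The sum over partitions in the first explicit expression, over finite sets of indices. -/
def partitionSum₁ (c : F) (zu : κ → F) (zv : κ' → F) (t₁₂ t₁₃ : κ → A) (t₂₃ : κ' → A)
    (lam : κ' → F) (Ω : V) (U : Finset κ) (W : Finset κ') : V :=
  ∑ S ∈ U.powerset, ∑ R ∈ W.powerset, if R.card = S.card then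
    (coeff₁ c zu zv U S W R * ∏ j ∈ R, lam j) •
      ((nprod (fun i k => hF c (zu i) (zu k)) t₁₃ S * sprod t₁₂ (U \ S) *
        nprod (fun i k => hF c (zv i) (zv k)) t₂₃ (W \ R)) • Ω) else 0

theorem mul_sprod_of_commute (F : Type*) [Field F] [Algebra F A] {B : κ → A} (hB : ∀ k l, B k * B l = B l * B k) (W : Finset κ) (k : κ)
    (hk : k ∉ W) : B k * sprod B W = sprod B (insert k W) := by
  have h1 : ∀ W : Finset κ, nprod (fun _ _ => (1 : F)) B W = sprod B W := fun W => by
    simp [nprod, setH]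
  have := mul_nprod (F := F) (h := fun _ _ => 1) (by simp) (B := B)
    (fun k l _ => by simpa using hB k l) W k hk
  simpa [h1] using this

/-- The left side is split by whether `y` belongs to the first part. If not, the term is the wanted
term of moving `t₁₂ y` past the `t₁₃`'s. If so, `coeff₁_insert` splits the coefficient, and its
first sum reproduces the unwanted terms of that move. -/
theorem partitionSum₁_insert {c : F} (hc : c ≠ 0) {zu : κ → F} {zv : κ' → F}
    (hu : Function.Injective zu) (hv : Function.Injective zv) (huv : ∀ i j, zu i ≠ zv j)
    (huu : ∀ i j, i ≠ j → hF c (zu i) (zu j) ≠ 0) {t₁₂ t₁₃ : κ → A} (t₂₃ : κ' → A)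
    (hE : IsExchange (-1) 1 (fun i k => gF c (zu i) (zu k)) t₁₃ t₁₂)
    (ht : ∀ k l, t₁₂ k * t₁₂ l = t₁₂ l * t₁₂ k)
    (lam : κ' → F) (Ω : V) {U : Finset κ} (W : Finset κ') {y : κ} (hy : ∀ k ∈ U, y < k) :
    partitionSum₁ c zu zv t₁₂ t₁₃ t₂₃ lam Ω (insert y U) W =
      t₁₂ y • partitionSum₁ c zu zv t₁₂ t₁₃ t₂₃ lam Ω U W +
      t₁₃ y • ∑ j ∈ W, (gF c (zv j) (zu y) * (∏ k ∈ W.erase j, gF c (zv k) (zv j)) *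
        (∏ i ∈ U, fF c (zv j) (zu i)) * lam j) •
          partitionSum₁ c zu zv t₁₂ t₁₃ t₂₃ lam Ω U (W.erase j) := by
  have hyU : y ∉ U := fun h => lt_irrefl _ (hy y h)
  set hu' : κ → κ → F := fun i k => hF c (zu i) (zu k) with hhu
  set hv' : κ' → κ' → F := fun i k => hF c (zv i) (zv k) with hhv
  have hh : ∀ k l, k ≠ l → hu' k l ≠ 0 := huu
  set v₂ : Finset κ → Finset κ' → V := fun S R =>
    (t₁₃ y * nprod hu' t₁₃ S * sprod t₁₂ (U \ S) * nprod hv' t₂₃ (W \ R)) • Ω with hv₂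
  -- All terms in play are multiples of the vectors `v₂ S R`; `T S R x` records the coefficient and
  -- is additive in it, so partial fractions can be inserted under the sums.
  set T : Finset κ → Finset κ' → F → V := fun S R x =>
    if R.card = S.card + 1 then (x * ∏ j ∈ R, lam j) • v₂ S R else 0 with hT
  have hTadd : ∀ S R x x', T S R (x + x') = T S R x + T S R x' := by
    intro S R x x'
    simp only [hT]
    split_ifs
    · rw [add_mul, add_smul]
    · simp
  have hTsum₁ : ∀ (s : Finset κ) S R (x : κ → F),
      T S R (∑ i ∈ s, x i) = ∑ i ∈ s, T S R (x i) := by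
    intro s S R x
    simp only [hT]
    split_ifs
    · rw [Finset.sum_mul, Finset.sum_smul]
    · simp
  have hTsum₂ : ∀ (s : Finset κ') S R (x : κ' → F),
      T S R (∑ i ∈ s, x i) = ∑ i ∈ s, T S R (x i) := by
    intro s S R x
    simp only [hT]
    split_ifs
    · rw [Finset.sum_mul, Finset.sum_smul]
    · simp
  -- the terms with `y ∈ S` on the left-hand side
  have hL2 : ∀ S ∈ U.powerset, ∀ R ∈ W.powerset, (if R.card = (insert y S).card then
      (coeff₁ c zu zv (insert y U) (insert y S) W R * ∏ j ∈ R, lam j) •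
      ((nprod hu' t₁₃ (insert y S) * sprod t₁₂ (insert y U \ insert y S) *
        nprod hv' t₂₃ (W \ R)) • Ω) else 0) =
      T S R (∑ k ∈ U \ S, (gF c (zu y) (zu k) * ∏ l ∈ S, gF c (zu l) (zu k)) *
        coeff₁ c zu zv U (insert k S) W R) +
      T S R (∑ j ∈ R, (gF c (zv j) (zu y) * (∏ k ∈ W.erase j, gF c (zv k) (zv j)) *
        ∏ i ∈ U, fF c (zv j) (zu i)) * coeff₁ c zu zv U S (W.erase j) (R.erase j)) := by
    intro S hS R hR
    rw [Finset.mem_powerset] at hS hR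
    have hyS : y ∉ S := fun h => hyU (hS h)
    rw [← hTadd, Finset.card_insert_of_notMem hyS]
    simp only [hT]
    split_ifs with hcard
    · rw [← coeff₁_insert hc hu hv huv huu hyU hS hR hcard]
      have hm := mul_nprod_of_lt hh t₁₃ (m := y) (W := S) fun w hw => hy w (hS hw)
      have hne : ∏ l ∈ S, hu' l y ≠ 0 :=
        Finset.prod_ne_zero_iff.2 fun l hl => hh _ _ fun h => hyS (h ▸ hl)
      simp only [hv₂]
      rw [hm, insert_sdiff_insert_of_notMem hyU]
      simp only [smul_mul_assoc, smul_assoc, smul_smul]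
      congr 1
      simp only [hhu] at hne ⊢
      field_simp
    · rfl
  -- the action of `t₁₂ y`
  have hR1 : ∀ S ∈ U.powerset, ∀ R ∈ W.powerset, (t₁₂ y • if R.card = S.card then
      (coeff₁ c zu zv U S W R * ∏ j ∈ R, lam j) •
      ((nprod hu' t₁₃ S * sprod t₁₂ (U \ S) * nprod hv' t₂₃ (W \ R)) • Ω) else 0) =
      (if R.card = S.card then
      (coeff₁ c zu zv (insert y U) S W R * ∏ j ∈ R, lam j) •
      ((nprod hu' t₁₃ S * sprod t₁₂ (insert y U \ S) * nprod hv' t₂₃ (W \ R)) • Ω) else 0) +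
      ∑ k ∈ S, T (S.erase k) R ((gF c (zu y) (zu k) * ∏ l ∈ S.erase k, gF c (zu l) (zu k)) *
        coeff₁ c zu zv U (insert k (S.erase k)) W R) := by
    intro S hS R hR
    rw [Finset.mem_powerset] at hS hR
    have hyS : y ∉ S := fun h => hyU (hS h)
    split_ifs with hcard
    · have hm := hE.mul_nprod (isCross_div c zu hu) hh
        (fun k l hkl => fF_eq_mul hc (hu.ne hkl)) (fun k l => gF_anti c _ _) S y hyS
      rw [one_pow, one_smul] at hm
      rw [smul_comm (t₁₂ y), ← mul_smul, ← mul_assoc, ← mul_assoc, hm, add_mul, add_mul, add_smul,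
        smul_add]
      congr 1
      · have hsd : insert y U \ S = insert y (U \ S) := Finset.insert_sdiff_of_notMem _ hyS
        have hprod : coeff₁ c zu zv (insert y U) S W R =
            coeff₁ c zu zv U S W R * ∏ i ∈ S, fF c (zu i) (zu y) := by
          rw [coeff₁, coeff₁, hsd]
          simp only [Finset.prod_insert (fun h => hyU (Finset.mem_sdiff.1 h).1 : y ∉ U \ S),
            Finset.prod_mul_distrib]
          ring
        rw [hprod, hsd, sprod_insert_min _ fun w hw => hy w (Finset.mem_sdiff.1 hw).1]
        simp only [smul_mul_assoc, smul_assoc, smul_smul, mul_assoc]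
        congr 1
        simp only [fF]
        ring
      · rw [Finset.sum_mul, Finset.sum_mul, Finset.sum_smul, Finset.smul_sum]
        refine Finset.sum_congr rfl fun k hk => ?_
        have hc' : R.card = (S.erase k).card + 1 := by rw [Finset.card_erase_add_one hk, hcard]
        have hsd : U \ S.erase k = insert k (U \ S) := by
          ext x
          simp only [Finset.mem_sdiff, Finset.mem_erase, Finset.mem_insert]
          by_cases hx : x = k
          · subst hx; simp [hS hk]
          · simp [hx]
        simp only [hT, hv₂]
        rw [if_pos hc', Finset.insert_erase hk, hsd, ← mul_sprod_of_commute F ht (U \ S) k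
          (fun h => (Finset.mem_sdiff.1 h).2 hk)]
        simp only [smul_mul_assoc, smul_assoc, smul_smul, mul_assoc]
        congr 1
        ring
    · rw [smul_zero, zero_add, Finset.sum_eq_zero]
      intro k hk
      simp only [hT]
      rw [if_neg]
      rwa [Finset.card_erase_add_one hk]
  rw [partitionSum₁, Finset.sum_powerset_insert hyU,
    Finset.sum_congr rfl fun S hS => Finset.sum_congr rfl (hL2 S hS)]
  have e1 := Finset.sum_congr (rfl : U.powerset = U.powerset) fun S hS =>
    Finset.sum_congr (rfl : W.powerset = W.powerset) (hR1 S hS)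
  simp only [← Finset.smul_sum] at e1
  change t₁₂ y • partitionSum₁ c zu zv t₁₂ t₁₃ t₂₃ lam Ω U W = _ at e1
  rw [e1]
  simp only [Finset.sum_add_distrib, add_assoc]
  congr 1
  congr 1
  -- Poles at the `u k` against unwanted terms: the former run over `k ∉ S`, the latter over `k ∈ S`
  -- with `S.erase k` in place of `S`, and both become sums over `k` and subsets of `U.erase k`.
  · simp only [hTsum₁]
    rw [Finset.sum_congr rfl fun S _ => Finset.sum_comm, Finset.sum_congr rfl fun S _ =>
      Finset.sum_comm (s := W.powerset), sum_powerset_sum_sdiff U fun k S => ∑ R ∈ W.powerset,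
      T S R ((gF c (zu y) (zu k) * ∏ l ∈ S, gF c (zu l) (zu k)) *
        coeff₁ c zu zv U (insert k S) W R),
      ← sum_powerset_sum_erase U fun k S => ∑ R ∈ W.powerset,
      T S R ((gF c (zu y) (zu k) * ∏ l ∈ S, gF c (zu l) (zu k)) *
        coeff₁ c zu zv U (insert k S) W R)]
  -- Poles at the `v j`: removing `j` from `R` turns each into a term of the sum for `W.erase j`.
  · simp only [hTsum₂]
    set ψ : Finset κ → κ' → Finset κ' → V := fun S j R => if R.card = S.card then
      ((gF c (zv j) (zu y) * (∏ k ∈ W.erase j, gF c (zv k) (zv j)) *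
        ∏ i ∈ U, fF c (zv j) (zu i)) * coeff₁ c zu zv U S (W.erase j) R *
        (lam j * ∏ j ∈ R, lam j)) •
      ((t₁₃ y * nprod hu' t₁₃ S * sprod t₁₂ (U \ S) * nprod hv' t₂₃ (W.erase j \ R)) • Ω) else 0
      with hψ
    have e2 : ∀ S, ∀ R ∈ W.powerset, ∀ j ∈ R, T S R ((gF c (zv j) (zu y) *
        (∏ k ∈ W.erase j, gF c (zv k) (zv j)) *
        ∏ i ∈ U, fF c (zv j) (zu i)) * coeff₁ c zu zv U S (W.erase j) (R.erase j)) =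
        ψ S j (R.erase j) := by
      intro S R hR j hj
      simp only [hT, hψ, hv₂]
      rw [erase_sdiff_erase hj, Finset.mul_prod_erase R lam hj]
      congr 1
      rw [← Finset.card_erase_add_one hj]
      simp
    rw [Finset.sum_congr rfl fun S _ => Finset.sum_congr rfl fun R hR =>
      Finset.sum_congr rfl (e2 S R hR)]
    simp_rw [fun S => sum_powerset_sum_erase W (ψ S)]
    rw [Finset.sum_comm, Finset.smul_sum]
    refine Finset.sum_congr rfl fun j _ => ?_
    rw [partitionSum₁, Finset.smul_sum, Finset.smul_sum]
    refine Finset.sum_congr rfl fun S _ => ?_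
    rw [Finset.smul_sum, Finset.smul_sum]
    refine Finset.sum_congr rfl fun R _ => ?_
    simp only [hψ]
    split_ifs
    · rw [smul_smul, smul_comm (t₁₃ y), ← mul_smul (t₁₃ y)]
      simp only [mul_assoc]
      congr 1
      ring
    · simp

end Explicit

end SuperBethe
end

noncomputable section
namespace SuperBethe

section Explicit

/-! ### The kernel over finite sets -/

theorem setH_gF_eq {F : Type*} [Field F] (c : F) {ℓ : ℕ} (v : Fin ℓ → F) :
    setH (fun j k => gF c (v j) (v k)) Finset.univ =
      (∏ j : Fin ℓ, ∏ _k ∈ Finset.univ.filter (· < j), c) * (Matrix.vandermonde v).det⁻¹ := by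
  rw [Matrix.det_vandermonde, setH]
  simp only [gF_eq, Finset.prod_mul_distrib]
  congr 1
  rw [← Finset.prod_inv_distrib]
  simp only [← Finset.prod_inv_distrib]
  refine Finset.prod_comm' ?_
  simp

/-- The product of the g(v j, v k) is a constant over a Vandermonde determinant, so it changes by
the sign of the permutation, as does the determinant in K. -/
theorem kernelF_comp_perm {F : Type*} [Field F] (c : F) {ℓ : ℕ} (v u : Fin ℓ → F)
    (π : Equiv.Perm (Fin ℓ)) : kernelF c (v ∘ π) u = kernelF c v u := by
  have h1 : (Matrix.vandermonde (v ∘ π)).det =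
      (Equiv.Perm.sign π : ℤ) * (Matrix.vandermonde v).det := by
    rw [← Matrix.det_permute]
    rfl
  have h2 : (Matrix.of fun j k => gF c ((v ∘ π) j) (u k) / hF c ((v ∘ π) j) (u k)).det =
      (Equiv.Perm.sign π : ℤ) * (Matrix.of fun j k => gF c (v j) (u k) / hF c (v j) (u k)).det := by
    rw [← Matrix.det_permute]
    rfl
  have h3 : ∏ i, ∏ j, hF c ((v ∘ π) i) (u j) = ∏ i, ∏ j, hF c (v i) (u j) :=
    Equiv.prod_comp π fun i => ∏ j, hF c (v i) (u j)
  rw [kernelF, kernelF, setH_gF_eq c (v ∘ π), setH_gF_eq c v, h1, h2, h3]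
  rcases Int.units_eq_one_or (Equiv.Perm.sign π) with h | h <;> rw [h] <;> simp

variable {κ κ' F A V : Type*} [LinearOrder κ] [LinearOrder κ'] [Field F] [Ring A] [Algebra F A]
  [AddCommGroup V] [Module A V] [Module F V] [IsScalarTower F A V]

/-- `K(R|S)` for finite sets of indices of equal size. -/
def setK (c : F) (zu : κ → F) (zv : κ' → F) (R : Finset κ') (S : Finset κ) : F :=
  if h : R.card = S.card then
    kernelF c (fun i => zv (R.orderEmbOfFin h i)) (fun i => zu (S.orderEmbOfFin rfl i)) else 0

/-- By symmetry in the first family any enumeration of `R` computes the kernel. This allows a new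
element to be listed first, where the partial fractions were taken, regardless of its position in
the order. -/
theorem setK_eq (c : F) (zu : κ → F) (zv : κ' → F) {R : Finset κ'} {S : Finset κ} {m : ℕ}
    (hS : S.card = m) (r : Fin m → κ') (hr : Function.Injective r)
    (hrR : Finset.univ.image r = R) :
    setK c zu zv R S = kernelF c (fun i => zv (r i)) (fun i => zu (S.orderEmbOfFin hS i)) := by
  subst hS
  have hR : R.card = S.card := by
    rw [← hrR, Finset.card_image_of_injective _ hr, Finset.card_univ, Fintype.card_fin]
  have hmem : ∀ i, r i ∈ R := fun i => hrR ▸ Finset.mem_image_of_mem r (Finset.mem_univ i)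
  let φ : Fin S.card → Fin S.card := fun i => (R.orderIsoOfFin hR).symm ⟨r i, hmem i⟩
  have hφ : Function.Injective φ := by
    intro i j h
    have := (R.orderIsoOfFin hR).symm.injective h
    exact hr (congrArg Subtype.val this)
  let π : Equiv.Perm (Fin S.card) := Equiv.ofBijective φ (Finite.injective_iff_bijective.1 hφ)
  have hπ : ∀ i, R.orderEmbOfFin hR (π i) = r i := by
    intro i
    change ((R.orderIsoOfFin hR (φ i) : R) : κ') = r i
    simp [φ]
  rw [setK, dif_pos hR, ← kernelF_comp_perm c _ _ π]
  congr 1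
  funext i
  exact congrArg zv (hπ i)

theorem sum_orderEmbOfFin {M : Type*} [AddCommMonoid M] {S : Finset κ} {m : ℕ} (hS : S.card = m)
    (φ : κ → M) : ∑ p, φ (S.orderEmbOfFin hS p) = ∑ j ∈ S, φ j := by
  refine (Finset.sum_map Finset.univ (S.orderEmbOfFin hS).toEmbedding φ).symm.trans ?_
  rw [Finset.map_orderEmbOfFin_univ]

theorem prod_orderEmbOfFin {M : Type*} [CommMonoid M] {S : Finset κ} {m : ℕ} (hS : S.card = m)
    (φ : κ → M) : ∏ p, φ (S.orderEmbOfFin hS p) = ∏ j ∈ S, φ j := by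
  refine (Finset.prod_map Finset.univ (S.orderEmbOfFin hS).toEmbedding φ).symm.trans ?_
  rw [Finset.map_orderEmbOfFin_univ]

theorem map_succAbove_orderEmbOfFin {S : Finset κ} {m : ℕ} (hS : S.card = m + 1)
    (p : Fin (m + 1)) :
    Finset.univ.map (p.succAboveOrderEmb.trans (S.orderEmbOfFin hS)).toEmbedding =
      S.erase (S.orderEmbOfFin hS p) := by
  have : (p.succAboveOrderEmb.trans (S.orderEmbOfFin hS)).toEmbedding =
      p.succAboveOrderEmb.toEmbedding.trans (S.orderEmbOfFin hS).toEmbedding := rfl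
  rw [this, ← Finset.map_map, ← univ_erase_eq_map, Finset.map_erase,
    Finset.map_orderEmbOfFin_univ]
  rfl

theorem orderEmbOfFin_erase {S : Finset κ} {m : ℕ} (hS : S.card = m + 1) (p : Fin (m + 1))
    (h : (S.erase (S.orderEmbOfFin hS p)).card = m) (q : Fin m) :
    (S.erase (S.orderEmbOfFin hS p)).orderEmbOfFin h q = S.orderEmbOfFin hS (p.succAbove q) := by
  have := Finset.orderEmbOfFin_unique' h
    (f := p.succAboveOrderEmb.trans (S.orderEmbOfFin hS)) fun x => by
      rw [← map_succAbove_orderEmbOfFin]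
      exact Finset.mem_map_of_mem _ (Finset.mem_univ x)
  exact (DFunLike.congr_fun this q).symm

/-- `kernelF_mul_prod_fF` for sets: in each kernel the variable element is put in front of a fixed
enumeration of `R`. -/
theorem setK_mul_prod_fF {c : F} (hc : c ≠ 0) {zu : κ → F} {zv : κ' → F}
    (hu : Function.Injective zu) (hv : Function.Injective zv) (huv : ∀ i j, zu i ≠ zv j)
    (hvu' : ∀ i j, zv j - zu i + c ≠ 0) {S : Finset κ} {R Q : Finset κ'} {y : κ'}
    (hyR : y ∉ R) (hyQ : y ∉ Q) (hRQ : Disjoint R Q) (hcard : S.card = R.card + 1) :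
    setK c zu zv (insert y R) S * ∏ j ∈ Q, fF c (zv j) (zv y) =
      (∑ i ∈ S, gF c (zv y) (zu i) * (∏ k ∈ S.erase i, fF c (zu i) (zu k)) *
        (∏ j ∈ Q, fF c (zv j) (zu i)) * (∏ j ∈ R, fF c (zv j) (zu i)) *
        setK c zu zv R (S.erase i)) -
      ∑ k ∈ Q, gF c (zv y) (zv k) * (∏ j ∈ Q.erase k, fF c (zv j) (zv k)) *
        setK c zu zv (insert k R) S := by
  set r : Fin R.card → κ' := fun i => R.orderEmbOfFin rfl i with hr
  have hrinj : Function.Injective r := (R.orderEmbOfFin rfl).injective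
  have hrmem : ∀ i, r i ∈ R := fun i => R.orderEmbOfFin_mem rfl i
  have hrim : Finset.univ.image r = R := by
    simp [hr]
  have hins : ∀ k, k ∉ R → setK c zu zv (insert k R) S =
      kernelF c (Fin.cons (zv k) (fun i => zv (r i)) : Fin (R.card + 1) → F)
        (fun i => zu (S.orderEmbOfFin hcard i)) := by
    intro k hk
    rw [setK_eq c zu zv hcard (Fin.cons k r : Fin (R.card + 1) → κ')]
    · congr 1
      funext i
      refine Fin.cases ?_ (fun i => ?_) i <;> simp
    · rw [Fin.cons_injective_iff]
      refine ⟨?_, hrinj⟩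
      rintro ⟨i, rfl⟩
      exact hk (hrmem i)
    · ext x
      have hx : x ∈ R ↔ ∃ i ∈ Finset.univ, r i = x := by
        rw [← Finset.mem_image, hrim]
      rw [Finset.mem_image, Finset.mem_insert, hx]
      constructor
      · rintro ⟨i, -, rfl⟩
        refine Fin.cases (Or.inl rfl) (fun i => Or.inr ⟨i, Finset.mem_univ _, rfl⟩) i
      · rintro (rfl | ⟨i, -, rfl⟩)
        · exact ⟨0, Finset.mem_univ _, rfl⟩
        · exact ⟨i.succ, Finset.mem_univ _, rfl⟩
  have hQR : ∀ k ∈ Q, k ∉ R := fun k hk hk' => Finset.disjoint_left.1 hRQ hk' hk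
  rw [hins y hyR, kernelF_mul_prod_fF c hc (fun i => zv (r i))
    (fun i => zu (S.orderEmbOfFin hcard i)) zv Q (zv y)
    (hu.comp (S.orderEmbOfFin hcard).injective) (hv.comp hrinj) hv
    (fun i p => (huv _ _).symm) (fun i j hj => hv.ne fun h => hQR j hj (h ▸ hrmem i))
    (fun p j => huv _ _) (fun p => (huv _ _).symm) (fun p => hvu' _ _)
    (fun i => hv.ne fun h => hyR (h ▸ hrmem i)) (fun j hj => hv.ne fun h => hyQ (h ▸ hj))
    (fun i p => hvu' _ _) (fun j p => hvu' _ _)]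
  congr 1
  · rw [← sum_orderEmbOfFin hcard]
    refine Finset.sum_congr rfl fun p _ => ?_
    have hce : (S.erase (S.orderEmbOfFin hcard p)).card = R.card := by
      rw [Finset.card_erase_of_mem (S.orderEmbOfFin_mem hcard p), hcard, Nat.add_sub_cancel]
    have hprod : ∏ k ∈ S.erase (S.orderEmbOfFin hcard p),
        fF c (zu (S.orderEmbOfFin hcard p)) (zu k) = ∏ q, fF c (zu (S.orderEmbOfFin hcard p))
          (zu (S.orderEmbOfFin hcard (p.succAbove q))) := by
      rw [← map_succAbove_orderEmbOfFin, Finset.prod_map]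
      rfl
    rw [setK_eq c zu zv hce r hrinj hrim, hprod, ← prod_orderEmbOfFin (S := R) rfl]
    simp only [orderEmbOfFin_erase]
    rfl
  · refine Finset.sum_congr rfl fun k hk => ?_
    rw [hins k (hQR k hk)]

/-! ### The second explicit expression over finite sets -/

def coeff₂ (c : F) (zu : κ → F) (zv : κ' → F) (U S : Finset κ) (W R : Finset κ') : F :=
  setK c zu zv R S * (∏ i ∈ S, ∏ k ∈ U \ S, fF c (zu i) (zu k)) *
    ∏ j ∈ W \ R, ∏ i ∈ R, gF c (zv j) (zv i)

/-- `setK_mul_prod_fF` with `Q = W \ R`, multiplied by the factors not containing `zv y`. The sign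
in the first sum is the one that appears when `t₂₃ y` passes the odd operators `t₁₃`. -/
theorem coeff₂_insert {c : F} (hc : c ≠ 0) {zu : κ → F} {zv : κ' → F}
    (hu : Function.Injective zu) (hv : Function.Injective zv) (huv : ∀ i j, zu i ≠ zv j)
    (hvu' : ∀ i j, zv j - zu i + c ≠ 0) {U S : Finset κ} {W R : Finset κ'} {y : κ'}
    (hyW : y ∉ W) (hS : S ⊆ U) (hR : R ⊆ W) (hcard : S.card = R.card + 1) :
    (∏ l ∈ W \ R, hF c (zv l) (zv y)) * coeff₂ c zu zv U S (insert y W) (insert y R) =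
      (∑ k ∈ W \ R, ((-1) ^ (R.card + 1) * (gF c (zv y) (zv k) * ∏ l ∈ R, gF c (zv l) (zv k)) *
        ∏ l ∈ (W \ R).erase k, hF c (zv l) (zv k)) * coeff₂ c zu zv U S W (insert k R)) +
      ∑ j ∈ S, (gF c (zv y) (zu j) * (∏ k ∈ U.erase j, fF c (zu j) (zu k)) *
        ∏ l ∈ W, fF c (zv l) (zu j)) * coeff₂ c zu zv (U.erase j) (S.erase j) W R := by
  have hyR : y ∉ R := fun h => hyW (hR h)
  have hyQ : y ∉ W \ R := fun h => hyW (Finset.mem_sdiff.1 h).1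
  set Cc := (∏ i ∈ S, ∏ k ∈ U \ S, fF c (zu i) (zu k)) *
    ∏ j ∈ W \ R, ∏ i ∈ R, gF c (zv j) (zv i) with hCc
  have key := setK_mul_prod_fF hc hu hv huv hvu' hyR hyQ Finset.disjoint_sdiff hcard
  have e1 : (∏ l ∈ W \ R, hF c (zv l) (zv y)) * coeff₂ c zu zv U S (insert y W) (insert y R) =
      Cc * (setK c zu zv (insert y R) S * ∏ j ∈ W \ R, fF c (zv j) (zv y)) := by
    rw [coeff₂, insert_sdiff_insert_of_notMem hyW, Finset.prod_congr rfl fun j hj =>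
      fF_eq_mul hc (hv.ne (show j ≠ y from fun h => hyQ (h ▸ hj)))]
    simp only [Finset.prod_insert hyR, Finset.prod_mul_distrib, hCc]
    ring
  rw [e1, key, sub_eq_add_neg, add_comm, mul_add, ← Finset.sum_neg_distrib, Finset.mul_sum,
    Finset.mul_sum]
  congr 1
  · refine Finset.sum_congr rfl fun k hk => ?_
    have hkR := (Finset.mem_sdiff.1 hk).2
    -- The exchange coefficient has g(v l, v k), whereas the coefficient of the partition with `k`
    -- outside `R` has g(v k, v l).
    have hg : ∏ l ∈ R, gF c (zv l) (zv k) = (-1) ^ R.card * ∏ l ∈ R, gF c (zv k) (zv l) := by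
      rw [← Finset.prod_const, ← Finset.prod_mul_distrib]
      exact Finset.prod_congr rfl fun l _ => by rw [gF_anti, neg_one_mul]
    have h2 : (-1 : F) ^ R.card * (-1) ^ R.card = 1 := by rw [← mul_pow]; simp
    rw [coeff₂, Finset.sdiff_insert, hg, hCc,
      ← Finset.mul_prod_erase (W \ R) (fun j => ∏ i ∈ R, gF c (zv j) (zv i)) hk,
      Finset.prod_congr rfl fun j hj => fF_eq_mul hc (hv.ne (Finset.ne_of_mem_erase hj))]
    simp only [Finset.prod_insert hkR, Finset.prod_mul_distrib, pow_succ]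
    generalize (-1 : F) ^ R.card = e at h2
    linear_combination (gF c (zv y) (zv k) *
      (∏ l ∈ R, gF c (zv k) (zv l)) * (∏ l ∈ (W \ R).erase k, hF c (zv l) (zv k)) *
      setK c zu zv (insert k R) S * (∏ i ∈ S, ∏ k ∈ U \ S, fF c (zu i) (zu k)) *
      (∏ j ∈ (W \ R).erase k, gF c (zv j) (zv k)) *
      ∏ j ∈ (W \ R).erase k, ∏ i ∈ R, gF c (zv j) (zv i)) * h2
  · refine Finset.sum_congr rfl fun j hj => ?_
    have hUs : ∏ k ∈ U.erase j, fF c (zu j) (zu k) =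
        (∏ k ∈ U \ S, fF c (zu j) (zu k)) * ∏ k ∈ S.erase j, fF c (zu j) (zu k) := by
      rw [← erase_sdiff_erase hj, Finset.prod_sdiff (Finset.erase_subset_erase j hS)]
    rw [coeff₂, erase_sdiff_erase hj, hUs, hCc, ← Finset.prod_sdiff hR,
      ← Finset.mul_prod_erase S (fun i => ∏ k ∈ U \ S, fF c (zu i) (zu k)) hj]
    ring

/-- The sum over partitions in the second explicit expression, over finite sets of indices. -/
def partitionSum₂ (c : F) (zu : κ → F) (zv : κ' → F) (t₁₂ : κ → A) (t₁₃ t₂₃ : κ' → A)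
    (lam : κ → F) (Ω : V) (U : Finset κ) (W : Finset κ') : V :=
  ∑ S ∈ U.powerset, ∑ R ∈ W.powerset, if R.card = S.card then
    (coeff₂ c zu zv U S W R * ∏ i ∈ S, lam i) •
      ((nprod (fun i k => hF c (zv i) (zv k)) t₁₃ R *
        nprod (fun i k => hF c (zv i) (zv k)) t₂₃ (W \ R) * sprod t₁₂ (U \ S)) • Ω) else 0

/-- The prefactor on the left is the ratio of `H` for `insert y W` and `W`, which removes
denominators. As for the first sum, the terms with `y ∉ R` are the wanted terms of moving `t₂₃ y`
past the `t₁₃`'s; in those with `y ∈ R`, the poles of the kernel at the other `v k` give the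
unwanted terms and the poles at the `u j` give the sum multiplied by `t₁₃ y`. -/
theorem partitionSum₂_insert {c : F} (hc : c ≠ 0) {zu : κ → F} {zv : κ' → F}
    (hu : Function.Injective zu) (hv : Function.Injective zv) (huv : ∀ i j, zu i ≠ zv j)
    (hvu' : ∀ i j, zv j - zu i + c ≠ 0)
    (hvv : ∀ i j, i ≠ j → hF c (zv i) (zv j) ≠ 0) (t₁₂ : κ → A) {t₁₃ t₂₃ : κ' → A}
    (hE : IsExchange (-1) (-1) (fun i k => gF c (zv i) (zv k)) t₁₃ t₂₃)
    (ht : ∀ k l, k ≠ l → hF c (zv k) (zv l) • (t₂₃ k * t₂₃ l) =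
      hF c (zv l) (zv k) • (t₂₃ l * t₂₃ k))
    (lam : κ → F) (Ω : V) (U : Finset κ) {W : Finset κ'} {y : κ'} (hy : ∀ k ∈ W, y < k) :
    (∏ l ∈ W, hF c (zv l) (zv y)) •
        partitionSum₂ c zu zv t₁₂ t₁₃ t₂₃ lam Ω U (insert y W) =
      t₂₃ y • partitionSum₂ c zu zv t₁₂ t₁₃ t₂₃ lam Ω U W +
      t₁₃ y • ∑ j ∈ U, (gF c (zv y) (zu j) * (∏ k ∈ U.erase j, fF c (zu j) (zu k)) *
        (∏ l ∈ W, fF c (zv l) (zu j)) * lam j) •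
          partitionSum₂ c zu zv t₁₂ t₁₃ t₂₃ lam Ω (U.erase j) W := by
  have hyW : y ∉ W := fun h => lt_irrefl _ (hy y h)
  set h' : κ' → κ' → F := fun i k => hF c (zv i) (zv k) with hh'
  have hh : ∀ k l, k ≠ l → h' k l ≠ 0 := hvv
  set v₂ : Finset κ → Finset κ' → V := fun S R =>
    (t₁₃ y * nprod h' t₁₃ R * nprod h' t₂₃ (W \ R) * sprod t₁₂ (U \ S)) • Ω with hv₂
  set T : Finset κ → Finset κ' → F → V := fun S R x =>
    if S.card = R.card + 1 then (x * ∏ i ∈ S, lam i) • v₂ S R else 0 with hT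
  have hTadd : ∀ S R x x', T S R (x + x') = T S R x + T S R x' := by
    intro S R x x'
    simp only [hT]
    split_ifs
    · rw [add_mul, add_smul]
    · simp
  have hTsum₁ : ∀ (s : Finset κ) S R (x : κ → F),
      T S R (∑ i ∈ s, x i) = ∑ i ∈ s, T S R (x i) := by
    intro s S R x
    simp only [hT]
    split_ifs
    · rw [Finset.sum_mul, Finset.sum_smul]
    · simp
  have hTsum₂ : ∀ (s : Finset κ') S R (x : κ' → F),
      T S R (∑ i ∈ s, x i) = ∑ i ∈ s, T S R (x i) := by
    intro s S R x
    simp only [hT]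
    split_ifs
    · rw [Finset.sum_mul, Finset.sum_smul]
    · simp
  have hprodW : ∀ R ⊆ W, ∏ l ∈ W, h' l y = (∏ l ∈ W \ R, h' l y) * ∏ l ∈ R, h' l y :=
    fun R hR => (Finset.prod_sdiff hR).symm
  -- the terms with `y ∈ R` on the left-hand side
  have hL2 : ∀ S ∈ U.powerset, ∀ R ∈ W.powerset, ((∏ l ∈ W, h' l y) •
      if (insert y R).card = S.card then
      (coeff₂ c zu zv U S (insert y W) (insert y R) * ∏ i ∈ S, lam i) •
      ((nprod h' t₁₃ (insert y R) * nprod h' t₂₃ (insert y W \ insert y R) *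
        sprod t₁₂ (U \ S)) • Ω) else 0) =
      T S R (∑ k ∈ W \ R, ((-1) ^ (R.card + 1) * (gF c (zv y) (zv k) *
        ∏ l ∈ R, gF c (zv l) (zv k)) * ∏ l ∈ (W \ R).erase k, hF c (zv l) (zv k)) *
          coeff₂ c zu zv U S W (insert k R)) +
      T S R (∑ j ∈ S, (gF c (zv y) (zu j) * (∏ k ∈ U.erase j, fF c (zu j) (zu k)) *
        ∏ l ∈ W, fF c (zv l) (zu j)) * coeff₂ c zu zv (U.erase j) (S.erase j) W R) := by
    intro S hS R hR
    rw [Finset.mem_powerset] at hS hR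
    have hyR : y ∉ R := fun h => hyW (hR h)
    rw [← hTadd, Finset.card_insert_of_notMem hyR]
    simp only [hT]
    by_cases hcard : S.card = R.card + 1
    · rw [if_pos hcard, if_pos hcard.symm,
        ← coeff₂_insert hc hu hv huv hvu' hyW hS hR hcard]
      have hm := mul_nprod_of_lt hh t₁₃ (m := y) (W := R) fun w hw => hy w (hR hw)
      simp only [hv₂]
      rw [hm, insert_sdiff_insert_of_notMem hyW, hprodW R hR]
      simp only [smul_mul_assoc, smul_assoc, smul_smul]
      congr 1
      simp only [hh']
      ring
    · rw [if_neg hcard, if_neg (Ne.symm hcard), smul_zero]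
  -- the action of `t₂₃ y`
  have hR1 : ∀ S ∈ U.powerset, ∀ R ∈ W.powerset, (t₂₃ y • if R.card = S.card then
      (coeff₂ c zu zv U S W R * ∏ i ∈ S, lam i) •
      ((nprod h' t₁₃ R * nprod h' t₂₃ (W \ R) * sprod t₁₂ (U \ S)) • Ω) else 0) =
      ((∏ l ∈ W, h' l y) • if R.card = S.card then
      (coeff₂ c zu zv U S (insert y W) R * ∏ i ∈ S, lam i) •
      ((nprod h' t₁₃ R * nprod h' t₂₃ (insert y W \ R) * sprod t₁₂ (U \ S)) • Ω) else 0) +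
      ∑ k ∈ R, T S (R.erase k) (((-1) ^ ((R.erase k).card + 1) * (gF c (zv y) (zv k) *
        ∏ l ∈ R.erase k, gF c (zv l) (zv k)) *
          ∏ l ∈ (W \ R.erase k).erase k, hF c (zv l) (zv k)) *
          coeff₂ c zu zv U S W (insert k (R.erase k))) := by
    intro S hS R hR
    rw [Finset.mem_powerset] at hS hR
    have hyR : y ∉ R := fun h => hyW (hR h)
    split_ifs with hcard
    · have hm := hE.mul_nprod (isCross_div c zv hv) hh
        (fun k l hkl => fF_eq_mul hc (hv.ne hkl)) (fun k l => gF_anti c _ _) R y hyR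
      rw [smul_comm (t₂₃ y), ← mul_smul, ← mul_assoc, ← mul_assoc, hm, smul_mul_assoc,
        smul_mul_assoc, add_mul, add_mul, smul_assoc, add_smul, smul_add, smul_add]
      congr 1
      · have hsd : insert y W \ R = insert y (W \ R) := Finset.insert_sdiff_of_notMem _ hyR
        have hprod : coeff₂ c zu zv U S (insert y W) R =
            coeff₂ c zu zv U S W R * ∏ i ∈ R, gF c (zv y) (zv i) := by
          rw [coeff₂, coeff₂, hsd, Finset.prod_insert fun h => hyW (Finset.mem_sdiff.1 h).1]
          ring
        -- The sign from reversing the arguments of g cancels the factor τ^|R| = (-1)^|R| of the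
        -- exchange relation.
        have hf : ∏ k ∈ R, (1 + gF c (zv k) (zv y)) =
            (-1) ^ R.card * ((∏ i ∈ R, gF c (zv y) (zv i)) * ∏ l ∈ R, h' l y) := by
          rw [← Finset.prod_const, ← Finset.prod_mul_distrib, ← Finset.prod_mul_distrib]
          refine Finset.prod_congr rfl fun i hi => ?_
          have := fF_eq_mul hc (hv.ne (show i ≠ y from fun h => hyR (h ▸ hi)))
          rw [← fF, this, gF_anti c (zv y)]
          simp only [hh']
          ring
        have h2 : (-1 : F) ^ R.card * (-1) ^ R.card = 1 := by rw [← mul_pow]; simp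
        have hm' := mul_nprod_of_lt hh t₂₃ (m := y) (W := W \ R)
          fun w hw => hy w (Finset.mem_sdiff.1 hw).1
        rw [hprod, hsd, hf, hprodW R hR, smul_mul_assoc, mul_assoc (nprod h' t₁₃ R), hm']
        simp only [smul_mul_assoc, mul_smul_comm, smul_assoc, smul_smul]
        congr 1
        generalize (-1 : F) ^ R.card = e at h2
        linear_combination (coeff₂ c zu zv U S W R * (∏ i ∈ S, lam i) *
          ((∏ i ∈ R, gF c (zv y) (zv i)) * ∏ l ∈ R, h' l y) * ∏ l ∈ W \ R, h' l y) * h2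
      · rw [Finset.sum_mul, Finset.sum_mul, Finset.sum_smul, Finset.smul_sum, Finset.smul_sum]
        refine Finset.sum_congr rfl fun k hk => ?_
        have hc' : S.card = (R.erase k).card + 1 := by rw [Finset.card_erase_add_one hk, hcard]
        have hsd : W \ R.erase k = insert k (W \ R) := by
          ext x
          simp only [Finset.mem_sdiff, Finset.mem_erase, Finset.mem_insert]
          by_cases hx : x = k
          · subst hx; simp [hR hk]
          · simp [hx]
        have hkQ : k ∉ W \ R := fun h => (Finset.mem_sdiff.1 h).2 hk
        have hm' := mul_nprod hh ht (W \ R) k hkQ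
        simp only [hT, hv₂]
        rw [if_pos hc', Finset.insert_erase hk, hsd, Finset.erase_insert hkQ,
          Finset.card_erase_add_one hk, smul_mul_assoc, smul_mul_assoc, mul_assoc _ (t₂₃ k), hm']
        simp only [smul_mul_assoc, mul_smul_comm, smul_assoc, smul_smul]
        congr 1
        simp only [hh']
        ring
    · rw [smul_zero, smul_zero, zero_add, Finset.sum_eq_zero]
      intro k hk
      simp only [hT]
      rw [if_neg]
      rw [Finset.card_erase_add_one hk]
      exact Ne.symm hcard
  rw [partitionSum₂, Finset.smul_sum]
  simp only [Finset.sum_powerset_insert hyW, smul_add, Finset.sum_add_distrib, Finset.smul_sum]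
  rw [Finset.sum_congr rfl fun S hS => Finset.sum_congr rfl (hL2 S hS)]
  have e1 := Finset.sum_congr (rfl : U.powerset = U.powerset) fun S hS =>
    Finset.sum_congr (rfl : W.powerset = W.powerset) (hR1 S hS)
  have e1' : t₂₃ y • partitionSum₂ c zu zv t₁₂ t₁₃ t₂₃ lam Ω U W =
    ∑ S ∈ U.powerset, ∑ R ∈ W.powerset, (t₂₃ y • if R.card = S.card then
      (coeff₂ c zu zv U S W R * ∏ i ∈ S, lam i) •
      ((nprod h' t₁₃ R * nprod h' t₂₃ (W \ R) * sprod t₁₂ (U \ S)) • Ω) else 0) := by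
    simp only [← Finset.smul_sum]
    rfl
  rw [e1', e1]
  simp only [Finset.sum_add_distrib, add_assoc]
  congr 1
  congr 1
  · simp only [hTsum₂]
    refine Finset.sum_congr rfl fun S _ => ?_
    rw [sum_powerset_sum_sdiff W fun k R => T S R (((-1) ^ (R.card + 1) * (gF c (zv y) (zv k) *
        ∏ l ∈ R, gF c (zv l) (zv k)) * ∏ l ∈ (W \ R).erase k, hF c (zv l) (zv k)) *
          coeff₂ c zu zv U S W (insert k R)),
      ← sum_powerset_sum_erase W fun k R => T S R (((-1) ^ (R.card + 1) * (gF c (zv y) (zv k) *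
        ∏ l ∈ R, gF c (zv l) (zv k)) * ∏ l ∈ (W \ R).erase k, hF c (zv l) (zv k)) *
          coeff₂ c zu zv U S W (insert k R))]
  · simp only [hTsum₁]
    set ψ : κ → Finset κ → V := fun j S => ∑ R ∈ W.powerset, if R.card = S.card then
      ((gF c (zv y) (zu j) * (∏ k ∈ U.erase j, fF c (zu j) (zu k)) *
        ∏ l ∈ W, fF c (zv l) (zu j)) * coeff₂ c zu zv (U.erase j) S W R *
        (lam j * ∏ i ∈ S, lam i)) •
      ((t₁₃ y * nprod h' t₁₃ R * nprod h' t₂₃ (W \ R) * sprod t₁₂ (U.erase j \ S)) • Ω) else 0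
      with hψ
    have e2 : ∀ S, ∑ R ∈ W.powerset, ∑ j ∈ S, T S R ((gF c (zv y) (zu j) *
        (∏ k ∈ U.erase j, fF c (zu j) (zu k)) *
        ∏ l ∈ W, fF c (zv l) (zu j)) * coeff₂ c zu zv (U.erase j) (S.erase j) W R) =
        ∑ j ∈ S, ψ j (S.erase j) := by
      intro S
      rw [Finset.sum_comm]
      refine Finset.sum_congr rfl fun j hj => Finset.sum_congr rfl fun R _ => ?_
      simp only [hT, hv₂]
      rw [erase_sdiff_erase hj, Finset.mul_prod_erase S lam hj, ← Finset.card_erase_add_one hj]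
      simp only [add_left_inj]
      congr 1
      exact propext eq_comm
    rw [Finset.sum_congr rfl fun S _ => e2 S, sum_powerset_sum_erase U ψ]
    refine Finset.sum_congr rfl fun j _ => ?_
    rw [partitionSum₂, Finset.smul_sum, Finset.smul_sum]
    refine Finset.sum_congr rfl fun S _ => ?_
    rw [Finset.smul_sum, Finset.smul_sum]
    refine Finset.sum_congr rfl fun R _ => ?_
    split_ifs
    · rw [smul_smul, smul_comm (t₁₃ y), ← mul_smul (t₁₃ y)]
      simp only [mul_assoc]
      congr 1
      ring
    · simp

end Explicit

end SuperBethe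
end

noncomputable section
namespace SuperBethe

/-! ### The graded tensor product acting on vector-valued functions -/

section JordanWigner

set_option linter.unusedSectionVars false

variable {n : ℕ} {F A V : Type*} [Field F] [Ring A] [Algebra F A]
  [AddCommGroup V] [Module A V] [Module F V] [IsScalarTower F A V] (π : Fin 3 → ℕ)

/-- The total parity of the tensor factors to the left of `p`. -/
def parBelow (I : Fin n → Fin 3) (p : Fin n) : ℕ := ∑ q ∈ Finset.univ.filter (· < p), π (I q)

/-- The total parity of a basis state. -/
def parTotal (I : Fin n → Fin 3) : ℕ := ∑ q, π (I q)

theorem parBelow_update_of_not_lt (I : Fin n → Fin 3) {p q : Fin n} (h : ¬q < p) (j : Fin 3) :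
    parBelow π (Function.update I q j) p = parBelow π I p := by
  refine Finset.sum_congr rfl fun r hr => ?_
  have : r ≠ q := fun e => h (e ▸ (Finset.mem_filter.1 hr).2)
  rw [Function.update_of_ne this]

theorem parBelow_update_of_lt (I : Fin n → Fin 3) {p q : Fin n} (h : q < p) (j : Fin 3) :
    parBelow π (Function.update I q j) p + π (I q) = parBelow π I p + π j := by
  have hq : q ∈ Finset.univ.filter (· < p) := by simp [h]
  rw [parBelow, parBelow, ← Finset.add_sum_erase _ _ hq,
    ← Finset.add_sum_erase _ (fun q => π (I q)) hq, Function.update_self]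
  have : ∑ x ∈ (Finset.univ.filter (· < p)).erase q, π (Function.update I q j x) =
      ∑ x ∈ (Finset.univ.filter (· < p)).erase q, π (I x) :=
    Finset.sum_congr rfl fun r hr => by rw [Function.update_of_ne (Finset.ne_of_mem_erase hr)]
  omega

theorem parTotal_update (I : Fin n → Fin 3) (q : Fin n) (j : Fin 3) :
    parTotal π (Function.update I q j) + π (I q) = parTotal π I + π j := by
  rw [parTotal, parTotal, ← Finset.add_sum_erase _ _ (Finset.mem_univ q),
    ← Finset.add_sum_erase _ (fun q => π (I q)) (Finset.mem_univ q), Function.update_self]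
  have : ∑ x ∈ Finset.univ.erase q, π (Function.update I q j x) =
      ∑ x ∈ Finset.univ.erase q, π (I x) :=
    Finset.sum_congr rfl fun r hr => by rw [Function.update_of_ne (Finset.ne_of_mem_erase hr)]
  omega

/-- Parities are natural numbers, so a change of parity is stated as an additive identity; this
converts such an identity into one between signs. -/
theorem neg_one_pow_eq_of_add_eq {R : Type*} [Monoid R] [HasDistribNeg R] {m k a b : ℕ}
    (h : m + a = k + b) : (-1 : R) ^ m = (-1) ^ (k + a + b) := by
  have : k + a + b = m + 2 * a := by omega
  rw [this, pow_add, pow_mul]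
  simp

theorem neg_one_pow_mul_self (R : Type*) [Monoid R] [HasDistribNeg R] (m : ℕ) :
    (-1 : R) ^ m * (-1) ^ m = 1 := by
  rw [← pow_add, ← two_mul, pow_mul]; simp

variable (F V) in
/-- The graded matrix unit `E_{ij}` in the factor `p`, in the Jordan–Wigner representation. -/
def jw (p : Fin n) (i j : Fin 3) : Module.End F ((Fin n → Fin 3) → V) where
  toFun ψ I := if I p = i then
    (-1 : F) ^ ((π i + π j) * parBelow π I p) • ψ (Function.update I p j) else 0
  map_add' ψ φ := by
    funext I
    by_cases h : I p = i <;> simp [h]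
  map_smul' s ψ := by
    funext I
    by_cases h : I p = i <;> simp [h, smul_comm s]

theorem jw_apply (p : Fin n) (i j : Fin 3) (ψ : (Fin n → Fin 3) → V) (I : Fin n → Fin 3) :
    jw F V π p i j ψ I = if I p = i then
      (-1 : F) ^ ((π i + π j) * parBelow π I p) • ψ (Function.update I p j) else 0 := rfl

theorem jw_mul_same (p : Fin n) (i j k l : Fin 3) :
    jw F V π p i j * jw F V π p k l = if j = k then jw F V π p i l else 0 := by
  refine LinearMap.ext fun ψ => funext fun I => ?_
  rw [Module.End.mul_apply, jw_apply]
  by_cases h : I p = i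
  · rw [if_pos h, jw_apply, Function.update_self]
    by_cases hjk : j = k
    · subst hjk
      rw [if_pos rfl, if_pos rfl, jw_apply, if_pos h, smul_smul, ← pow_add,
        parBelow_update_of_not_lt π I (lt_irrefl p), Function.update_idem, ← add_mul]
      congr 1
      have : (π i + π j + (π j + π l)) * parBelow π I p =
          (π i + π l) * parBelow π I p + 2 * (π j * parBelow π I p) := by ring
      rw [this, pow_add, pow_mul]
      simp
    · rw [if_neg hjk, if_neg hjk, smul_zero]
      rfl
  · rw [if_neg h]
    split_ifs
    · rw [jw_apply, if_neg h]
    · rfl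

/-- Acting at `p` changes the parity to the left of `q` by `π i + π j` modulo two, while acting at
`q` does not affect the parity to the left of `p`. -/
theorem jw_mul_of_lt {p q : Fin n} (hpq : p < q) (i j k l : Fin 3) :
    jw F V π p i j * jw F V π q k l =
      ((-1 : F) ^ ((π i + π j) * (π k + π l))) • (jw F V π q k l * jw F V π p i j) := by
  refine LinearMap.ext fun ψ => funext fun I => ?_
  rw [Module.End.mul_apply, LinearMap.smul_apply, Module.End.mul_apply, Pi.smul_apply, jw_apply,
    jw_apply, jw_apply, jw_apply, Function.update_of_ne hpq.ne', Function.update_of_ne hpq.ne]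
  by_cases h : I p = i
  · by_cases h' : I q = k
    · rw [if_pos h, if_pos h', if_pos h', if_pos h, smul_smul, smul_smul, smul_smul,
        Function.update_comm hpq.ne', parBelow_update_of_not_lt π I hpq.not_gt]
      congr 1
      have e := parBelow_update_of_lt π I hpq j
      rw [h] at e
      have e' : (π k + π l) * parBelow π (Function.update I p j) q + (π k + π l) * π i =
        (π k + π l) * parBelow π I q + (π k + π l) * π j := by rw [← mul_add, e, mul_add]
      rw [neg_one_pow_eq_of_add_eq e']
      ring
    · rw [if_neg h', if_neg h']
      simp
  · rw [if_neg h]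
    split_ifs <;> simp

theorem jw_mul_of_ne {p q : Fin n} (hpq : p ≠ q) (i j k l : Fin 3) :
    jw F V π p i j * jw F V π q k l =
      ((-1 : F) ^ ((π i + π j) * (π k + π l))) • (jw F V π q k l * jw F V π p i j) := by
  rcases lt_or_gt_of_ne hpq with h | h
  · exact jw_mul_of_lt π h i j k l
  · rw [jw_mul_of_lt π h k l i j, smul_smul, mul_comm (π k + π l), neg_one_pow_mul_self, one_smul]

variable (γ : A →+* A)

variable (F V) (n) in
/-- The coefficient `a` as an operator: moving it past a basis state applies the grading
involution. -/
def lft (a : A) : Module.End F ((Fin n → Fin 3) → V) where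
  toFun ψ I := γ^[parTotal π I] a • ψ I
  map_add' ψ φ := by
    funext I
    simp
  map_smul' s ψ := by
    funext I
    have := IsScalarTower.to_smulCommClass (R := F) (A := A) (M := V)
    simp [smul_comm s]

theorem lft_apply (a : A) (ψ : (Fin n → Fin 3) → V) (I : Fin n → Fin 3) :
    lft n F V π γ a ψ I = γ^[parTotal π I] a • ψ I := rfl

theorem iterate_of_homogeneous {a : A} {d : ℕ} (ha : γ a = (-1) ^ d * a) (m : ℕ) :
    γ^[m] a = (-1) ^ (d * m) * a := by
  induction m with
  | zero => simp
  | succ m ih =>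
    rw [Function.iterate_succ_apply', ih, map_mul, map_pow, map_neg, map_one, ha, ← mul_assoc,
      ← pow_add, Nat.mul_succ]

theorem neg_one_pow_mul_smul (m : ℕ) (a : A) (v : V) :
    ((-1) ^ m * a) • v = (-1 : F) ^ m • a • v := by
  rcases neg_one_pow_eq_or A m with h | h <;> rcases Nat.even_or_odd m with h' | h' <;>
    simp [h'.neg_one_pow]

/-- The unit changes the total parity of the word by `π k + π l` modulo two, and the grading
involution acts on `a` once for each unit of total parity. -/
theorem lft_mul_jw {a : A} {d : ℕ} (ha : γ a = (-1) ^ d * a) (p : Fin n) (k l : Fin 3) :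
    lft n F V π γ a * jw F V π p k l =
      ((-1 : F) ^ (d * (π k + π l))) • (jw F V π p k l * lft n F V π γ a) := by
  refine LinearMap.ext fun ψ => funext fun I => ?_
  have := IsScalarTower.to_smulCommClass (R := F) (A := A) (M := V)
  rw [Module.End.mul_apply, LinearMap.smul_apply, Module.End.mul_apply, Pi.smul_apply, lft_apply,
    jw_apply, jw_apply, lft_apply]
  by_cases h : I p = k
  · rw [if_pos h, if_pos h, iterate_of_homogeneous γ ha, iterate_of_homogeneous γ ha,
      neg_one_pow_mul_smul (F := F),
      neg_one_pow_mul_smul (F := F), smul_comm a ((-1 : F) ^ _), smul_smul, smul_smul, smul_smul]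
    congr 1
    have e := parTotal_update π I p l
    rw [h] at e
    have e' : d * parTotal π (Function.update I p l) + d * π k = d * parTotal π I + d * π l := by
      rw [← mul_add, e, mul_add]
    rw [neg_one_pow_eq_of_add_eq e']
    have h2 := neg_one_pow_mul_self F (d * π k)
    have h3 := neg_one_pow_mul_self F (d * π l)
    simp only [mul_add, pow_add]
    generalize (-1 : F) ^ (d * π k) = x at *
    generalize (-1 : F) ^ (d * π l) = y at *
    linear_combination (-(-1 : F) ^ (d * parTotal π I) * (-1 : F) ^ ((π k + π l) * parBelow π I p)) *
      ((y * y) * h2 + h3)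
  · rw [if_neg h, if_neg h, smul_zero, smul_zero]

theorem lft_mul (a b : A) : lft n F V π γ (a * b) = lft n F V π γ a * lft n F V π γ b := by
  refine LinearMap.ext fun ψ => funext fun I => ?_
  rw [Module.End.mul_apply, lft_apply, lft_apply, lft_apply, smul_smul]
  congr 1
  exact iterate_map_mul γ _ _ _

theorem lft_add (a b : A) : lft n F V π γ (a + b) = lft n F V π γ a + lft n F V π γ b := by
  refine LinearMap.ext fun ψ => funext fun I => ?_
  rw [LinearMap.add_apply, Pi.add_apply, lft_apply, lft_apply, lft_apply, iterate_map_add,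
    add_smul]

theorem lft_smul (hγ : ∀ s : F, γ (algebraMap F A s) = algebraMap F A s) (s : F) (a : A) :
    lft n F V π γ (s • a) = s • lft n F V π γ a := by
  refine LinearMap.ext fun ψ => funext fun I => ?_
  have h : ∀ m, γ^[m] (s • a) = s • γ^[m] a := by
    intro m
    induction m with
    | zero => rfl
    | succ m ih =>
      rw [Function.iterate_succ_apply', Function.iterate_succ_apply', ih, Algebra.smul_def, map_mul,
        hγ, ← Algebra.smul_def]
  rw [LinearMap.smul_apply, Pi.smul_apply, lft_apply, lft_apply, h, smul_assoc]

end JordanWigner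

end SuperBethe
end

/-! ### Ordered products, and monodromy and R-operators on words of labels -/

noncomputable section
namespace SuperBethe

section Lists

variable {M α β : Type*} [Monoid M]

theorem prod_map_mul_of_commute (l : List α) (hl : l.Nodup) (a b : α → M)
    (h : ∀ x ∈ l, ∀ y ∈ l, x ≠ y → Commute (b x) (a y)) :
    (l.map a).prod * (l.map b).prod = (l.map fun x => a x * b x).prod := by
  induction l with
  | nil => simp
  | cons x l ih =>
    rw [List.nodup_cons] at hl
    have hc : Commute (b x) (l.map a).prod := by
      refine Commute.list_prod_right _ _ fun c hc => ?_
      obtain ⟨y, hy, rfl⟩ := List.mem_map.1 hc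
      exact h x (by simp) y (by simp [hy]) fun e => hl.1 (e ▸ hy)
    rw [List.map_cons, List.map_cons, List.map_cons, List.prod_cons, List.prod_cons,
      List.prod_cons, ← ih hl.2 fun x hx y hy => h x (by simp [hx]) y (by simp [hy]),
      mul_assoc (a x) (b x), ← mul_assoc (b x), hc.eq]
    simp only [mul_assoc]

/-- Used to pass from a product of R-matrices grouped by the sites of one family to the same product
grouped by those of the other. -/
theorem prod_map_prod_comm (l : List α) (l' : List β) (hl : l.Nodup) (hl' : l'.Nodup)
    (a : α → β → M)
    (h : ∀ x ∈ l, ∀ x' ∈ l, ∀ y ∈ l', ∀ y' ∈ l', x ≠ x' → y ≠ y' → Commute (a x y) (a x' y')) :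
    (l.map fun x => (l'.map fun y => a x y).prod).prod =
      (l'.map fun y => (l.map fun x => a x y).prod).prod := by
  induction l with
  | nil => simp
  | cons x l ih =>
    rw [List.nodup_cons] at hl
    rw [List.map_cons, List.prod_cons, ih hl.2 fun x hx x' hx' => h x (by simp [hx]) x' (by simp [hx'])]
    simp only [List.map_cons, List.prod_cons]
    refine prod_map_mul_of_commute l' hl' _ _ fun y hy y' hy' hne => ?_
    refine Commute.list_prod_left _ _ fun c hc => ?_
    obtain ⟨x', hx', rfl⟩ := List.mem_map.1 hc
    exact h x' (by simp [hx']) x (by simp) y hy y' hy' (fun e => hl.1 (e ▸ hx')) hne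

end Lists

section Operators

set_option linter.unusedSectionVars false

variable {n : ℕ} {F A V : Type*} [Field F] [Ring A] [Algebra F A]
  [AddCommGroup V] [Module A V] [Module F V] [IsScalarTower F A V] (π : Fin 3 → ℕ) (γ : A →+* A)

theorem commute_mul_of_sign {R : Type*} [Ring R] [Algebra F R] {X Y Z : R} {s : F}
    (hX : X * Z = s • (Z * X)) (hY : Y * Z = s • (Z * Y)) (hs : s * s = 1) : Commute (X * Y) Z := by
  rw [commute_iff_eq, mul_assoc, hY, mul_smul_comm, ← mul_assoc, hX, smul_mul_assoc, smul_smul, hs,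
    one_smul, mul_assoc]

/-- The matrix `t` of homogeneous elements has an even monodromy matrix. -/
def IsEven (t : Fin 3 → Fin 3 → A) : Prop := ∀ i j, γ (t i j) = (-1) ^ (π i + π j) * t i j

variable (F V) in
/-- `∑_{ij} E_{ij}^{(p)} ⊗ t_{ij}`. -/
def monOp (p : Fin n) (t : Fin 3 → Fin 3 → A) : Module.End F ((Fin n → Fin 3) → V) :=
  ∑ i, ∑ j, jw F V π p i j * lft n F V π γ (t i j)

variable (F V) in
/-- The graded permutation of the factors `p` and `q`. -/
def permOp (p q : Fin n) : Module.End F ((Fin n → Fin 3) → V) :=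
  ∑ i, ∑ j, ((-1 : F) ^ π j) • (jw F V π p i j * jw F V π q j i)

variable (V) in
/-- `1 + G P_{pq}`. -/
def rOp (G : F) (p q : Fin n) : Module.End F ((Fin n → Fin 3) → V) := 1 + G • permOp F V π p q

/-- Both factors have parity `π i + π j`, so the two signs cancel. The commutation of permutations,
R-operators and even monodromy operators at disjoint sites is built on this. -/
theorem commute_jw_mul_jw {p q r : Fin n} (hp : p ≠ r) (hq : q ≠ r) (i j k l : Fin 3) :
    Commute (jw F V π p i j * jw F V π q j i) (jw F V π r k l) :=
  commute_mul_of_sign (jw_mul_of_ne π hp i j k l)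
    (by rw [jw_mul_of_ne π hq j i k l, add_comm (π j)]) (neg_one_pow_mul_self F _)

theorem commute_permOp_jw {p q r : Fin n} (hp : p ≠ r) (hq : q ≠ r) (k l : Fin 3) :
    Commute (permOp F V π p q) (jw F V π r k l) :=
  Commute.sum_left _ _ _ fun i _ => Commute.sum_left _ _ _ fun j _ =>
    (commute_jw_mul_jw π hp hq i j k l).smul_left _

theorem commute_permOp_lft {a : A} {d : ℕ} (ha : γ a = (-1) ^ d * a) (p q : Fin n) :
    Commute (permOp F V π p q) (lft n F V π γ a) :=
  Commute.sum_left _ _ _ fun i _ => Commute.sum_left _ _ _ fun j _ =>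
    (show Commute (lft n F V π γ a) (jw F V π p i j * jw F V π q j i) by
      rw [commute_iff_eq, ← mul_assoc, lft_mul_jw π γ ha p i j, smul_mul_assoc, mul_assoc,
        lft_mul_jw π γ ha q j i, mul_smul_comm, smul_smul, add_comm (π j), neg_one_pow_mul_self,
        one_smul, mul_assoc]).symm.smul_left _

theorem commute_monOp_jw {t : Fin 3 → Fin 3 → A} (ht : IsEven π γ t) {p r : Fin n} (hp : p ≠ r)
    (k l : Fin 3) : Commute (monOp F V π γ p t) (jw F V π r k l) :=
  Commute.sum_left _ _ _ fun i _ => Commute.sum_left _ _ _ fun j _ =>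
    commute_mul_of_sign (jw_mul_of_ne π hp i j k l) (lft_mul_jw π γ (ht i j) r k l)
      (neg_one_pow_mul_self F _)

theorem commute_permOp_monOp {t : Fin 3 → Fin 3 → A} (ht : IsEven π γ t) {p q r : Fin n}
    (hp : p ≠ r) (hq : q ≠ r) : Commute (permOp F V π p q) (monOp F V π γ r t) :=
  Commute.sum_right _ _ _ fun i _ => Commute.sum_right _ _ _ fun j _ =>
    (commute_permOp_jw π hp hq i j).mul_right (commute_permOp_lft π γ (ht i j) p q)

theorem commute_rOp_jw (G : F) {p q r : Fin n} (hp : p ≠ r) (hq : q ≠ r) (k l : Fin 3) :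
    Commute (rOp V π G p q) (jw F V π r k l) :=
  (Commute.one_left _).add_left ((commute_permOp_jw π hp hq k l).smul_left _)

theorem commute_rOp_monOp (G : F) {t : Fin 3 → Fin 3 → A} (ht : IsEven π γ t) {p q r : Fin n}
    (hp : p ≠ r) (hq : q ≠ r) : Commute (rOp V π G p q) (monOp F V π γ r t) :=
  (Commute.one_left _).add_left ((commute_permOp_monOp π γ ht hp hq).smul_left _)

theorem commute_rOp_rOp (G G' : F) {p q r s : Fin n} (hpr : p ≠ r) (hqr : q ≠ r) (hps : p ≠ s)
    (hqs : q ≠ s) : Commute (rOp V π G p q) (rOp V π G' r s) := by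
  refine (Commute.one_right _).add_right (Commute.smul_right ?_ _)
  exact Commute.sum_right _ _ _ fun i _ => Commute.sum_right _ _ _ fun j _ =>
    ((commute_rOp_jw π G hpr hqr i j).mul_right (commute_rOp_jw π G hps hqs j i)).smul_right _

theorem permOp_comm {p q : Fin n} (h : p ≠ q) : permOp F V π p q = permOp F V π q p := by
  rw [permOp, permOp, Finset.sum_comm]
  refine Finset.sum_congr rfl fun j _ => Finset.sum_congr rfl fun i _ => ?_
  rw [jw_mul_of_ne π h, smul_smul]
  congr 1
  rcases neg_one_pow_eq_or F (π i) with hi | hi <;> rcases neg_one_pow_eq_or F (π j) with hj | hj <;>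
    simp [hi, hj, mul_add, add_mul, pow_add, pow_mul]

theorem rOp_comm (G : F) {p q : Fin n} (h : p ≠ q) : rOp V π G p q = rOp V π G q p := by
  rw [rOp, rOp, permOp_comm π h]

/-! ### The `RTT` relation -/

/-- The matrix units leave one summand of the permutation, which interchanges the column labels `j`
and `l`. Multiplication from the left, in the next lemma, interchanges the row labels. -/
theorem jw_mul_jw_mul_permOp {p q : Fin n} (h : p ≠ q) (i j k l : Fin 3) :
    jw F V π p i j * jw F V π q k l * permOp F V π p q =
      ((-1 : F) ^ (π l + (π k + π l) * (π j + π l))) • (jw F V π p i l * jw F V π q k j) := by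
  rw [permOp, Finset.mul_sum, Finset.sum_eq_single j, Finset.mul_sum, Finset.sum_eq_single l]
  · rw [mul_smul_comm, mul_assoc, ← mul_assoc (jw F V π q k l), jw_mul_of_ne π h.symm k l j l,
      smul_mul_assoc, mul_smul_comm, smul_smul, mul_assoc (jw F V π p j l), ← mul_assoc,
      jw_mul_same, jw_mul_same, if_pos rfl, if_pos rfl, pow_add]
  · intro m _ hm
    rw [mul_smul_comm, mul_assoc, ← mul_assoc (jw F V π q k l), jw_mul_of_ne π h.symm,
      smul_mul_assoc, mul_assoc (jw F V π p j m), jw_mul_same π q, if_neg hm.symm]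
    simp
  · simp
  · intro m _ hm
    rw [Finset.mul_sum, Finset.sum_eq_zero]
    intro r _
    rw [mul_smul_comm, mul_assoc, ← mul_assoc (jw F V π q k l), jw_mul_of_ne π h.symm,
      smul_mul_assoc, mul_assoc (jw F V π p m r), mul_smul_comm, ← mul_assoc (jw F V π p i j),
      jw_mul_same π p, if_neg hm.symm]
    simp
  · simp

theorem permOp_mul_jw_mul_jw {p q : Fin n} (h : p ≠ q) (i j k l : Fin 3) :
    permOp F V π p q * (jw F V π p i j * jw F V π q k l) =
      ((-1 : F) ^ (π i + (π i + π k) * (π i + π j))) • (jw F V π p k j * jw F V π q i l) := by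
  rw [permOp, Finset.sum_mul, Finset.sum_eq_single k, Finset.sum_mul, Finset.sum_eq_single i]
  · rw [smul_mul_assoc, mul_assoc, ← mul_assoc (jw F V π q i k), jw_mul_of_ne π h.symm i k i j,
      smul_mul_assoc, mul_smul_comm, smul_smul, mul_assoc (jw F V π p i j), ← mul_assoc,
      jw_mul_same, jw_mul_same, if_pos rfl, if_pos rfl, pow_add]
  · intro m _ hm
    rw [smul_mul_assoc, mul_assoc, ← mul_assoc (jw F V π q m k), jw_mul_of_ne π h.symm,
      smul_mul_assoc, mul_smul_comm, mul_assoc (jw F V π p i j), ← mul_assoc (jw F V π p k m),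
      jw_mul_same π p, if_neg hm]
    simp
  · simp
  · intro m _ hm
    rw [Finset.sum_mul, Finset.sum_eq_zero]
    intro r _
    rw [smul_mul_assoc, mul_assoc, ← mul_assoc (jw F V π q r m), jw_mul_of_ne π h.symm,
      smul_mul_assoc, mul_assoc (jw F V π p i j), jw_mul_same π q, if_neg hm]
    simp
  · simp

theorem sum_sum_sum_swap {ι M : Type*} [Fintype ι] [AddCommMonoid M] (f : ι → ι → ι → M) :
    ∑ j, ∑ k, ∑ l, f j k l = ∑ j, ∑ k, ∑ l, f l k j := by
  rw [Finset.sum_comm]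
  conv_rhs => rw [Finset.sum_comm]
  exact Finset.sum_congr rfl fun k _ => Finset.sum_comm

theorem sum_sum_comm_pairs {ι M : Type*} [Fintype ι] [AddCommMonoid M] (f : ι → ι → ι → ι → M) :
    ∑ k, ∑ l, ∑ i, ∑ j, f k l i j = ∑ i, ∑ j, ∑ k, ∑ l, f k l i j := by
  have h := Finset.sum_comm (s := (Finset.univ : Finset (ι × ι)))
    (t := (Finset.univ : Finset (ι × ι))) (f := fun x y => f x.1 x.2 y.1 y.2)
  simpa only [Fintype.sum_prod_type] using h

theorem mul_one_add_neg_smul_comm {F R : Type*} [Field F] [Ring R] [Algebra F R] {X Y P : R} {G : F}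
    (h : X - Y = G • (X * P - P * Y)) : X * (1 + (-G) • P) = (1 + (-G) • P) * Y := by
  rw [mul_add, add_mul, mul_one, one_mul, mul_smul_comm, smul_mul_assoc, neg_smul, neg_smul,
    ← sub_eq_add_neg, ← sub_eq_add_neg, sub_eq_sub_iff_sub_eq_sub, h, smul_sub]

theorem monOp_mul_monOp {t : Fin 3 → Fin 3 → A} (ht : IsEven π γ t) (t' : Fin 3 → Fin 3 → A)
    (p q : Fin n) :
    monOp F V π γ p t * monOp F V π γ q t' =
      ∑ i, ∑ j, ∑ k, ∑ l, ((-1 : F) ^ ((π i + π j) * (π k + π l))) •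
        (jw F V π p i j * jw F V π q k l * lft n F V π γ (t i j * t' k l)) := by
  rw [monOp, monOp, Finset.sum_mul]
  refine Finset.sum_congr rfl fun i _ => ?_
  rw [Finset.sum_mul]
  refine Finset.sum_congr rfl fun j _ => ?_
  rw [Finset.mul_sum]
  refine Finset.sum_congr rfl fun k _ => ?_
  rw [Finset.mul_sum]
  refine Finset.sum_congr rfl fun l _ => ?_
  rw [lft_mul, mul_assoc, ← mul_assoc (lft n F V π γ (t i j)), lft_mul_jw π γ (ht i j),
    smul_mul_assoc, mul_smul_comm]
  simp only [mul_assoc]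

theorem monOp_mul_monOp_swap {t t' : Fin 3 → Fin 3 → A} (ht' : IsEven π γ t') {p q : Fin n}
    (h : p ≠ q) :
    monOp F V π γ q t' * monOp F V π γ p t =
      ∑ i, ∑ j, ∑ k, ∑ l,
        (jw F V π p i j * jw F V π q k l * lft n F V π γ (t' k l * t i j)) := by
  rw [monOp_mul_monOp π γ ht', sum_sum_comm_pairs]
  refine Finset.sum_congr rfl fun i _ => Finset.sum_congr rfl fun j _ =>
    Finset.sum_congr rfl fun k _ => Finset.sum_congr rfl fun l _ => ?_
  rw [jw_mul_of_ne π h, smul_mul_assoc, mul_comm (π k + π l)]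

theorem monOp_mul_monOp_mul_permOp {t t' : Fin 3 → Fin 3 → A} (ht : IsEven π γ t)
    (ht' : IsEven π γ t') {p q : Fin n} (h : p ≠ q) :
    monOp F V π γ p t * monOp F V π γ q t' * permOp F V π p q =
      ∑ i, ∑ j, ∑ k, ∑ l, ((-1 : F) ^ (π i * π k + π i * π j + π k * π j)) •
        (jw F V π p i j * jw F V π q k l * lft n F V π γ (t i l * t' k j)) := by
  rw [monOp_mul_monOp π γ ht, Finset.sum_mul]
  refine Finset.sum_congr rfl fun i _ => ?_
  -- The permutation has interchanged the column labels, so `j` and `l` are renamed to collect the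
  -- coefficient of the same pair of units.
  rw [sum_sum_sum_swap]
  simp only [Finset.sum_mul]
  refine Finset.sum_congr rfl fun j _ =>
    Finset.sum_congr rfl fun k _ => Finset.sum_congr rfl fun l _ => ?_
  have hP : Commute (permOp F V π p q) (lft n F V π γ (t i l * t' k j)) := by
    rw [lft_mul]
    exact (commute_permOp_lft π γ (ht i l) p q).mul_right (commute_permOp_lft π γ (ht' k j) p q)
  rw [smul_mul_assoc, mul_assoc, ← hP.eq, ← mul_assoc, jw_mul_jw_mul_permOp π h, smul_mul_assoc,
    smul_smul, ← pow_add]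
  congr 1
  refine neg_one_pow_congr ?_
  simp only [Nat.even_add, Nat.even_mul]
  by_cases hi : Even (π i) <;> by_cases hj : Even (π j) <;> by_cases hk : Even (π k) <;>
    by_cases hl : Even (π l) <;> simp [hi, hj, hk, hl]

theorem permOp_mul_monOp_mul_monOp {t t' : Fin 3 → Fin 3 → A}
    (ht' : IsEven π γ t') {p q : Fin n} (h : p ≠ q) :
    permOp F V π p q * (monOp F V π γ q t' * monOp F V π γ p t) =
      ∑ i, ∑ j, ∑ k, ∑ l, ((-1 : F) ^ (π i * π k + π i * π j + π k * π j)) •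
        (jw F V π p i j * jw F V π q k l * lft n F V π γ (t' i l * t k j)) := by
  rw [monOp_mul_monOp_swap π γ ht' h, sum_sum_sum_swap]
  simp only [Finset.mul_sum]
  refine Finset.sum_congr rfl fun i _ => Finset.sum_congr rfl fun j _ =>
    Finset.sum_congr rfl fun k _ => Finset.sum_congr rfl fun l _ => ?_
  rw [← mul_assoc, permOp_mul_jw_mul_jw π h, smul_mul_assoc]
  congr 1
  refine neg_one_pow_congr ?_
  simp only [Nat.even_add, Nat.even_mul]
  by_cases hi : Even (π i) <;> by_cases hj : Even (π j) <;> by_cases hk : Even (π k) <;>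
    by_cases hl : Even (π l) <;> simp [hi, hj, hk]

theorem lft_sub (a b : A) : lft n F V π γ (a - b) = lft n F V π γ a - lft n F V π γ b := by
  rw [eq_sub_iff_add_eq, ← lft_add, sub_add_cancel]

theorem lft_neg_one_pow_mul (m : ℕ) (a : A) :
    lft n F V π γ ((-1) ^ m * a) = (-1 : F) ^ m • lft n F V π γ a := by
  have h : lft n F V π γ (-a) = -lft n F V π γ a := by
    rw [eq_neg_iff_add_eq_zero, ← lft_add, neg_add_cancel]
    refine LinearMap.ext fun ψ => funext fun I => ?_
    rw [lft_apply, iterate_map_zero, zero_smul]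
    rfl
  rcases Nat.even_or_odd m with h' | h'
  · rw [h'.neg_one_pow, h'.neg_one_pow, one_mul, one_smul]
  · rw [h'.neg_one_pow, h'.neg_one_pow, neg_one_mul, h]
    refine LinearMap.ext fun ψ => ?_
    rw [LinearMap.neg_apply, LinearMap.smul_apply, neg_one_smul]

/-- The coefficients of `jw p i j * jw q k l` on the two sides differ by the component RTT relation
times (-1)^(([i]+[j])([k]+[l])). Modulo two this sign changes the exponent in the relation into the
symmetric exponent produced by the permutation. -/
theorem monOp_mul_monOp_sub {t t' : Fin 3 → Fin 3 → A} (ht : IsEven π γ t)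
    (ht' : IsEven π γ t') (hγ : ∀ s : F, γ (algebraMap F A s) = algebraMap F A s) (G : F)
    (hrtt : ∀ i j k l, t i j * t' k l - (-1) ^ ((π i + π j) * (π k + π l)) * (t' k l * t i j) =
      (-1) ^ (π l * (π i + π j) + π i * π j) * (G • (t i l * t' k j - t' i l * t k j)))
    {p q : Fin n} (h : p ≠ q) :
    monOp F V π γ p t * monOp F V π γ q t' - monOp F V π γ q t' * monOp F V π γ p t =
      G • (monOp F V π γ p t * monOp F V π γ q t' * permOp F V π p q -
        permOp F V π p q * (monOp F V π γ q t' * monOp F V π γ p t)) := by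
  rw [monOp_mul_monOp_mul_permOp π γ ht ht' h, permOp_mul_monOp_mul_monOp π γ ht' h,
    monOp_mul_monOp π γ ht, monOp_mul_monOp_swap π γ ht' h]
  simp only [← Finset.sum_sub_distrib, Finset.smul_sum]
  refine Finset.sum_congr rfl fun i _ => Finset.sum_congr rfl fun j _ =>
    Finset.sum_congr rfl fun k _ => Finset.sum_congr rfl fun l _ => ?_
  have key := congrArg (lft (F := F) (V := V) n π γ) (hrtt i j k l)
  rw [lft_sub, lft_neg_one_pow_mul, lft_neg_one_pow_mul, lft_smul π γ hγ, lft_sub] at key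
  set e := jw F V π p i j * jw F V π q k l
  have h1 : ((-1 : F) ^ ((π i + π j) * (π k + π l))) • lft n F V π γ (t i j * t' k l) -
      lft n F V π γ (t' k l * t i j) = ((-1 : F) ^ (π i * π k + π i * π j + π k * π j)) •
        (G • (lft n F V π γ (t i l * t' k j) - lft n F V π γ (t' i l * t k j))) := by
    have h2 := congrArg (fun X => ((-1 : F) ^ ((π i + π j) * (π k + π l))) • X) key
    simp only [smul_sub, smul_smul, neg_one_pow_mul_self, one_smul] at h2
    rw [h2, ← mul_assoc, ← pow_add, smul_sub, smul_sub, smul_smul, smul_smul]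
    have h3 : (-1 : F) ^ ((π i + π j) * (π k + π l) + (π l * (π i + π j) + π i * π j)) =
        (-1 : F) ^ (π i * π k + π i * π j + π k * π j) := by
      refine neg_one_pow_congr ?_
      simp only [Nat.even_add, Nat.even_mul]
      by_cases hi : Even (π i) <;> by_cases hj : Even (π j) <;> by_cases hk : Even (π k) <;>
        by_cases hl : Even (π l) <;> simp [hi, hj, hk, hl]
    rw [h3]
  rw [← mul_smul_comm, ← mul_sub, h1, mul_smul_comm, mul_smul_comm, mul_sub, smul_comm, smul_sub]

/-- Since g is antisymmetric, `-G` is g with its arguments exchanged: the relation reads T_p T_q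
R_qp = R_qp T_q T_p, with R on the right as in the Bethe vector. -/
theorem monOp_mul_monOp_mul_rOp {t t' : Fin 3 → Fin 3 → A} (ht : IsEven π γ t)
    (ht' : IsEven π γ t') (hγ : ∀ s : F, γ (algebraMap F A s) = algebraMap F A s) (G : F)
    (hrtt : ∀ i j k l, t i j * t' k l - (-1) ^ ((π i + π j) * (π k + π l)) * (t' k l * t i j) =
      (-1) ^ (π l * (π i + π j) + π i * π j) * (G • (t i l * t' k j - t' i l * t k j)))
    {p q : Fin n} (h : p ≠ q) :
    monOp F V π γ p t * monOp F V π γ q t' * rOp V π (-G) p q =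
      rOp V π (-G) p q * (monOp F V π γ q t' * monOp F V π γ p t) :=
  mul_one_add_neg_smul_comm (monOp_mul_monOp_sub π γ ht ht' hγ G hrtt h)

end Operators

end SuperBethe
end

/-! ### Moving the product of R-matrices through the monodromy matrices -/

noncomputable section
namespace SuperBethe

section Exchange

variable {M α β : Type*} [Monoid M]

/-- The last `X` stands next to `Y`, and the reversed order puts its own `R` directly to the right
of `Y`. The exchange thus works from the inside outwards. -/
theorem prod_mul_mul_prod_reverse (l : List α) (hl : l.Nodup) (X R : α → M) (Y : M)
    (h : ∀ i ∈ l, X i * Y * R i = R i * (Y * X i))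
    (hX : ∀ i ∈ l, ∀ k ∈ l, i ≠ k → Commute (R i) (X k)) :
    (l.map X).prod * Y * (l.reverse.map R).prod = (l.reverse.map R).prod * (Y * (l.map X).prod) := by
  induction l with
  | nil => simp
  | cons i l ih =>
    rw [List.nodup_cons] at hl
    have ih' := ih hl.2 (fun k hk => h k (by simp [hk]))
      fun k hk m hm => hX k (by simp [hk]) m (by simp [hm])
    have h1 : Commute (R i) (l.map X).prod := by
      refine Commute.list_prod_right _ _ fun c hc => ?_
      obtain ⟨k, hk, rfl⟩ := List.mem_map.1 hc
      exact hX i (by simp) k (by simp [hk]) fun e => hl.1 (e ▸ hk)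
    have h2 : Commute (l.reverse.map R).prod (X i) := by
      refine Commute.list_prod_left _ _ fun c hc => ?_
      obtain ⟨k, hk, rfl⟩ := List.mem_map.1 hc
      exact hX k (by simp_all) i (by simp) fun e => hl.1 (e ▸ List.mem_reverse.1 hk)
    simp only [List.map_cons, List.reverse_cons, List.map_append, List.prod_cons, List.prod_append,
      List.map_nil, List.prod_nil, mul_one]
    calc X i * (l.map X).prod * Y * ((l.reverse.map R).prod * R i)
        = X i * ((l.map X).prod * Y * (l.reverse.map R).prod) * R i := by simp only [mul_assoc]
      _ = X i * (l.reverse.map R).prod * Y * ((l.map X).prod * R i) := by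
        rw [ih']; simp only [mul_assoc]
      _ = (l.reverse.map R).prod * (X i * Y * R i) * (l.map X).prod := by
        rw [← h1.eq, ← h2.eq]; simp only [mul_assoc]
      _ = _ := by rw [h i (by simp)]; simp only [mul_assoc]

/-- One `Y` is treated at a time; its block of R's commutes with the other `Y`'s, since these live
at different sites. -/
theorem prod_mul_prod_mul_prod_prod (l : List α) (l' : List β) (hl : l.Nodup) (hl' : l'.Nodup)
    (X : α → M) (Y : β → M) (R : β → α → M)
    (h : ∀ i ∈ l, ∀ j ∈ l', X i * Y j * R j i = R j i * (Y j * X i))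
    (hX : ∀ i ∈ l, ∀ k ∈ l, ∀ j ∈ l', i ≠ k → Commute (R j i) (X k))
    (hY : ∀ i ∈ l, ∀ j ∈ l', ∀ k ∈ l', j ≠ k → Commute (R j i) (Y k)) :
    (l.map X).prod * (l'.map Y).prod * (l'.map fun j => (l.reverse.map (R j)).prod).prod =
      (l'.map fun j => (l.reverse.map (R j)).prod).prod * ((l'.map Y).prod * (l.map X).prod) := by
  induction l' with
  | nil => simp
  | cons j l' ih =>
    rw [List.nodup_cons] at hl'
    have ih' := ih hl'.2 (fun i hi k hk => h i hi k (by simp [hk]))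
      (fun i hi k hk m hm => hX i hi k hk m (by simp [hm]))
      fun i hi k hk m hm => hY i hi k (by simp [hk]) m (by simp [hm])
    have h0 := prod_mul_mul_prod_reverse l hl X (R j) (Y j) (fun i hi => h i hi j (by simp))
      fun i hi k hk => hX i hi k hk j (by simp)
    have h1 : Commute (l.reverse.map (R j)).prod (l'.map Y).prod := by
      refine Commute.list_prod_right _ _ fun c hc => Commute.list_prod_left _ _ fun d hd => ?_
      obtain ⟨k, hk, rfl⟩ := List.mem_map.1 hc
      obtain ⟨i, hi, rfl⟩ := List.mem_map.1 hd
      exact hY i (by simp_all) j (by simp) k (by simp [hk]) fun e => hl'.1 (e ▸ hk)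
    have h2 : Commute (l'.map fun j => (l.reverse.map (R j)).prod).prod (Y j) := by
      refine Commute.list_prod_left _ _ fun c hc => ?_
      obtain ⟨k, hk, rfl⟩ := List.mem_map.1 hc
      refine Commute.list_prod_left _ _ fun d hd => ?_
      obtain ⟨i, hi, rfl⟩ := List.mem_map.1 hd
      exact hY i (by simp_all) k (by simp [hk]) j (by simp) fun e => hl'.1 (e ▸ hk)
    simp only [List.map_cons, List.prod_cons]
    generalize (l'.map fun j => (l.reverse.map (R j)).prod).prod = RR at *
    generalize (l.reverse.map (R j)).prod = S at *
    generalize (l.map X).prod = XX at *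
    generalize (l'.map Y).prod = YY at *
    calc XX * (Y j * YY) * (S * RR) = XX * Y j * (YY * S) * RR := by simp only [mul_assoc]
      _ = XX * Y j * S * (YY * RR) := by rw [← h1.eq]; simp only [mul_assoc]
      _ = S * Y j * (XX * YY * RR) := by rw [h0]; simp only [mul_assoc]
      _ = S * (RR * Y j) * (YY * XX) := by rw [ih', h2.eq]; simp only [mul_assoc]
      _ = _ := by simp only [mul_assoc]

end Exchange

/-! ### Matrix units on basis words, and the representation of the graded tensor product -/

section Single

variable {n : ℕ} {F A V : Type*} [Field F] [Ring A] [Algebra F A]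
  [AddCommGroup V] [Module A V] [Module F V] [IsScalarTower F A V] (π : Fin 3 → ℕ)

theorem jw_single (p : Fin n) (i j : Fin 3) (I : Fin n → Fin 3) (v : V) :
    jw F V π p i j (Pi.single I v) = if I p = j then
      ((-1 : F) ^ ((π i + π j) * parBelow π I p)) • Pi.single (Function.update I p i) v else 0 := by
  funext J
  rw [jw_apply]
  by_cases hJ : J p = i
  · rw [if_pos hJ]
    by_cases hI : I p = j
    · rw [if_pos hI, Pi.smul_apply]
      by_cases hIJ : Function.update J p j = I
      · subst hIJ
        rw [Pi.single_eq_same, Function.update_idem, ← hJ, Function.update_eq_self,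
          Pi.single_eq_same, parBelow_update_of_not_lt π J (lt_irrefl p)]
      · rw [Pi.single_eq_of_ne hIJ, Pi.single_eq_of_ne, smul_zero, smul_zero]
        rintro rfl
        refine hIJ ?_
        rw [Function.update_idem, ← hI, Function.update_eq_self]
    · rw [if_neg hI, Pi.single_eq_of_ne, smul_zero, Pi.zero_apply]
      rintro rfl
      simp at hI
  · rw [if_neg hJ]
    split_ifs
    · rw [Pi.smul_apply, Pi.single_eq_of_ne, smul_zero]
      rintro rfl
      simp at hJ
    · rfl

/-- The configuration `I` with the labels at the sites of `l` replaced by `i`. -/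
def relabel (I : Fin n → Fin 3) (l : List (Fin n)) (i : Fin 3) : Fin n → Fin 3 :=
  fun q => if q ∈ l then i else I q

/-- The rightmost factor acts first and the sites increase, so at each step only sites further to
the right have been relabelled. The parities to the left are therefore those of the original word.
-/
theorem prod_jw_single (l : List (Fin n)) (hl : l.Pairwise (· < ·)) (i j : Fin 3)
    (I : Fin n → Fin 3) (v : V) :
    (l.map fun p => jw F V π p i j).prod (Pi.single I v) = if ∀ p ∈ l, I p = j then
      ((-1 : F) ^ ((π i + π j) * (l.map fun p => parBelow π I p).sum)) •
        Pi.single (relabel I l i) v else 0 := by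
  induction l with
  | nil =>
    have : relabel I [] i = I := by funext q; simp [relabel]
    simp [this]
  | cons p l ih =>
    rw [List.pairwise_cons] at hl
    rw [List.map_cons, List.prod_cons, Module.End.mul_apply, ih hl.2]
    have hp : p ∉ l := fun h => lt_irrefl p (hl.1 p h)
    by_cases h : ∀ p ∈ l, I p = j
    · rw [if_pos h, map_smul, jw_single]
      have h1 : relabel I l i p = I p := by simp [relabel, hp]
      have h2 : parBelow π (relabel I l i) p = parBelow π I p := by
        refine Finset.sum_congr rfl fun q hq => ?_
        have : q ∉ l := fun hq' => lt_asymm (hl.1 q hq') (Finset.mem_filter.1 hq).2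
        simp [relabel, this]
      have h3 : Function.update (relabel I l i) p i = relabel I (p :: l) i := by
        funext q
        by_cases hq : q = p
        · subst hq; simp [relabel]
        · rw [Function.update_of_ne hq]; simp [relabel, hq]
      rw [h1, h2, h3]
      by_cases hI : I p = j
      · rw [if_pos hI, if_pos (by simpa [hI] using h), smul_smul, ← pow_add, List.map_cons,
          List.sum_cons, mul_add, add_comm]
      · rw [if_neg hI, if_neg (by simp [hI]), smul_zero]
    · rw [if_neg h, map_zero, if_neg]
      exact fun h' => h fun q hq => h' q (by simp [hq])

end Single

namespace MonodromyData

set_option linter.unusedSectionVars false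

variable {P F A : Type*} [Field F] [Ring A] [Algebra F A] (M : MonodromyData P F A) {n : ℕ}
  (V : Type*) [AddCommGroup V] [Module A V] [Module F V] [IsScalarTower F A V]

/-- The exponent of the sign of a coefficient in the Jordan–Wigner representation. -/
def jwExponent (I J : Fin n → Fin 3) : ℕ := ∑ p, (par (I p) + par (J p)) * parBelow par J p

/-- The coefficient of `E_{I₁J₁}^{(1)} ⋯ E_{IₙJₙ}^{(n)}`. -/
def entry (X : M.Aux n) (I J : Fin n → Fin 3) : A := X I J

/-- The action of the graded tensor product on `(ℂ^{2|1})^{⊗ n} ⊗ V`. -/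
def repr (X : M.Aux n) : Module.End F ((Fin n → Fin 3) → V) where
  toFun ψ I := ∑ J, (-1 : F) ^ jwExponent I J • M.grade^[parTotal par J] (M.entry X I J) • ψ J
  map_add' ψ φ := by
    funext I
    simp [smul_add, Finset.sum_add_distrib]
  map_smul' s ψ := by
    have := IsScalarTower.to_smulCommClass (R := F) (A := A) (M := V)
    funext I
    simp only [Pi.smul_apply, RingHom.id_apply, Finset.smul_sum]
    refine Finset.sum_congr rfl fun J _ => ?_
    rw [smul_comm _ s (ψ J), smul_comm _ s]

variable {V}

theorem repr_apply (X : M.Aux n) (ψ : (Fin n → Fin 3) → V) (I : Fin n → Fin 3) :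
    M.repr V X ψ I = ∑ J, (-1 : F) ^ jwExponent I J • M.grade^[parTotal par J] (M.entry X I J) • ψ J := rfl

variable (V) in
theorem repr_add (X Y : M.Aux n) : M.repr V (X + Y) = M.repr V X + M.repr V Y := by
  refine LinearMap.ext fun ψ => funext fun I => ?_
  rw [LinearMap.add_apply, Pi.add_apply, repr_apply, repr_apply, repr_apply,
    ← Finset.sum_add_distrib]
  refine Finset.sum_congr rfl fun J _ => ?_
  rw [show M.entry (X + Y) I J = M.entry X I J + M.entry Y I J from rfl, iterate_map_add, add_smul, smul_add]

variable (V) in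
/-- `repr` as an additive map. -/
def reprHom : M.Aux n →+ Module.End F ((Fin n → Fin 3) → V) := AddMonoidHom.mk' (M.repr V) (M.repr_add V)

theorem grade_iterate (hg : ∀ y, M.grade (M.grade y) = y) (m : ℕ) (y : A) :
    M.grade^[m] (M.grade^[m] y) = y := by
  rw [← Function.iterate_add_apply, ← two_mul, Function.Involutive.iterate_two_mul hg]
  rfl

variable (V) in
-- This is what the sign in `repr` is made for. Both exponents are sums over pairs q < p, and their
-- total is even for each pair; the powers of the grading involution match because it squares to the
-- identity.
theorem repr_mul (hg : ∀ y, M.grade (M.grade y) = y) (X Y : M.Aux n) :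
    M.repr V (X * Y) = M.repr V X * M.repr V Y := by
  have hc := IsScalarTower.to_smulCommClass (R := F) (A := A) (M := V)
  refine LinearMap.ext fun ψ => funext fun I => ?_
  rw [Module.End.mul_apply, repr_apply, repr_apply]
  simp only [repr_apply, Finset.smul_sum]
  rw [Finset.sum_comm]
  refine Finset.sum_congr rfl fun L _ => ?_
  rw [show M.entry (X * Y) I L = ∑ J : Fin n → Fin 3,
    (-1) ^ (∑ p, ∑ q ∈ Finset.univ.filter (· < p),
        (par (I p) + par (J p)) * (par (J q) + par (L q))) *
      ((M.grade)^[∑ q, (par (J q) + par (L q))] (M.entry X I J) * M.entry Y J L) from rfl]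
  rw [show M.grade^[parTotal par L] = (M.grade ^ parTotal par L : A →+* A) from
    (RingHom.coe_pow _ _).symm, map_sum, Finset.sum_smul, Finset.smul_sum]
  refine Finset.sum_congr rfl fun J _ => ?_
  rw [map_mul, map_pow, map_neg, map_one, neg_one_pow_mul_smul (F := F), map_mul, RingHom.coe_pow,
    Finset.sum_add_distrib, add_comm, Function.iterate_add_apply]
  rw [show ∑ i, par (L i) = parTotal par L from rfl, M.grade_iterate hg,
    show ∑ i, par (J i) = parTotal par J from rfl, smul_smul, ← pow_add, mul_smul,
    smul_comm (M.grade^[parTotal par J] (M.entry X I J)) ((-1 : F) ^ _), smul_smul (M.grade^[parTotal par J] (M.entry X I J)),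
    smul_smul ((-1 : F) ^ _), ← pow_add]
  congr 1
  refine neg_one_pow_congr ?_
  refine Nat.even_add.1 ?_
  simp only [jwExponent, parBelow, Finset.mul_sum, ← Finset.sum_add_distrib]
  exact Finset.even_sum _ fun p _ => Finset.even_sum _ fun q _ =>
    ⟨par (I p) * par (L q) + par (L p) * par (L q) + par (I p) * par (J q) + par (J p) * par (J q) +
      par (J p) * par (L q), by ring⟩

variable (V) in
theorem repr_one : M.repr V (1 : M.Aux n) = 1 := by
  refine LinearMap.ext fun ψ => funext fun I => ?_
  rw [repr_apply, Finset.sum_eq_single I, Module.End.one_apply]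
  · rw [show M.entry 1 I I = 1 from if_pos rfl, iterate_map_one, one_smul, jwExponent,
      Even.neg_one_pow, one_smul]
    exact Finset.even_sum _ fun p _ => by rw [← two_mul, mul_assoc]; exact even_two_mul _
  · intro J _ hJ
    rw [show M.entry 1 I J = 0 from if_neg hJ.symm, iterate_map_zero, zero_smul, smul_zero]
  · simp

variable (V) in
theorem repr_oprod (hg : ∀ y, M.grade (M.grade y) = y) {m : ℕ} (X : Fin m → M.Aux n) :
    M.repr V (oprod X) = (List.ofFn fun i => M.repr V (X i)).prod := by
  rw [oprod, show (List.ofFn fun i => M.repr V (X i)) = (List.ofFn X).map (M.repr V) by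
    rw [List.map_ofFn]; rfl]
  generalize List.ofFn X = l
  induction l with
  | nil => exact M.repr_one V
  | cons x l ih =>
    rw [List.map_cons, List.prod_cons (a := M.repr V x), ← ih, ← M.repr_mul V hg]
    rfl

variable (V) in
theorem repr_auxScale (hs : ∀ s, M.scal s = algebraMap F A s)
    (hg : ∀ s, M.grade (M.scal s) = M.scal s) (s : F) (X : M.Aux n) :
    M.repr V (M.auxScale s X) = s • M.repr V X := by
  refine LinearMap.ext fun ψ => funext fun I => ?_
  rw [LinearMap.smul_apply, Pi.smul_apply, repr_apply, repr_apply, Finset.smul_sum]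
  refine Finset.sum_congr rfl fun J _ => ?_
  rw [show M.entry (M.auxScale s X) I J = M.scal s * M.entry X I J from rfl, iterate_map_mul,
    (show Function.IsFixedPt M.grade (M.scal s) from hg s).iterate, hs, ← Algebra.smul_def,
    smul_assoc, smul_comm]

/-- Only words that differ from `I` at `p` alone contribute, and the remaining sites enter the
exponent with even terms. -/
theorem repr_of_local (X : M.Aux n) (p : Fin n)
    (hX : ∀ I J, (∃ q, q ≠ p ∧ I q ≠ J q) → M.entry X I J = 0) (ψ : (Fin n → Fin 3) → V)
    (I : Fin n → Fin 3) :
    M.repr V X ψ I = ∑ j, (-1 : F) ^ ((par (I p) + par j) * parBelow par I p) •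
      M.grade^[parTotal par (Function.update I p j)] (M.entry X I (Function.update I p j)) •
        ψ (Function.update I p j) := by
  rw [repr_apply]
  refine (Finset.sum_of_injOn (fun j => Function.update I p j) ?_ ?_ ?_ ?_).symm
  · exact fun i _ j _ h => Function.update_injective I p h
  · simp
  · intro J _ hJ
    rw [hX, iterate_map_zero, zero_smul, smul_zero]
    by_contra! h
    refine hJ ⟨J p, by simp, ?_⟩
    funext q
    by_cases hq : q = p
    · subst hq; simp
    · simp only [Function.update_of_ne hq]; exact h q hq
  · intro j _
    congr 1
    refine neg_one_pow_congr ?_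
    rw [jwExponent, ← Finset.add_sum_erase _ _ (Finset.mem_univ p), Nat.even_add (n := ∑ x ∈ _, _),
      Function.update_self, parBelow_update_of_not_lt par I (lt_irrefl p)]
    have : Even (∑ x ∈ Finset.univ.erase p, (par (I x) + par (Function.update I p j x)) *
        parBelow par (Function.update I p j) x) :=
      Finset.even_sum _ fun q hq => by
        rw [Function.update_of_ne (Finset.ne_of_mem_erase hq), ← two_mul, mul_assoc]
        exact even_two_mul _
    simp [this]

variable (V) in
theorem repr_E (p : Fin n) (i j : Fin 3) : M.repr V (M.E p i j) = jw F V par p i j := by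
  refine LinearMap.ext fun ψ => funext fun I => ?_
  have hE : ∀ I J, M.entry (M.E p i j) I J = if I p = i ∧ J p = j ∧ ∀ q, q ≠ p → I q = J q then 1 else 0 :=
    fun I J => rfl
  rw [M.repr_of_local _ p, jw_apply, Finset.sum_eq_single j]
  · by_cases h : I p = i
    · rw [if_pos h, hE, if_pos, iterate_map_one, one_smul, h]
      exact ⟨h, by simp, fun q hq => by rw [Function.update_of_ne hq]⟩
    · rw [if_neg h, hE, if_neg (fun h' => h h'.1), iterate_map_zero, zero_smul, smul_zero]
  · intro k _ hk
    rw [hE, if_neg, iterate_map_zero, zero_smul, smul_zero]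
    rintro ⟨_, h, _⟩
    simp [hk] at h
  · simp
  · rintro I J ⟨q, hq, h⟩
    rw [hE, if_neg]
    exact fun h' => h (h'.2.2 q hq)

variable (V) in
theorem repr_TAux (p : Fin n) (x : P) :
    M.repr V (M.TAux p x) = monOp F V par M.grade p (M.T x) := by
  refine LinearMap.ext fun ψ => funext fun I => ?_
  have hT : ∀ I J, M.entry (M.TAux p x) I J = if ∀ q, q ≠ p → I q = J q then M.T x (I p) (J p) else 0 :=
    fun I J => rfl
  rw [M.repr_of_local _ p, monOp, LinearMap.sum_apply, Finset.sum_apply]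
  symm
  rw [Finset.sum_eq_single (I p)]
  · rw [LinearMap.sum_apply, Finset.sum_apply]
    refine Finset.sum_congr rfl fun j _ => ?_
    rw [Module.End.mul_apply, jw_apply, if_pos rfl, lft_apply, hT, if_pos, Function.update_self]
    exact fun q hq => by rw [Function.update_of_ne hq]
  · intro i _ hi
    rw [LinearMap.sum_apply, Finset.sum_apply, Finset.sum_eq_zero]
    intro j _
    rw [Module.End.mul_apply, jw_apply, if_neg hi.symm]
  · simp
  · rintro I J ⟨q, hq, h⟩
    rw [hT, if_neg]
    exact fun h' => h (h' q hq)

variable (V) in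
theorem repr_R (hs : ∀ s, M.scal s = algebraMap F A s) (hgg : ∀ y, M.grade (M.grade y) = y)
    (hg : ∀ s, M.grade (M.scal s) = M.scal s) (p q : Fin n) (x y : P) :
    M.repr V (M.R p q x y) = rOp V par (M.g x y) p q := by
  rw [R, repr_add, repr_one, M.repr_auxScale V hs hg, rOp]
  congr 2
  change M.reprHom V (M.perm p q) = _
  rw [perm, map_sum, permOp]
  refine Finset.sum_congr rfl fun i _ => ?_
  rw [map_sum]
  refine Finset.sum_congr rfl fun j _ => ?_
  rw [map_zsmul]
  change _ • M.repr V _ = _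
  rw [M.repr_mul V hgg, repr_E, repr_E]
  rcases Nat.even_or_odd (par j) with h | h
  · rw [h.neg_one_pow, h.neg_one_pow, one_smul, one_smul]
  · rw [h.neg_one_pow, h.neg_one_pow, neg_smul, one_smul]
    refine LinearMap.ext fun ψ => ?_
    rw [LinearMap.neg_apply, LinearMap.smul_apply, neg_one_smul]

variable (V) in
/-- The operator `RR` in the Jordan–Wigner representation. -/
def rrOp {a b : ℕ} (u : Fin a → P) (v : Fin b → P) : Module.End F ((Fin (a + b) → Fin 3) → V) :=
  (List.ofFn fun j : Fin b => (List.ofFn fun k : Fin a =>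
    rOp V par (M.g (v j) (u k.rev)) (Fin.natAdd a j) (Fin.castAdd b k.rev)).prod).prod

variable {a b : ℕ}

/-- `1^a 2^b`. -/
def rowState (a b : ℕ) : Fin (a + b) → Fin 3 := Fin.append (fun _ => 0) (fun _ => 1)

/-- `2^a 3^b`. -/
def colState (a b : ℕ) : Fin (a + b) → Fin 3 := Fin.append (fun _ => 1) (fun _ => 2)

/-- No sign appears: the odd units E_32 act first, on a word of even labels, and the units E_21 are
even. -/
theorem prod_jw_mul_prod_jw_single (I : Fin (a + b) → Fin 3) (x : V) :
    ((List.ofFn fun k : Fin a => jw F V par (Fin.castAdd b k) 1 0).prod *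
      (List.ofFn fun j : Fin b => jw F V par (Fin.natAdd a j) 2 1).prod) (Pi.single I x) =
      if I = rowState a b then Pi.single (colState a b) x else 0 := by
  have h1 : (List.ofFn fun k : Fin a => jw F V par (Fin.castAdd b k) 1 0) =
      (List.ofFn (Fin.castAdd b : Fin a → Fin (a + b))).map fun p => jw F V par p 1 0 := by
    rw [List.map_ofFn]; rfl
  have h2 : (List.ofFn fun j : Fin b => jw F V par (Fin.natAdd a j) 2 1) =
      (List.ofFn (Fin.natAdd a : Fin b → Fin (a + b))).map fun p => jw F V par p 2 1 := by
    rw [List.map_ofFn]; rfl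
  have hne : ∀ (i : Fin a) (j : Fin b), Fin.castAdd b i ≠ Fin.natAdd a j := by
    intro i j h
    have := congrArg Fin.val h
    simp at this
    omega
  have hne' : ∀ (i : Fin a) (j : Fin b), Fin.natAdd a j ≠ Fin.castAdd b i := fun i j =>
    (hne i j).symm
  have hsort : (List.ofFn (Fin.castAdd b : Fin a → Fin (a + b))).Pairwise (· < ·) := by
    rw [List.pairwise_ofFn]
    intro i j h
    exact h
  rw [Module.End.mul_apply, h1, h2, prod_jw_single]
  swap
  · rw [List.pairwise_ofFn]
    intro i j h
    simpa using h
  by_cases hI : I = rowState a b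
  · subst hI
    rw [if_pos rfl, if_pos (by simp [rowState]), map_smul, prod_jw_single, if_pos]
    · have : (List.map (fun p => parBelow par (rowState a b) p)
          (List.ofFn (Fin.natAdd a : Fin b → Fin (a + b)))).sum = 0 := by
        rw [List.sum_eq_zero]
        intro m hm
        obtain ⟨p, _, rfl⟩ := List.mem_map.1 hm
        refine Finset.sum_eq_zero fun q _ => ?_
        refine Fin.addCases (fun i => ?_) (fun i => ?_) q <;> simp [rowState, par]
      rw [this]
      have : relabel (relabel (rowState a b) (List.ofFn (Fin.natAdd a : Fin b → Fin (a + b))) 2)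
          (List.ofFn (Fin.castAdd b : Fin a → Fin (a + b))) 1 = colState a b := by
        funext q
        refine Fin.addCases (fun i => ?_) (fun i => ?_) q <;> simp [relabel, colState, List.mem_ofFn, hne]
      rw [this]
      simp [par]
    · simp [relabel, rowState, List.mem_ofFn, hne']
    · exact hsort
  · rw [if_neg hI]
    split_ifs with h
    · rw [map_smul, prod_jw_single, if_neg, smul_zero]
      · intro h'
        refine hI (funext fun q => ?_)
        refine Fin.addCases (fun i => ?_) (fun i => ?_) q
        · have := h' (Fin.castAdd b i) (by simp [List.mem_ofFn])
          simpa [relabel, rowState, List.mem_ofFn, hne'] using this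
        · simpa [rowState] using h (Fin.natAdd a i) (by simp [List.mem_ofFn])
      · exact hsort
    · rw [map_zero]

theorem parTotal_rowState : parTotal par (rowState a b) = 0 := by
  refine Finset.sum_eq_zero fun q _ => ?_
  refine Fin.addCases (fun i => ?_) (fun i => ?_) q <;> simp [rowState, par]

theorem repr_single_apply (X : M.Aux n) (I : Fin n → Fin 3) (x : V) :
    M.repr V X (Pi.single I x) I = M.grade^[parTotal par I] (M.entry X I I) • x := by
  rw [repr_apply, Finset.sum_eq_single I, Pi.single_eq_same, Even.neg_one_pow, one_smul]
  · exact Finset.even_sum _ fun q _ => by rw [← two_mul, mul_assoc]; exact even_two_mul _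
  · intro J _ hJ
    rw [Pi.single_eq_of_ne hJ, smul_zero, smul_zero]
  · simp

theorem repr_mul_prod_E_single (hgg : ∀ y, M.grade (M.grade y) = y) (Y : M.Aux (a + b))
    (I : Fin (a + b) → Fin 3) (x : V) :
    M.repr V (Y * (oprod fun k : Fin a => M.E (Fin.castAdd b k) 1 0) *
        (oprod fun j : Fin b => M.E (Fin.natAdd a j) 2 1)) (Pi.single I x) =
      if I = rowState a b then M.repr V Y (Pi.single (colState a b) x) else 0 := by
  rw [M.repr_mul V hgg, M.repr_mul V hgg, mul_assoc, Module.End.mul_apply,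
    M.repr_oprod V hgg, M.repr_oprod V hgg]
  simp only [repr_E]
  rw [prod_jw_mul_prod_jw_single]
  split_ifs
  · rfl
  · exact map_zero _

/-- The final matrix units leave a single diagonal entry of the super-trace, at the word 1^a 2^b.
That word is even, so neither the super-trace nor the grading involution contributes a sign. -/
theorem betheVector_eq (hs : ∀ s, M.scal s = algebraMap F A s)
    (hgg : ∀ y, M.grade (M.grade y) = y) (hg : ∀ s, M.grade (M.scal s) = M.scal s)
    (u : Fin a → P) (v : Fin b → P) (Ω : V) :
    M.betheVector u v Ω = ((-1) ^ b / M.H v) •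
      ((List.ofFn fun k : Fin a => monOp F V par M.grade (Fin.castAdd b k) (M.T (u k))).prod *
        (List.ofFn fun j : Fin b => monOp F V par M.grade (Fin.natAdd a j) (M.T (v j))).prod *
        M.rrOp V u v) (Pi.single (colState a b) Ω) (rowState a b) := by
  set Y := (oprod fun k : Fin a => M.TAux (Fin.castAdd b k) (u k)) *
        (oprod fun j : Fin b => M.TAux (Fin.natAdd a j) (v j)) *
        M.RR u v with hY
  set Z := Y * (oprod fun k : Fin a => M.E (Fin.castAdd b k) 1 0) *
        (oprod fun j : Fin b => M.E (Fin.natAdd a j) 2 1) with hZ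
  have h0 : ∀ I, I ≠ rowState a b → M.entry Z I I = 0 := by
    intro I hI
    -- Applied to the unit of the regular module, the representation returns the entry itself, up to
    -- the invertible grading.
    have h := M.repr_single_apply Z I (1 : A)
    rw [hZ, M.repr_mul_prod_E_single hgg, if_neg hI, Pi.zero_apply, smul_eq_mul, mul_one] at h
    rw [← M.grade_iterate hgg (parTotal par I) (M.entry Z I I), ← h, iterate_map_zero]
  have h1 : M.entry Z (rowState a b) (rowState a b) • Ω =
      M.repr V Y (Pi.single (colState a b) Ω) (rowState a b) := by
    have h := M.repr_single_apply Z (rowState a b) Ω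
    rw [hZ, M.repr_mul_prod_E_single hgg, if_pos rfl, parTotal_rowState] at h
    exact h.symm
  have h2 : M.str Z = M.entry Z (rowState a b) (rowState a b) := by
    rw [str, Finset.sum_eq_single (rowState a b)]
    · rw [show ∑ p, par (rowState a b p) = 0 from parTotal_rowState, pow_zero, one_mul]
      rfl
    · intro I _ hI
      rw [show Z I I = 0 from h0 I hI, mul_zero]
    · simp
  rw [betheVector, show M.betheOperator u v = M.scal ((-1) ^ b / M.H v) * M.str Z from rfl, h2,
    mul_smul, h1, hs, algebraMap_smul]
  congr 2
  rw [hY, M.repr_mul V hgg, M.repr_mul V hgg, M.repr_oprod V hgg, M.repr_oprod V hgg, RR,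
    M.repr_oprod V hgg, rrOp]
  simp only [M.repr_oprod V hgg, M.repr_R V hs hgg hg, repr_TAux]

end MonodromyData

end SuperBethe
end

/-! ### Adding one site to an exchange algebra -/

noncomputable section
namespace SuperBethe

section Nesting

variable {F R : Type*} [Field F] [Ring R] [Algebra F R]

/-- `m, n, w, l` are the matrix units `E_{ββ}, E_{γγ}, E_{γβ}, E_{βγ}`. -/
structure IsMatrixUnits (m n w l : R) : Prop where
  mm : m * m = m
  mn : m * n = 0
  mw : m * w = 0
  ml : m * l = l
  nm : n * m = 0
  nn : n * n = n
  nw : n * w = w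
  nl : n * l = 0
  wm : w * m = w
  wn : w * n = 0
  ww : w * w = 0
  wl : w * l = n
  lm : l * m = 0
  ln : l * n = l
  lw : l * w = m
  ll : l * l = 0

/-- `m, n, w, l` commute with `D`; `m, n` commute with `B`, and `w, l` do so up to the sign `σ`. -/
structure IsTransverse {κ : Type*} (σ : F) (B D : κ → R) (m n w l : R) : Prop where
  mB : ∀ k, m * B k = B k * m
  nB : ∀ k, n * B k = B k * n
  wB : ∀ k, w * B k = σ • (B k * w)
  lB : ∀ k, l * B k = σ • (B k * l)
  mD : ∀ k, m * D k = D k * m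
  nD : ∀ k, n * D k = D k * n
  wD : ∀ k, w * D k = D k * w
  lD : ∀ k, l * D k = D k * l

variable {κ : Type*}

/-- The creation operator after adding a site with inhomogeneity `g`. -/
def nestB (σ : F) (g : κ → F) (B D : κ → R) (n w : R) (k : κ) : R :=
  B k * (1 + (σ * g k) • n) + (σ * g k) • (D k * w)

/-- The diagonal operator after adding a site with inhomogeneity `g`. -/
def nestD (σ : F) (g : κ → F) (B D : κ → R) (m l : R) (k : κ) : R :=
  D k * (1 + g k • m) + (σ * g k) • (B k * l)

variable {σ : F} {g : κ → F} {B D : κ → R} {m n w l : R}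

/-- The normal form with the site unit on the right. In this form and its three companions the
exchange relations can be compared unit by unit. -/
theorem nestB_mul_nestB (hσ : σ * σ = 1) (hU : IsMatrixUnits m n w l)
    (hT : IsTransverse σ B D m n w l) (j k : κ) :
    nestB σ g B D n w j * nestB σ g B D n w k =
      B j * B k + (σ * g j + σ * g k + g j * g k) • (B j * B k * n) +
        (σ * g k + g j * g k) • (B j * D k * w) + g j • (D j * B k * w) := by
  have e1 : ∀ k x, n * (B k * x) = B k * (n * x) := fun k x => by
    rw [← mul_assoc, hT.nB, mul_assoc]
  have e2 : ∀ k x, n * (D k * x) = D k * (n * x) := fun k x => by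
    rw [← mul_assoc, hT.nD, mul_assoc]
  have e3 : ∀ k x, w * (B k * x) = σ • (B k * (w * x)) := fun k x => by
    rw [← mul_assoc, hT.wB, smul_mul_assoc, mul_assoc]
  have e4 : ∀ k x, w * (D k * x) = D k * (w * x) := fun k x => by
    rw [← mul_assoc, hT.wD, mul_assoc]
  simp only [nestB, mul_add, add_mul, smul_mul_assoc, mul_smul_comm, mul_one, mul_assoc, e1, e2, e3,
    e4, hU.nn, hU.nw, hU.wn, hU.ww, hT.nB, hT.wB, mul_zero, smul_zero]
  linear_combination (norm := module) (g j * g k) • hσ • (B j * (B k * n)) +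
    (g j * g k) • hσ • (B j * (D k * w)) + g j • hσ • (D j * (B k * w))

theorem nestD_mul_nestD (hU : IsMatrixUnits m n w l)
    (hT : IsTransverse σ B D m n w l) (j k : κ) :
    nestD σ g B D m l j * nestD σ g B D m l k =
      D j * D k + (g j + g k + g j * g k) • (D j * D k * m) +
        (σ * ((1 + g j) * g k)) • (D j * B k * l) + (σ * g j) • (B j * D k * l) := by
  have e1 : ∀ k x, m * (B k * x) = B k * (m * x) := fun k x => by
    rw [← mul_assoc, hT.mB, mul_assoc]
  have e2 : ∀ k x, m * (D k * x) = D k * (m * x) := fun k x => by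
    rw [← mul_assoc, hT.mD, mul_assoc]
  have e3 : ∀ k x, l * (B k * x) = σ • (B k * (l * x)) := fun k x => by
    rw [← mul_assoc, hT.lB, smul_mul_assoc, mul_assoc]
  have e4 : ∀ k x, l * (D k * x) = D k * (l * x) := fun k x => by
    rw [← mul_assoc, hT.lD, mul_assoc]
  simp only [nestD, mul_add, add_mul, smul_mul_assoc, mul_smul_comm, mul_one, mul_assoc, e1, e2, e3,
    e4, hU.mm, hU.ml, hU.lm, hU.ll, hT.mD, hT.lD, mul_zero, smul_zero]
  module

theorem nestD_mul_nestB (hσ : σ * σ = 1) (hU : IsMatrixUnits m n w l)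
    (hT : IsTransverse σ B D m n w l) (j k : κ) :
    nestD σ g B D m l j * nestB σ g B D n w k =
      D j * B k + g j • (D j * B k * m) + (σ * g k) • (D j * B k * n) +
        (σ * g k) • (D j * D k * w) + (g j * (1 + σ * g k)) • (B j * B k * l) +
        (g j * g k) • (B j * D k * m) := by
  have e1 : ∀ k x, m * (B k * x) = B k * (m * x) := fun k x => by
    rw [← mul_assoc, hT.mB, mul_assoc]
  have e2 : ∀ k x, m * (D k * x) = D k * (m * x) := fun k x => by
    rw [← mul_assoc, hT.mD, mul_assoc]
  have e3 : ∀ k x, l * (B k * x) = σ • (B k * (l * x)) := fun k x => by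
    rw [← mul_assoc, hT.lB, smul_mul_assoc, mul_assoc]
  have e4 : ∀ k x, l * (D k * x) = D k * (l * x) := fun k x => by
    rw [← mul_assoc, hT.lD, mul_assoc]
  simp only [nestD, nestB, mul_add, add_mul, smul_mul_assoc, mul_smul_comm, mul_one, mul_assoc, e1,
    e2, e3, e4, hU.mn, hU.mw, hU.ln, hU.lw, hT.mB, hT.lB, mul_zero, smul_zero]
  linear_combination (norm := module) g j • hσ • (B j * (B k * l)) +
    (σ * g j * g k) • hσ • (B j * (B k * l)) + (g j * g k) • hσ • (B j * (D k * m))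

theorem nestB_mul_nestD (hσ : σ * σ = 1) (hU : IsMatrixUnits m n w l)
    (hT : IsTransverse σ B D m n w l) (j k : κ) :
    nestB σ g B D n w j * nestD σ g B D m l k =
      B j * D k + g k • (B j * D k * m) + (σ * g j) • (B j * D k * n) +
        (σ * g k) • (B j * B k * l) + (σ * g j * (1 + g k)) • (D j * D k * w) +
        (σ * (g j * g k)) • (D j * B k * n) := by
  have e1 : ∀ k x, n * (B k * x) = B k * (n * x) := fun k x => by
    rw [← mul_assoc, hT.nB, mul_assoc]
  have e2 : ∀ k x, n * (D k * x) = D k * (n * x) := fun k x => by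
    rw [← mul_assoc, hT.nD, mul_assoc]
  have e3 : ∀ k x, w * (B k * x) = σ • (B k * (w * x)) := fun k x => by
    rw [← mul_assoc, hT.wB, smul_mul_assoc, mul_assoc]
  have e4 : ∀ k x, w * (D k * x) = D k * (w * x) := fun k x => by
    rw [← mul_assoc, hT.wD, mul_assoc]
  simp only [nestD, nestB, mul_add, add_mul, smul_mul_assoc, mul_smul_comm, mul_one, mul_assoc, e1,
    e2, e3, e4, hU.nm, hU.nl, hU.wm, hU.wl, hT.nD, hT.wD, mul_zero, smul_zero]
  linear_combination (norm := module) (σ * g j * g k) • hσ • (D j * (B k * n))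

/-- The exchange relations are preserved when a site is added. -/
theorem IsExchange.nest {G : κ → κ → F} (hE : IsExchange σ 1 G B D)
    (hD : ∀ k l, D k * D l = D l * D k) (hanti : ∀ k l, G k l = -G l k)
    (hcross : ∀ k l, k ≠ l → g k * G k l + g k * g l = g l * G k l)
    (hσ : σ * σ = 1) (hU : IsMatrixUnits m n w l) (hT : IsTransverse σ B D m n w l) :
    IsExchange σ 1 G (nestB σ g B D n w) (nestD σ g B D m l) := by
  have hDB := hE.DB
  simp only [one_smul] at hDB
  constructor
  · intro j k hjk
    have hc := hcross j k hjk
    have h1 := hE.BB j k hjk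
    have h2 := congrArg (· * n) h1
    have h3 := congrArg (· * w) (hDB j k hjk)
    have h4 := congrArg (· * w) (hDB k j hjk.symm)
    simp only [smul_mul_assoc, add_mul] at h2 h3 h4
    rw [nestB_mul_nestB hσ hU hT, nestB_mul_nestB hσ hU hT]
    rw [hanti k j] at h3 h4
    -- The coefficients of 1 and `n` agree by `BB` alone. For `w`, both orders of `DB` are needed,
    -- and what is left vanishes by the three-term identity `hcross`.
    linear_combination (norm := module) h1 + (σ * g j + σ * g k + g j * g k) • h2 +
      ((1 + G j k) * g j) • h3 - ((σ + G j k) * g k) • h4 +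
      ((1 + G j k) • hc) • (B j * D k * w) - ((σ + G j k) • hc) • (B k * D j * w) -
      (g j • hσ) • (B k * D j * w)
  · intro j k hjk
    have hc := hcross j k hjk
    have h1 := hDB j k hjk
    have h2 := congrArg (· * m) h1
    have h3 := congrArg (· * n) h1
    have h4 := congrArg (· * n) (hDB k j hjk.symm)
    have h5 := congrArg (· * l) (hE.BB k j hjk.symm)
    simp only [smul_mul_assoc, add_mul] at h2 h3 h4 h5
    rw [one_smul, nestD_mul_nestB hσ hU hT, nestB_mul_nestD hσ hU hT, nestB_mul_nestD hσ hU hT,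
      hD k j]
    rw [hanti k j] at h1 h2 h3 h4 h5 ⊢
    linear_combination (norm := module) h1 + g j • h2 + (σ * g k) • h3 -
      ((1 - G j k) * σ * g j * g k) • h4 - (G j k * σ * g j * g k) • h3 - (σ * g j) • h5 +
      hc • (B j * D k * m) - (σ • hc) • (B j * D k * n) - (σ • hc) • (D j * D k * w) +
      (σ • hc) • (B j * B k * l) - (g j • hσ) • (B j * B k * l)

theorem nestD_comm {G : κ → κ → F} (hE : IsExchange σ 1 G B D)
    (hD : ∀ k l, D k * D l = D l * D k) (hanti : ∀ k l, G k l = -G l k)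
    (hcross : ∀ k l, k ≠ l → g k * G k l + g k * g l = g l * G k l)
    (hU : IsMatrixUnits m n w l) (hT : IsTransverse σ B D m n w l) (j k : κ) :
    nestD σ g B D m l j * nestD σ g B D m l k = nestD σ g B D m l k * nestD σ g B D m l j := by
  rcases eq_or_ne j k with rfl | hjk
  · rfl
  have hDB := hE.DB
  simp only [one_smul] at hDB
  have hc := hcross j k hjk
  have h3 := congrArg (· * l) (hDB j k hjk)
  have h4 := congrArg (· * l) (hDB k j hjk.symm)
  simp only [smul_mul_assoc, add_mul] at h3 h4
  rw [nestD_mul_nestD hU hT, nestD_mul_nestD hU hT, hD k j]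
  rw [hanti k j] at h3 h4
  linear_combination (norm := module) (σ * ((1 + g j) * g k)) • h3 - (σ * ((1 + g k) * g j)) • h4 +
    (σ • hc) • (B k * D j * l) - (σ • hc) • (B j * D k * l)

end Nesting

section Vacuum

variable {F E κ : Type*} [Field F] [AddCommGroup E] [Module F E] [LinearOrder κ]
  {σ : F} {g d : κ → F} {B D : κ → Module.End F E} {m n w l : Module.End F E} {e : E}

omit [LinearOrder κ] in
theorem nestD_apply_vacuum (hD : ∀ k, D k e = d k • e) (hm : m e = e) (hl : l e = 0) (k : κ) :
    nestD σ g B D m l k e = (d k * (1 + g k)) • e := by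
  simp only [nestD, LinearMap.add_apply, LinearMap.smul_apply, Module.End.mul_apply,
    Module.End.one_apply, hm, hl, map_add, map_smul, map_zero, hD, smul_zero, smul_smul, ← add_smul, add_zero]
  congr 1
  ring

/-- Since `w * w = 0` and `n` kills the vacuum, the site is raised at most once. If the new leftmost
factor raises it, its `D k` is carried to the vacuum by `IsExchange.mul_sprod`; if it was raised
before, `n` acts as the identity and `B k` gains the factor `1 + σ * g k`. The two contributions for
the same `j` add up by `hcross`. -/
theorem sprod_nestB_apply_vacuum {G : κ → κ → F} (hE : IsExchange σ 1 G B D) (hG : IsCross G)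
    (hcross : ∀ k l, k ≠ l → g k * G k l + g k * g l = g l * G k l)
    (hσ : σ * σ = 1) (hU : IsMatrixUnits m n w l) (hT : IsTransverse σ B D m n w l)
    (hD : ∀ k, D k e = d k • e) (hn : n e = 0) (W : Finset κ) :
    sprod (nestB σ g B D n w) W e = sprod B W e +
      ∑ j ∈ W, (σ * (g j * exchCoeff σ G j W * d j)) • w (sprod B (W.erase j) e) := by
  have hnW : ∀ W : Finset κ, n (sprod B W e) = 0 := by
    intro W
    have h : n * sprod B W = sprod B W * n := by
      refine (Commute.list_prod_right _ _ fun x hx => ?_).eq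
      obtain ⟨k, _, rfl⟩ := List.mem_map.1 hx
      exact hT.nB k
    rw [← Module.End.mul_apply, h, Module.End.mul_apply, hn, map_zero]
  have hnw : ∀ x, n (w x) = w x := fun x => by rw [← Module.End.mul_apply, hU.nw]
  have hww : ∀ x, w (w x) = 0 := fun x => by rw [← Module.End.mul_apply, hU.ww]; rfl
  have hwD : ∀ k x, D k (w x) = w (D k x) := fun k x => by
    rw [← Module.End.mul_apply, ← hT.wD, Module.End.mul_apply]
  have hwB : ∀ k x, B k (w x) = σ • w (B k x) := fun k x => by
    have h := LinearMap.congr_fun (hT.wB k) x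
    rw [Module.End.mul_apply, LinearMap.smul_apply, Module.End.mul_apply] at h
    rw [h, smul_smul, hσ, one_smul]
  induction W using Finset.induction_on_min with
  | empty => simp
  | insert k W hk ih =>
    have hkW : k ∉ W := fun h => lt_irrefl _ (hk k h)
    have hDk := LinearMap.congr_fun (hE.mul_sprod hG W k hkW) e
    simp only [one_pow, one_smul, LinearMap.add_apply, LinearMap.smul_apply, Module.End.mul_apply,
      LinearMap.sum_apply, hD, map_smul] at hDk
    rw [sprod_insert_min _ hk, sprod_insert_min _ hk, Finset.sum_insert hkW, Module.End.mul_apply,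
      Module.End.mul_apply, ih, exchCoeff_insert_self _ _ hk, Finset.erase_insert hkW]
    simp only [nestB, LinearMap.add_apply, LinearMap.smul_apply, Module.End.mul_apply,
      Module.End.one_apply, map_add, map_sum, map_smul, hnW, hnw, hww, hwD, hwB, hDk, smul_zero,
      add_zero, smul_add, Finset.smul_sum, smul_smul]
    rw [add_assoc, add_assoc, ← Finset.sum_add_distrib]
    congr 2
    · congr 1
      ring
    refine Finset.sum_congr rfl fun j hj => ?_
    rw [exchCoeff_insert _ _ hk hj, erase_insert_min hk hj,
      sprod_insert_min _ fun i hi => hk i (Finset.mem_of_mem_erase hi), Module.End.mul_apply,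
      map_zero, smul_zero, add_zero, ← add_smul, ← add_smul]
    congr 1
    linear_combination (σ * exchCoeff σ G j W * d j) * hcross k j (hk j hj).ne +
      (σ * g j * g k * exchCoeff σ G j W * d j) * hσ

end Vacuum

end SuperBethe
end

/-! ### Nested monodromy matrices over a list of sites -/

noncomputable section
namespace SuperBethe

section Nested

set_option linter.unusedSectionVars false

variable {n : ℕ} {F A V : Type*} [Field F] [Ring A] [Algebra F A]
  [AddCommGroup V] [Module A V] [Module F V] [IsScalarTower F A V] (π : Fin 3 → ℕ) (γ : A →+* A)
  {κ κ' : Type*} (σ : F) (G : κ → κ' → F) (s : κ' → Fin n) (t : κ → Fin 3 → Fin 3 → A)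
  (β δ : Fin 3)

variable (V) in
/-- The creation and diagonal operators of the nested monodromy matrix with the sites of `l`. -/
def nested : List κ' → (κ → Module.End F ((Fin n → Fin 3) → V)) ×
    (κ → Module.End F ((Fin n → Fin 3) → V))
  | [] => (fun k => lft n F V π γ (t k β δ), fun k => lft n F V π γ (t k β β))
  | y :: l =>
    (nestB σ (fun k => G k y) (nested l).1 (nested l).2 (jw F V π (s y) δ δ) (jw F V π (s y) δ β),
      nestD σ (fun k => G k y) (nested l).1 (nested l).2 (jw F V π (s y) β β)
        (jw F V π (s y) β δ))

variable {σ β δ}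

theorem isMatrixUnits_jw (hβδ : β ≠ δ) (p : Fin n) :
    IsMatrixUnits (jw F V π p β β) (jw F V π p δ δ) (jw F V π p δ β) (jw F V π p β δ) := by
  constructor <;> simp [jw_mul_same, hβδ, hβδ.symm]

/-- With β even, every summand of the nested creation operator has the parity of δ and every summand
of the diagonal one is even, whatever sites have been added. -/
theorem nested_mul_jw (hβ : π β = 0) (ht : ∀ k, IsEven π γ (t k)) (l : List κ') (p : Fin n)
    (hp : p ∉ l.map s) (i j : Fin 3) (k : κ) :
    (nested V π γ σ G s t β δ l).1 k * jw F V π p i j = ((-1 : F) ^ (π δ * (π i + π j))) •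
        (jw F V π p i j * (nested V π γ σ G s t β δ l).1 k) ∧
      (nested V π γ σ G s t β δ l).2 k * jw F V π p i j =
        jw F V π p i j * (nested V π γ σ G s t β δ l).2 k := by
  induction l with
  | nil =>
    constructor
    · have := lft_mul_jw (F := F) (V := V) π γ (ht k β δ) p i j
      rwa [hβ, zero_add] at this
    · have := lft_mul_jw (F := F) (V := V) π γ (ht k β β) p i j
      rwa [hβ, zero_add, zero_mul, pow_zero, one_smul] at this
  | cons y l ih =>
    simp only [List.map_cons, List.mem_cons, not_or] at hp
    obtain ⟨ihB, ihD⟩ := ih hp.2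
    have h0 : ∀ a b : Fin 3, jw F V π (s y) a b * jw F V π p i j =
      ((-1 : F) ^ ((π a + π b) * (π i + π j))) • (jw F V π p i j * jw F V π (s y) a b) :=
      fun a b => jw_mul_of_ne π (Ne.symm hp.1) a b i j
    have h1 : jw F V π (s y) β β * jw F V π p i j = jw F V π p i j * jw F V π (s y) β β := by
      rw [h0, hβ, zero_add, zero_mul, pow_zero, one_smul]
    have h2 : jw F V π (s y) δ δ * jw F V π p i j = jw F V π p i j * jw F V π (s y) δ δ := by
      rw [h0, ← two_mul, mul_assoc, pow_mul, neg_one_sq, one_pow, one_smul]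
    have h3 : jw F V π (s y) δ β * jw F V π p i j = ((-1 : F) ^ (π δ * (π i + π j))) •
        (jw F V π p i j * jw F V π (s y) δ β) := by
      rw [h0, hβ, add_zero]
    have h4 : jw F V π (s y) β δ * jw F V π p i j = ((-1 : F) ^ (π δ * (π i + π j))) •
        (jw F V π p i j * jw F V π (s y) β δ) := by
      rw [h0, hβ, zero_add]
    have hs := neg_one_pow_mul_self F (π δ * (π i + π j))
    rw [nested]
    generalize (-1 : F) ^ (π δ * (π i + π j)) = r at *
    constructor
    · have e1 : ∀ x, (nested V π γ σ G s t β δ l).1 k * (jw F V π p i j * x) = r •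
          (jw F V π p i j * ((nested V π γ σ G s t β δ l).1 k * x)) := fun x => by
        rw [← mul_assoc, ihB, smul_mul_assoc, mul_assoc]
      have e2 : ∀ x, (nested V π γ σ G s t β δ l).2 k * (jw F V π p i j * x) =
          (jw F V π p i j * ((nested V π γ σ G s t β δ l).2 k * x)) := fun x => by
        rw [← mul_assoc, ihD, mul_assoc]
      simp only [nestB, add_mul, mul_add, mul_one, smul_mul_assoc, mul_smul_comm, mul_assoc, ihB,
        h2, h3, e1, e2]
      module
    · have e1 : ∀ x, (nested V π γ σ G s t β δ l).1 k * (jw F V π p i j * x) = r •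
          (jw F V π p i j * ((nested V π γ σ G s t β δ l).1 k * x)) := fun x => by
        rw [← mul_assoc, ihB, smul_mul_assoc, mul_assoc]
      have e2 : ∀ x, (nested V π γ σ G s t β δ l).2 k * (jw F V π p i j * x) =
          (jw F V π p i j * ((nested V π γ σ G s t β δ l).2 k * x)) := fun x => by
        rw [← mul_assoc, ihD, mul_assoc]
      simp only [nestD, add_mul, mul_add, mul_one, smul_mul_assoc, mul_smul_comm, mul_assoc, ihD,
        h1, h4, e1, e2, smul_smul]
      rw [hs, mul_one]

theorem commute_nested_fst_jw_self (hβ : π β = 0) (ht : ∀ k, IsEven π γ (t k)) (l : List κ')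
    (p : Fin n) (hp : p ∉ l.map s) (i : Fin 3) (k : κ) :
    Commute ((nested V π γ σ G s t β δ l).1 k) (jw F V π p i i) := by
  rw [commute_iff_eq, (nested_mul_jw π γ G s t hβ ht l p hp i i k).1, ← two_mul,
    mul_left_comm, pow_mul, neg_one_sq, one_pow, one_smul]

theorem isTransverse_nested (hβ : π β = 0) (hσ : (-1 : F) ^ π δ = σ)
    (ht : ∀ k, IsEven π γ (t k)) (l : List κ') (p : Fin n) (hp : p ∉ l.map s) :
    IsTransverse σ (nested V π γ σ G s t β δ l).1 (nested V π γ σ G s t β δ l).2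
      (jw F V π p β β) (jw F V π p δ δ) (jw F V π p δ β) (jw F V π p β δ) := by
  have hB := fun i j k => (nested_mul_jw (σ := σ) (V := V) (δ := δ) π γ G s t hβ ht l p hp i j k).1
  have hD := fun i j k => (nested_mul_jw (σ := σ) (V := V) (δ := δ) π γ G s t hβ ht l p hp i j k).2
  have h1 : (-1 : F) ^ (π δ * π δ) = σ := by
    rw [← hσ]
    exact neg_one_pow_congr (by simp [Nat.even_mul])
  have hσσ : σ * σ = 1 := by rw [← hσ, neg_one_pow_mul_self]
  refine ⟨fun k => ?_, fun k => ?_, fun k => ?_, fun k => ?_, fun k => (hD _ _ k).symm,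
    fun k => (hD _ _ k).symm, fun k => (hD _ _ k).symm, fun k => (hD _ _ k).symm⟩
  · exact (commute_nested_fst_jw_self π γ G s t hβ ht l p hp β k).eq.symm
  · exact (commute_nested_fst_jw_self π γ G s t hβ ht l p hp δ k).eq.symm
  · rw [hB, hβ, add_zero, h1, smul_smul, hσσ, one_smul]
  · rw [hB, hβ, zero_add, h1, smul_smul, hσσ, one_smul]

variable {Gx : κ → κ → F}

theorem IsExchange.lft (hγ : ∀ s : F, γ (algebraMap F A s) = algebraMap F A s) {τ : F}
    {B D : κ → A} (hE : IsExchange σ τ Gx B D) :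
    IsExchange σ τ Gx (fun k => lft n F V π γ (B k)) (fun k => lft n F V π γ (D k)) := by
  constructor
  · intro k l h
    rw [← lft_mul, ← lft_mul, ← lft_smul π γ hγ, ← lft_smul π γ hγ, hE.BB k l h]
  · intro k l h
    simp only [← lft_mul, ← lft_smul π γ hγ, ← lft_add]
    rw [hE.DB k l h]

/-- Only the exchange relations of the row β of `t` enter, not the full RTT relation. For this
reason the result can be applied to transposed monodromy matrices. -/
theorem isExchange_nested (hβ : π β = 0) (hβδ : β ≠ δ) (hσ : (-1 : F) ^ π δ = σ)
    (hγ : ∀ s : F, γ (algebraMap F A s) = algebraMap F A s) (ht : ∀ k, IsEven π γ (t k))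
    (hE : IsExchange σ 1 Gx (fun k => t k β δ) (fun k => t k β β))
    (hD : ∀ k l, t k β β * t l β β = t l β β * t k β β)
    (hanti : ∀ k l, Gx k l = -Gx l k)
    (hcross : ∀ y k l, k ≠ l → G k y * Gx k l + G k y * G l y = G l y * Gx k l)
    (l : List κ') (hl : (l.map s).Nodup) :
    IsExchange σ 1 Gx (nested V π γ σ G s t β δ l).1 (nested V π γ σ G s t β δ l).2 ∧
      ∀ j k, (nested V π γ σ G s t β δ l).2 j * (nested V π γ σ G s t β δ l).2 k =
        (nested V π γ σ G s t β δ l).2 k * (nested V π γ σ G s t β δ l).2 j := by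
  induction l with
  | nil => exact ⟨hE.lft π γ hγ, fun j k => by simp only [nested, ← lft_mul, hD j k]⟩
  | cons y l ih =>
    rw [List.map_cons, List.nodup_cons] at hl
    obtain ⟨ihE, ihD⟩ := ih hl.2
    have hσσ : σ * σ = 1 := by rw [← hσ, neg_one_pow_mul_self]
    have hU := isMatrixUnits_jw (F := F) (V := V) π hβδ (s y)
    have hT := isTransverse_nested (F := F) (V := V) π γ G s t hβ hσ ht l (s y) hl.1
    exact ⟨ihE.nest ihD hanti (hcross y) hσσ hU hT, nestD_comm ihE ihD hanti (hcross y) hU hT⟩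

theorem nested_snd_apply_vacuum (hβ : π β = 0) (hβδ : β ≠ δ) {lam : κ → F} {Ω : V}
    (hΩ : ∀ k, t k β β • Ω = lam k • Ω) (l : List κ') (k : κ) :
    (nested V π γ σ G s t β δ l).2 k (Pi.single (fun _ => β) Ω) =
      (lam k * (l.map fun y => 1 + G k y).prod) • Pi.single (fun _ => β) Ω := by
  induction l generalizing k with
  | nil =>
    funext I
    rw [nested, lft_apply, List.map_nil, List.prod_nil, mul_one, Pi.smul_apply]
    by_cases hI : I = fun _ => β
    · subst hI
      rw [Pi.single_eq_same, ← hΩ, parTotal, Finset.sum_eq_zero fun _ _ => hβ]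
      rfl
    · rw [Pi.single_eq_of_ne hI, smul_zero, smul_zero]
  | cons y l ih =>
    rw [nested, nestD_apply_vacuum (g := fun k => G k y)
      (d := fun k => lam k * (l.map fun y => 1 + G k y).prod)]
    · rw [List.map_cons, List.prod_cons]
      congr 1
      ring
    · exact ih
    · rw [jw_single, if_pos rfl, hβ, zero_add, zero_mul, pow_zero, one_smul]
      congr 1
      exact Function.update_eq_self _ _
    · rw [jw_single, if_neg hβδ]

/-! ### The recursion for nested vectors -/

/-- A vector whose label at `p` is β selects the column β of `t`. There is no sign, since all labels
met are even. -/
theorem monOp_apply_of_jw_eq {p : Fin n} {t : Fin 3 → Fin 3 → A} {ψ : (Fin n → Fin 3) → V}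
    (hψ : jw F V π p β β ψ = ψ) {I : Fin n → Fin 3} (hI : ∀ q, π (I q) = 0) (hβ : π β = 0) :
    monOp F V π γ p t ψ I = t (I p) β • ψ (Function.update I p β) := by
  have h0 : ∀ J : Fin n → Fin 3, J p ≠ β → ψ J = 0 := fun J hJ => by
    rw [← hψ, jw_apply, if_neg hJ]
  rw [monOp, LinearMap.sum_apply, Finset.sum_apply, Finset.sum_eq_single (I p)]
  · rw [LinearMap.sum_apply, Finset.sum_apply, Finset.sum_eq_single β]
    · rw [Module.End.mul_apply, jw_apply, if_pos rfl, hI, hβ, zero_add, zero_mul, pow_zero, one_smul,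
        lft_apply, parTotal, Finset.sum_eq_zero]
      · rfl
      · intro q _
        by_cases hq : q = p
        · subst hq; rw [Function.update_self, hβ]
        · rw [Function.update_of_ne hq, hI]
    · intro j _ hj
      rw [Module.End.mul_apply, jw_apply, if_pos rfl, lft_apply, h0 _ (by simpa using hj), smul_zero,
        smul_zero]
    · simp
  · intro i _ hi
    rw [LinearMap.sum_apply, Finset.sum_apply, Finset.sum_eq_zero]
    intro j _
    rw [Module.End.mul_apply, jw_apply, if_neg hi.symm]
  · simp

/-- The raised site selects the column δ. The entry has the parity of δ and passes a word of the
same parity, which gives the sign σ. -/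
theorem monOp_jw_apply {p : Fin n} {t : Fin 3 → Fin 3 → A} (ht : IsEven π γ t)
    (hσ : (-1 : F) ^ π δ = σ)
    (χ : (Fin n → Fin 3) → V) {I : Fin n → Fin 3} (hI : ∀ q, π (I q) = 0) :
    monOp F V π γ p t (jw F V π p δ β χ) I = σ • t (I p) δ • χ (Function.update I p β) := by
  have h0 : ∀ j, jw F V π p δ β χ (Function.update I p j) =
      if j = δ then χ (Function.update I p β) else 0 := fun j => by
    rw [jw_apply, Function.update_self]
    split_ifs with h
    · rw [parBelow_update_of_not_lt π I (lt_irrefl p), parBelow, Finset.sum_eq_zero fun q _ => hI q,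
        mul_zero, pow_zero, one_smul, Function.update_idem]
    · rfl
  rw [monOp, LinearMap.sum_apply, Finset.sum_apply, Finset.sum_eq_single (I p)]
  · rw [LinearMap.sum_apply, Finset.sum_apply, Finset.sum_eq_single δ]
    · have h1 : parTotal π (Function.update I p δ) = π δ := by
        have := parTotal_update π I p δ
        rwa [hI, add_zero, show parTotal π I = 0 from Finset.sum_eq_zero fun q _ => hI q,
          zero_add] at this
      rw [Module.End.mul_apply, jw_apply, if_pos rfl, parBelow, Finset.sum_eq_zero fun q _ => hI q,
        mul_zero, pow_zero, one_smul, lft_apply, h0, if_pos rfl, h1,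
        iterate_of_homogeneous γ (ht (I p) δ), neg_one_pow_mul_smul (F := F), hI, zero_add, ← hσ]
      congr 1
      exact neg_one_pow_congr (by simp [Nat.even_mul])
    · intro j _ hj
      rw [Module.End.mul_apply, jw_apply, if_pos rfl, lft_apply, h0, if_neg hj, smul_zero,
        smul_zero]
    · simp
  · intro i _ hi
    rw [LinearMap.sum_apply, Finset.sum_apply, Finset.sum_eq_zero]
    intro j _
    rw [Module.End.mul_apply, jw_apply, if_neg hi.symm]
  · simp

end Nested

section Recursion

set_option linter.unusedSectionVars false

variable {n : ℕ} {F A V : Type*} [Field F] [Ring A] [Algebra F A]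
  [AddCommGroup V] [Module A V] [Module F V] [IsScalarTower F A V] (π : Fin 3 → ℕ) (γ : A →+* A)
  {κ κ' : Type*} [LinearOrder κ] (σ : F) (G : κ → κ' → F) (s : κ' → Fin n)
  (t : κ → Fin 3 → Fin 3 → A) (t' : κ' → Fin 3 → Fin 3 → A) (α β δ : Fin 3) (Ω : V)

/-- The nested Bethe vector: the coefficient at `α ⋯ α` on the sites of `l` of the vector created by
the nested operators. -/
def nestedVector (l : List κ') (W : Finset κ) : V :=
  (l.map fun y => monOp F V π γ (s y) (t' y)).prod
    (sprod (nested V π γ σ G s t β δ l).1 W (Pi.single (fun _ => β) Ω))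
    (relabel (fun _ => β) (l.map s) α)

theorem nestedVector_nil (hβ : π β = 0) (W : Finset κ) :
    nestedVector π γ σ G s t t' α β δ Ω [] W = sprod (fun k => t k β δ) W • Ω := by
  have h0 : relabel (fun _ : Fin n => β) [] α = fun _ => β := by funext q; simp [relabel]
  rw [nestedVector, List.map_nil, List.prod_nil, Module.End.one_apply, List.map_nil, h0]
  suffices h : ∀ l : List κ, (l.map (nested V π γ σ G s t β δ []).1).prod
      (Pi.single (fun _ => β) Ω) (fun _ => β) = (l.map fun k => t k β δ).prod • Ω from h _
  intro l
  induction l with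
  | nil => simp
  | cons k l ih =>
    rw [List.map_cons, List.prod_cons, List.map_cons, List.prod_cons, Module.End.mul_apply, mul_smul,
      ← ih, nested, lft_apply, parTotal, Finset.sum_eq_zero fun _ _ => hβ]
    rfl

variable {α β δ}

/-- The last site added is the first to be evaluated. In `sprod_nestB_apply_vacuum` its label is β
in the first term and δ in the others, so the monodromy matrix at this site contributes its entries
`α β` and `α δ` respectively. The rest is the nested vector with one site fewer. -/
theorem nestedVector_cons (hα : π α = 0) (hβ : π β = 0) (hβδ : β ≠ δ)
    (hσ : (-1 : F) ^ π δ = σ)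
    (hγ : ∀ s : F, γ (algebraMap F A s) = algebraMap F A s) (ht : ∀ k, IsEven π γ (t k))
    (ht' : ∀ y, IsEven π γ (t' y)) {Gx : κ → κ → F}
    (hE : IsExchange σ 1 Gx (fun k => t k β δ) (fun k => t k β β))
    (hD : ∀ k l, t k β β * t l β β = t l β β * t k β β)
    (hanti : ∀ k l, Gx k l = -Gx l k) (hG : IsCross Gx)
    (hcross : ∀ y k l, k ≠ l → G k y * Gx k l + G k y * G l y = G l y * Gx k l)
    {lam : κ → F} (hΩ : ∀ k, t k β β • Ω = lam k • Ω)
    (y : κ') (l : List κ') (hl : ((y :: l).map s).Nodup) (W : Finset κ) :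
    nestedVector π γ σ G s t t' α β δ Ω (y :: l) W =
      t' y α β • nestedVector π γ σ G s t t' α β δ Ω l W +
        t' y α δ • ∑ j ∈ W, (G j y * exchCoeff σ Gx j W * (lam j * (l.map fun y => 1 + G j y).prod)) •
          nestedVector π γ σ G s t t' α β δ Ω l (W.erase j) := by
  have hs := IsScalarTower.to_smulCommClass (R := F) (A := A) (M := V)
  rw [List.map_cons, List.nodup_cons] at hl
  have hσσ : σ * σ = 1 := by rw [← hσ, neg_one_pow_mul_self]
  obtain ⟨hE', -⟩ := isExchange_nested (V := V) π γ G s t hβ hβδ hσ hγ ht hE hD hanti hcross l hl.2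
  have hU := isMatrixUnits_jw (F := F) (V := V) π hβδ (s y)
  have hT := isTransverse_nested (F := F) (V := V) π γ G s t hβ hσ ht l (s y) hl.1
  have hexp := sprod_nestB_apply_vacuum (g := fun k => G k y)
    (d := fun k => lam k * (l.map fun y => 1 + G k y).prod) (e := Pi.single (fun _ => β) Ω)
    hE' hG (hcross y) hσσ hU hT
    (fun k => nested_snd_apply_vacuum π γ G s t hβ hβδ hΩ l k)
    (by rw [jw_single, if_neg hβδ]) W
  set Y := (l.map fun y => monOp F V π γ (s y) (t' y)).prod with hY
  have hYjw : ∀ i j, Commute Y (jw F V π (s y) i j) := fun i j =>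
    Commute.list_prod_left _ _ fun c hc => by
      obtain ⟨z, hz, rfl⟩ := List.mem_map.1 hc
      exact commute_monOp_jw π γ (ht' z) (fun h => hl.1 (List.mem_map.2 ⟨z, hz, h⟩)) i j
  have hBjw : ∀ W, Commute (sprod (nested V π γ σ G s t β δ l).1 W) (jw F V π (s y) β β) :=
    fun W => Commute.list_prod_left _ _ fun c hc => by
      obtain ⟨k, _, rfl⟩ := List.mem_map.1 hc
      exact commute_nested_fst_jw_self π γ G s t hβ ht l (s y) hl.1 β k
  have hvac : jw F V π (s y) β β (Pi.single (fun _ => β) Ω) = Pi.single (fun _ => β) Ω := by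
    rw [jw_single, if_pos rfl, hβ, zero_add, zero_mul, pow_zero, one_smul]
    congr 1
    exact Function.update_eq_self _ _
  have hfix : jw F V π (s y) β β (Y (sprod (nested V π γ σ G s t β δ l).1 W
      (Pi.single (fun _ => β) Ω))) = Y (sprod (nested V π γ σ G s t β δ l).1 W
      (Pi.single (fun _ => β) Ω)) := by
    rw [← Module.End.mul_apply, ← (hYjw β β).eq, Module.End.mul_apply, ← Module.End.mul_apply
      (jw F V π (s y) β β), ← (hBjw W).eq, Module.End.mul_apply, hvac]
  set I := relabel (fun _ : Fin n => β) ((y :: l).map s) α with hI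
  have hI0 : ∀ q, π (I q) = 0 := fun q => by
    simp only [hI, relabel]
    split_ifs <;> assumption
  have hIy : I (s y) = α := by simp [hI, relabel]
  have hIu : Function.update I (s y) β = relabel (fun _ => β) (l.map s) α := by
    funext q
    by_cases hq : q = s y
    · subst hq
      rw [Function.update_self, relabel, if_neg hl.1]
    · rw [Function.update_of_ne hq]
      simp [hI, relabel, hq]
  rw [nestedVector, List.map_cons, List.prod_cons, ← hY, Module.End.mul_apply, nested, hexp, map_add,
    map_add, Pi.add_apply, monOp_apply_of_jw_eq π γ hfix hI0 hβ, hIu, hIy]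
  congr 1
  rw [map_sum, map_sum, Finset.sum_apply, Finset.smul_sum]
  refine Finset.sum_congr rfl fun j _ => ?_
  rw [map_smul, map_smul, Pi.smul_apply, ← Module.End.mul_apply Y, (hYjw δ β).eq,
    Module.End.mul_apply, monOp_jw_apply π γ (ht' y) hσ _ hI0, hIu, hIy, smul_smul,
    smul_comm (t' y α δ)]
  congr 1
  -- The sign from the expansion cancels the one from `monOp_jw_apply`.
  rw [mul_right_comm, hσσ, one_mul]

end Recursion

end SuperBethe
end

/-! ### Truncation of the R-matrices to two labels -/

noncomputable section
namespace SuperBethe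

section Truncation

set_option linter.unusedSectionVars false

variable {n : ℕ} {F A V : Type*} [Field F] [Ring A] [Algebra F A]
  [AddCommGroup V] [Module A V] [Module F V] [IsScalarTower F A V] (π : Fin 3 → ℕ) (γ : A →+* A)

theorem univ_eq_of_distinct {α β δ : Fin 3} (h1 : α ≠ β) (h2 : α ≠ δ) (h3 : β ≠ δ) :
    (Finset.univ : Finset (Fin 3)) = {α, β, δ} := by
  revert α β δ
  decide

theorem sum_eq_of_distinct {M : Type*} [AddCommMonoid M] {α β δ : Fin 3} (h1 : α ≠ β) (h2 : α ≠ δ)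
    (h3 : β ≠ δ) (f : Fin 3 → M) : ∑ i, f i = f α + (f β + f δ) := by
  rw [univ_eq_of_distinct h1 h2 h3, Finset.sum_insert (by simp [h1, h2]),
    Finset.sum_insert (by simp [h3]), Finset.sum_singleton]

/-- The vectors in which no site carries the label `α`. -/
def noLabel (F : Type*) [Field F] (n : ℕ) (V : Type*) [AddCommGroup V] [Module F V] (π : Fin 3 → ℕ)
    (α : Fin 3) : Submodule F ((Fin n → Fin 3) → V) :=
  ⨅ (p : Fin n) (i : Fin 3), LinearMap.ker (jw F V π p i α)

theorem mem_noLabel {α : Fin 3} {ψ : (Fin n → Fin 3) → V} :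
    ψ ∈ noLabel F n V π α ↔ ∀ p i, jw F V π p i α ψ = 0 := by
  simp [noLabel, Submodule.mem_iInf]

theorem jw_mem_noLabel {α : Fin 3} {ψ : (Fin n → Fin 3) → V} (hψ : ψ ∈ noLabel F n V π α)
    (p : Fin n) {i : Fin 3} (hi : i ≠ α) (j : Fin 3) : jw F V π p i j ψ ∈ noLabel F n V π α := by
  rw [mem_noLabel] at hψ ⊢
  intro q k
  rw [← Module.End.mul_apply]
  by_cases hpq : q = p
  · subst hpq
    rw [jw_mul_same, if_neg hi.symm]
    rfl
  · rw [jw_mul_of_ne π hpq, LinearMap.smul_apply, Module.End.mul_apply, hψ, map_zero, smul_zero]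

theorem single_mem_noLabel {α : Fin 3} {I : Fin n → Fin 3} (hI : ∀ p, I p ≠ α) (x : V) :
    (Pi.single I x : (Fin n → Fin 3) → V) ∈ noLabel F n V π α := by
  rw [mem_noLabel]
  intro p i
  rw [jw_single, if_neg (hI p)]

/-- `X` and `Y` agree on the submodule `N`, which is stable under them. -/
def AgreeOn {E : Type*} [AddCommGroup E] [Module F E] (N : Submodule F E) (X Y : Module.End F E) :
    Prop := ∀ ψ ∈ N, X ψ = Y ψ ∧ Y ψ ∈ N

theorem AgreeOn.list_prod {E ι : Type*} [AddCommGroup E] [Module F E] {N : Submodule F E}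
    (l : List ι) {X Y : ι → Module.End F E} (h : ∀ i, AgreeOn N (X i) (Y i)) :
    AgreeOn N (l.map X).prod (l.map Y).prod := by
  induction l with
  | nil => exact fun ψ hψ => ⟨rfl, hψ⟩
  | cons i l ih =>
    intro ψ hψ
    obtain ⟨h1, h2⟩ := ih ψ hψ
    simp only [List.map_cons, List.prod_cons, Module.End.mul_apply]
    rw [h1]
    exact h i _ h2

variable (F V) in
/-- The graded permutation, truncated to two labels. -/
def permTrunc (σ : F) (β δ : Fin 3) (p q : Fin n) : Module.End F ((Fin n → Fin 3) → V) :=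
  jw F V π p β β * jw F V π q β β + σ • (jw F V π p β δ * jw F V π q δ β) +
    jw F V π p δ β * jw F V π q β δ + σ • (jw F V π p δ δ * jw F V π q δ δ)

variable (V) in
/-- `1 + G P_{pq}` for the truncated permutation. -/
def rTrunc (σ : F) (β δ : Fin 3) (G : F) (p q : Fin n) : Module.End F ((Fin n → Fin 3) → V) :=
  1 + G • permTrunc F V π σ β δ p q

variable {α β δ : Fin 3} {σ : F}

/-- On words without the label α, every summand of the permutation that involves α has a unit that
needs α to be present or one that would only move it, hence vanishes. The remaining summands create
only β and δ. -/
theorem agreeOn_rOp_rTrunc (hβ : π β = 0) (h1 : α ≠ β) (h2 : α ≠ δ) (h3 : β ≠ δ)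
    (hσ : (-1 : F) ^ π δ = σ) (G : F) {p q : Fin n} (hpq : p ≠ q) :
    AgreeOn (noLabel F n V π α) (rOp V π G p q) (rTrunc V π σ β δ G p q) := by
  intro ψ hψ
  have h0 := (mem_noLabel π).1 hψ
  have ha : ∀ i j, (jw F V π p i α * jw F V π q j i) ψ = 0 := fun i j => by
    rw [jw_mul_of_ne π hpq, LinearMap.smul_apply, Module.End.mul_apply, h0, map_zero, smul_zero]
  have hb : ∀ i j, (jw F V π p α i * jw F V π q j α) ψ = 0 := fun i j => by
    rw [Module.End.mul_apply, h0, map_zero]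
  constructor
  · rw [rOp, rTrunc, LinearMap.add_apply, LinearMap.add_apply, LinearMap.smul_apply,
      LinearMap.smul_apply, permOp]
    congr 2
    simp only [sum_eq_of_distinct h1 h2 h3, permTrunc, LinearMap.add_apply, LinearMap.smul_apply, ha,
      hb, hσ, hβ, pow_zero, one_smul, smul_zero, zero_add]
    abel
  · have hm : ∀ i j k l, i ≠ α → k ≠ α →
        (jw F V π p i j * jw F V π q k l) ψ ∈ noLabel F n V π α := fun i j k l hi hk =>
      jw_mem_noLabel π (jw_mem_noLabel π hψ q hk l) p hi j
    rw [rTrunc, LinearMap.add_apply, LinearMap.smul_apply]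
    refine Submodule.add_mem _ hψ (Submodule.smul_mem _ _ ?_)
    exact Submodule.add_mem _ (Submodule.add_mem _ (Submodule.add_mem _ (hm _ _ _ _ h1.symm h1.symm)
      (Submodule.smul_mem _ _ (hm _ _ _ _ h1.symm h2.symm))) (hm _ _ _ _ h2.symm h1.symm))
      (Submodule.smul_mem _ _ (hm _ _ _ _ h2.symm h2.symm))

theorem commute_rTrunc (G : F) {p q : Fin n} {X : Module.End F ((Fin n → Fin 3) → V)}
    (h : ∀ i j, Commute (jw F V π p i j * jw F V π q j i) X) :
    Commute (rTrunc V π σ β δ G p q) X :=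
  (Commute.one_left _).add_left (((((h _ _).add_left ((h _ _).smul_left _)).add_left
    (h _ _)).add_left ((h _ _).smul_left _)).smul_left _)

theorem commute_rTrunc_jw (G : F) {p q r : Fin n} (hp : p ≠ r) (hq : q ≠ r) (k l : Fin 3) :
    Commute (rTrunc V π σ β δ G p q) (jw F V π r k l) :=
  commute_rTrunc π G fun i j => commute_jw_mul_jw π hp hq i j k l

theorem commute_jw_mul_jw_lft {a : A} {d : ℕ} (ha : γ a = (-1) ^ d * a) (p q : Fin n)
    (i j : Fin 3) : Commute (jw F V π p i j * jw F V π q j i) (lft n F V π γ a) := by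
  refine Commute.symm ?_
  rw [commute_iff_eq, ← mul_assoc, lft_mul_jw π γ ha p i j, smul_mul_assoc, mul_assoc,
    lft_mul_jw π γ ha q j i, mul_smul_comm, smul_smul, add_comm (π j), neg_one_pow_mul_self,
    one_smul, mul_assoc]

theorem commute_rTrunc_monOp (G : F) {t : Fin 3 → Fin 3 → A} (ht : IsEven π γ t) {p q r : Fin n}
    (hp : p ≠ r) (hq : q ≠ r) : Commute (rTrunc V π σ β δ G p q) (monOp F V π γ r t) :=
  commute_rTrunc π G fun i j => Commute.sum_right _ _ _ fun k _ => Commute.sum_right _ _ _ fun l _ =>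
    (commute_jw_mul_jw π hp hq i j k l).mul_right (commute_jw_mul_jw_lft π γ (ht k l) p q i j)

variable {κ κ' : Type*} (G : κ → κ' → F) (s : κ' → Fin n) (t : κ → Fin 3 → Fin 3 → A)

/-- The row `β` of the monodromy matrix dressed by the truncated `R`-matrices. -/
theorem jw_mul_monOp_mul_prod_rTrunc (hβ : π β = 0) (h1 : α ≠ β) (h2 : α ≠ δ) (h3 : β ≠ δ)
    (hσ : (-1 : F) ^ π δ = σ) (ht : ∀ k, IsEven π γ (t k)) (k : κ) (p : Fin n)
    (l : List κ') (hl : (l.map s).Nodup) (hp : p ∉ l.map s) :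
    jw F V π p β β * monOp F V π γ p (t k) *
        (l.reverse.map fun y => rTrunc V π σ β δ (G k y) p (s y)).prod =
      jw F V π p β β * (nested V π γ σ G s t β δ l).2 k +
        jw F V π p β δ * (nested V π γ σ G s t β δ l).1 k +
        jw F V π p β α * lft n F V π γ (t k β α) := by
  induction l with
  | nil =>
    rw [List.reverse_nil, List.map_nil, List.prod_nil, mul_one, monOp,
      sum_eq_of_distinct h1 h2 h3]
    simp only [mul_add, Finset.mul_sum, ← mul_assoc, jw_mul_same, if_neg h1.symm, if_neg h3, zero_mul,
      Finset.sum_const_zero, zero_add, add_zero, if_true]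
    rw [sum_eq_of_distinct h1 h2 h3, nested]
    abel
  | cons y l ih =>
    simp only [List.map_cons, List.mem_cons, not_or, List.nodup_cons] at hp hl
    have hB := fun i j => (nested_mul_jw (σ := σ) (V := V) (δ := δ) π γ G s t hβ ht l p hp.2 i j k).1
    have hD := fun i j => (nested_mul_jw (σ := σ) (V := V) (δ := δ) π γ G s t hβ ht l p hp.2 i j k).2
    have hBs : ∀ x, (nested V π γ σ G s t β δ l).1 k * (jw F V π p δ β * x) = σ •
        (jw F V π p δ β * ((nested V π γ σ G s t β δ l).1 k * x)) := fun x => by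
      rw [← mul_assoc, hB, smul_mul_assoc, mul_assoc, hβ, add_zero, ← hσ]
      congr 1
      exact neg_one_pow_congr (by simp [Nat.even_mul])
    have hBs' : ∀ x, (nested V π γ σ G s t β δ l).1 k * (jw F V π p β δ * x) = σ •
        (jw F V π p β δ * ((nested V π γ σ G s t β δ l).1 k * x)) := fun x => by
      rw [← mul_assoc, hB, smul_mul_assoc, mul_assoc, hβ, zero_add, ← hσ]
      congr 1
      exact neg_one_pow_congr (by simp [Nat.even_mul])
    have hBd : ∀ i x, (nested V π γ σ G s t β δ l).1 k * (jw F V π p i i * x) =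
        (jw F V π p i i * ((nested V π γ σ G s t β δ l).1 k * x)) := fun i x => by
      rw [← mul_assoc, (commute_nested_fst_jw_self π γ G s t hβ ht l p hp.2 i k).eq, mul_assoc]
    have hDx : ∀ i j x, (nested V π γ σ G s t β δ l).2 k * (jw F V π p i j * x) =
        (jw F V π p i j * ((nested V π γ σ G s t β δ l).2 k * x)) := fun i j x => by
      rw [← mul_assoc, hD, mul_assoc]
    -- The entry with column α never meets the truncated permutations, which have no row α; it is
    -- carried along unchanged.
    have hl0 : jw F V π p β α * lft n F V π γ (t k β α) * permTrunc F V π σ β δ p (s y) = 0 := by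
      have hc : Commute (permTrunc F V π σ β δ p (s y)) (lft n F V π γ (t k β α)) :=
        have h := commute_jw_mul_jw_lft (F := F) (V := V) π γ (ht k β α) p (s y)
        ((((h _ _).add_left ((h _ _).smul_left _)).add_left (h _ _)).add_left
          ((h _ _).smul_left _))
      rw [mul_assoc, ← hc.eq, ← mul_assoc, permTrunc]
      simp only [mul_add, mul_smul_comm, ← mul_assoc, jw_mul_same, if_neg h1, if_neg h2, zero_mul,
        smul_zero, add_zero]
    rw [List.reverse_cons, List.map_append, List.prod_append, ← mul_assoc, ih hl.2 hp.2]
    simp only [List.map_cons, List.map_nil, List.prod_cons, List.prod_nil, mul_one]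
    rw [rTrunc, add_mul, mul_add (_ * lft n F V π γ _), mul_smul_comm, hl0, smul_zero, add_zero, mul_one]
    congr 1
    have e : ∀ i j k l x, jw F V π p i j * (jw F V π p k l * x) =
        if j = k then jw F V π p i l * x else 0 := fun i j k l x => by
      rw [← mul_assoc, jw_mul_same]
      split_ifs <;> simp
    simp only [permTrunc, nested, nestB, nestD, mul_add, add_mul, mul_one, mul_smul_comm,
      mul_assoc, hBs, hBs', hBd, hDx, e, if_neg h3, if_neg h3.symm, if_true, smul_zero,
      add_zero, zero_add, smul_add]
    module

/-- The unit on the right keeps, of the dressed row β, only the column δ, which is the nested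
creation operator. -/
theorem jw_mul_monOp_mul_prod_rTrunc_mul_jw (hβ : π β = 0) (h1 : α ≠ β) (h2 : α ≠ δ) (h3 : β ≠ δ)
    (hσ : (-1 : F) ^ π δ = σ) (ht : ∀ k, IsEven π γ (t k)) (k : κ) (p : Fin n)
    (l : List κ') (hl : (l.map s).Nodup) (hp : p ∉ l.map s) :
    jw F V π p β β * (monOp F V π γ p (t k) *
        (l.reverse.map fun y => rTrunc V π σ β δ (G k y) p (s y)).prod * jw F V π p δ β) =
      σ • (jw F V π p β β * (nested V π γ σ G s t β δ l).1 k) := by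
  rw [← mul_assoc, ← mul_assoc, jw_mul_monOp_mul_prod_rTrunc π γ G s t hβ h1 h2 h3 hσ ht k p l hl hp,
    add_mul, add_mul, mul_assoc, mul_assoc, mul_assoc,
    (nested_mul_jw π γ G s t hβ ht l p hp δ β k).1, (nested_mul_jw π γ G s t hβ ht l p hp δ β k).2,
    lft_mul_jw π γ (ht k β α), mul_smul_comm, mul_smul_comm, ← mul_assoc, ← mul_assoc, ← mul_assoc,
    jw_mul_same, jw_mul_same, jw_mul_same, if_neg h3, if_pos rfl, if_neg h2, zero_mul, zero_mul,
    smul_zero, zero_add, add_zero, hβ, add_zero, ← hσ]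
  congr 1
  exact neg_one_pow_congr (by simp [Nat.even_mul])

end Truncation

end SuperBethe
end

/-! ### Regrouping the operators site by site -/

noncomputable section
namespace SuperBethe

section Regroup

set_option linter.unusedSectionVars false

variable {n : ℕ} {F A V : Type*} [Field F] [Ring A] [Algebra F A]
  [AddCommGroup V] [Module A V] [Module F V] [IsScalarTower F A V] (π : Fin 3 → ℕ) (γ : A →+* A)
  {κ κ' : Type*} [LinearOrder κ] {σ : F} (G : κ → κ' → F) (s : κ' → Fin n) (s' : κ → Fin n)
  (t : κ → Fin 3 → Fin 3 → A) (t' : κ' → Fin 3 → Fin 3 → A) {α β δ : Fin 3} (Ω : V)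

theorem prod_jw_self_apply (l : List κ) (β : Fin 3) (ψ : (Fin n → Fin 3) → V) {I : Fin n → Fin 3}
    (hI : ∀ k ∈ l, I (s' k) = β) : (l.map fun k => jw F V π (s' k) β β).prod ψ I = ψ I := by
  induction l with
  | nil => rfl
  | cons k l ih =>
    rw [List.map_cons, List.prod_cons, Module.End.mul_apply, jw_apply, if_pos (hI k (by simp)),
      ← two_mul, mul_assoc, pow_mul, neg_one_sq, one_pow, one_smul, ← hI k (by simp),
      Function.update_eq_self, hI k (by simp), ih fun k hk => hI k (by simp [hk])]

theorem list_prod_map_smul {R : Type*} [Ring R] [Algebra F R] (l : List κ) (X : κ → R) (σ : F) :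
    (l.map fun k => σ • X k).prod = σ ^ l.length • (l.map X).prod := by
  induction l with
  | nil => simp
  | cons k l ih =>
    rw [List.map_cons, List.prod_cons, ih, List.map_cons, List.prod_cons, smul_mul_smul_comm,
      List.length_cons, pow_succ']

/-- The reference word is created from β⋯β by units `jw δ β` at the sites `s' k`, and the component
taken has label β there, so projectors `jw β β` may be inserted on the left. As factors belonging to
different `k` commute, each `k` can be treated alone, where projector, dressed monodromy matrix and
unit combine to a nested creation operator with a sign σ. -/
theorem prod_monOp_mul_prod_rOp_apply (hβ : π β = 0) (h1 : α ≠ β) (h2 : α ≠ δ)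
    (h3 : β ≠ δ) (hσ : (-1 : F) ^ π δ = σ) (ht : ∀ k, IsEven π γ (t k))
    (ht' : ∀ y, IsEven π γ (t' y)) (l : List κ) (l' : List κ') (hl : l.Pairwise (· < ·))
    (hs' : (l.map s').Pairwise (· < ·)) (hs : (l'.map s).Nodup)
    (hd : ∀ k ∈ l, ∀ y ∈ l', s' k ≠ s y) :
    ((l'.map fun y => monOp F V π γ (s y) (t' y)).prod *
        (l.map fun k => monOp F V π γ (s' k) (t k)).prod *
        (l.map fun k => (l'.reverse.map fun y => rOp V π (G k y) (s' k) (s y)).prod).prod)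
        (Pi.single (relabel (fun _ => β) (l.map s') δ) Ω) (relabel (fun _ => β) (l'.map s) α) =
      σ ^ l.length • nestedVector π γ σ G s t t' α β δ Ω l' l.toFinset := by
  have hnd : l.Nodup := hl.imp fun h => h.ne
  have hnd' : ∀ k ∈ l, ∀ k' ∈ l, k ≠ k' → s' k ≠ s' k' := by
    have := List.inj_on_of_nodup_map (hs'.imp fun h => h.ne)
    exact fun k hk k' hk' hne h => hne (this hk hk' h)
  have hp : ∀ k ∈ l, s' k ∉ l'.map s := fun k hk h => by
    obtain ⟨y, hy, h⟩ := List.mem_map.1 h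
    exact hd k hk y hy h.symm
  set Tx := fun k => monOp F V π γ (s' k) (t k) with hTx
  set Y := (l'.map fun y => monOp F V π γ (s y) (t' y)).prod with hY
  set ρ := fun k => (l'.reverse.map fun y => rTrunc V π σ β δ (G k y) (s' k) (s y)).prod with hρ
  set e := fun k => jw F V π (s' k) β β with he
  set f := fun k => jw F V π (s' k) δ β with hf
  set B := (nested V π γ σ G s t β δ l').1 with hB
  -- replace the `R`-matrices by the truncated ones
  have hagree : (l.map fun k => (l'.reverse.map fun y => rOp V π (G k y) (s' k) (s y)).prod).prod
      (Pi.single (relabel (fun _ => β) (l.map s') δ) Ω) = (l.map ρ).prod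
      (Pi.single (relabel (fun _ => β) (l.map s') δ) Ω) := by
    -- The sites of an R-matrix are known to be distinct only for members of the lists, hence the
    -- attached lists.
    have hsub : AgreeOn (noLabel F n V π α)
        (l.attach.map fun k => (l'.reverse.attach.map fun y =>
          rOp V π (G k.1 y.1) (s' k.1) (s y.1)).prod).prod
        (l.attach.map fun k => (l'.reverse.attach.map fun y =>
          rTrunc V π σ β δ (G k.1 y.1) (s' k.1) (s y.1)).prod).prod :=
      AgreeOn.list_prod _ fun k => AgreeOn.list_prod _ fun y =>
        agreeOn_rOp_rTrunc π hβ h1 h2 h3 hσ _ (hd k.1 k.2 y.1 (List.mem_reverse.1 y.2))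
    have h := (hsub (Pi.single (relabel (fun _ => β) (l.map s') δ) Ω)
      (single_mem_noLabel π (fun p => by
        rw [relabel]; split_ifs
        · exact h2.symm
        · exact h1.symm) _)).1
    simpa only [List.attach_map_subtype_val, hρ, List.map_attach_eq_pmap, List.pmap_eq_map] using h
  -- the reference state
  have hvac : (Pi.single (relabel (fun _ => β) (l.map s') δ) Ω : (Fin n → Fin 3) → V) =
      (l.map f).prod (Pi.single (fun _ => β) Ω) := by
    have h := prod_jw_single (F := F) π (l.map s') hs' δ β (fun _ => β) Ω
    rw [if_pos fun _ _ => rfl, List.sum_eq_zero, mul_zero, pow_zero, one_smul, List.map_map] at h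
    · exact h.symm
    · intro m hm
      obtain ⟨p, _, rfl⟩ := List.mem_map.1 hm
      exact Finset.sum_eq_zero fun _ _ => hβ
  -- regroup by sites
  have hρ_jw : ∀ k ∈ l, ∀ k' ∈ l, k ≠ k' → ∀ i j, Commute (ρ k) (jw F V π (s' k') i j) :=
    fun k hk k' hk' hne i j => Commute.list_prod_left _ _ fun c hc => by
      obtain ⟨y, hy, rfl⟩ := List.mem_map.1 hc
      exact commute_rTrunc_jw π _ (hnd' k hk k' hk' hne)
        (hd k' hk' y (List.mem_reverse.1 hy)).symm i j
  have hρ_T : ∀ k ∈ l, ∀ k' ∈ l, k ≠ k' → Commute (ρ k) (Tx k') :=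
    fun k hk k' hk' hne => Commute.list_prod_left _ _ fun c hc => by
      obtain ⟨y, hy, rfl⟩ := List.mem_map.1 hc
      exact commute_rTrunc_monOp π γ _ (ht k') (hnd' k hk k' hk' hne)
        (hd k' hk' y (List.mem_reverse.1 hy)).symm
  have hT_jw : ∀ k ∈ l, ∀ k' ∈ l, k ≠ k' → ∀ i j, Commute (Tx k) (jw F V π (s' k') i j) :=
    fun k hk k' hk' hne i j => commute_monOp_jw π γ (ht k) (hnd' k hk k' hk' hne) i j
  have he_jw : ∀ k ∈ l, ∀ k' ∈ l, k ≠ k' → ∀ i j, Commute (jw F V π (s' k') i j) (e k) := by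
    intro k hk k' hk' hne i j
    rw [commute_iff_eq, jw_mul_of_ne π (hnd' k' hk' k hk hne.symm), ← two_mul, mul_left_comm, pow_mul,
      neg_one_sq, one_pow, one_smul]
  have hgroup : (l.map e).prod * ((l.map Tx).prod * (l.map ρ).prod * (l.map f).prod) =
      σ ^ l.length • ((l.map e).prod * (l.map B).prod) := by
    rw [prod_map_mul_of_commute l hnd Tx ρ hρ_T,
      prod_map_mul_of_commute l hnd _ f fun k hk k' hk' hne =>
        ((hT_jw k' hk' k hk hne.symm δ β).symm.mul_right (hρ_jw k' hk' k hk hne.symm δ β).symm),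
      prod_map_mul_of_commute l hnd e _ fun k hk k' hk' hne =>
        ((hT_jw k hk k' hk' hne β β).mul_left (hρ_jw k hk k' hk' hne β β)).mul_left
          (he_jw k' hk' k hk hne.symm δ β),
      prod_map_mul_of_commute l hnd e B fun k hk k' hk' _ =>
        commute_nested_fst_jw_self π γ G s t hβ ht l' (s' k') (hp k' hk') β k,
      ← list_prod_map_smul]
    congr 1
    refine List.map_congr_left fun k hk => ?_
    exact jw_mul_monOp_mul_prod_rTrunc_mul_jw π γ G s t hβ h1 h2 h3 hσ ht k (s' k) l' hs (hp k hk)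
  have hY_e : Commute (l.map e).prod Y := by
    refine Commute.list_prod_left _ _ fun c hc => Commute.list_prod_right _ _ fun d hd' => ?_
    obtain ⟨k, hk, rfl⟩ := List.mem_map.1 hc
    obtain ⟨y, hy, rfl⟩ := List.mem_map.1 hd'
    exact (commute_monOp_jw π γ (ht' y) (hd k hk y hy).symm β β).symm
  have hrow : ∀ ψ : (Fin n → Fin 3) → V, (l.map e).prod ψ (relabel (fun _ => β) (l'.map s) α) =
      ψ (relabel (fun _ => β) (l'.map s) α) := fun ψ =>
    prod_jw_self_apply π s' l β ψ fun k hk => by rw [relabel, if_neg (hp k hk)]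
  have hsort : l.toFinset.sort (· ≤ ·) = l :=
    (List.toFinset_sort (r := (· ≤ ·)) hnd).2 (hl.imp fun h => h.le)
  rw [Module.End.mul_apply, hagree, hvac, ← Module.End.mul_apply (l.map ρ).prod,
    ← Module.End.mul_apply]
  -- The projectors come for free: the component in question already has the label β at the sites
  -- `s' k`.
  refine (hrow _).symm.trans ?_
  rw [← Module.End.mul_apply, mul_assoc, ← mul_assoc, hY_e.eq,
    mul_assoc, ← mul_assoc (l.map Tx).prod, hgroup, mul_smul_comm, LinearMap.smul_apply, Pi.smul_apply,
    ← mul_assoc, ← hY_e.eq, mul_assoc, Module.End.mul_apply, hrow, nestedVector, sprod, hsort,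
    Module.End.mul_apply]

end Regroup

end SuperBethe
end

noncomputable section
namespace SuperBethe

section Transpose

set_option linter.unusedSectionVars false

variable {n : ℕ} {F A V : Type*} [Field F] [Ring A] [Algebra F A]
  [AddCommGroup V] [Module A V] [Module F V] [IsScalarTower F A V] (π : Fin 3 → ℕ) (γ : A →+* A)

/-! ### Matrix elements of products of monodromy matrices -/

/-- The sign exponent of a matrix element of a product of monodromy matrices. -/
def wordExponent : List (Fin n × (Fin 3 → Fin 3 → A)) → (Fin n → Fin 3) → (Fin n → Fin 3) → ℕ
  | [], _, _ => 0
  | x :: l, I, J => (π (I x.1) + π (J x.1)) *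
      (parBelow π I x.1 + parTotal π (Function.update I x.1 (J x.1))) +
        wordExponent l (Function.update I x.1 (J x.1)) J

theorem monOp_apply {t : Fin 3 → Fin 3 → A} (ht : IsEven π γ t) (p : Fin n)
    (ψ : (Fin n → Fin 3) → V) (I : Fin n → Fin 3) :
    monOp F V π γ p t ψ I = ∑ j, ((-1 : F) ^ ((π (I p) + π j) *
      (parBelow π I p + parTotal π (Function.update I p j)))) •
        t (I p) j • ψ (Function.update I p j) := by
  rw [monOp, LinearMap.sum_apply, Finset.sum_apply, Finset.sum_eq_single (I p)]
  · rw [LinearMap.sum_apply, Finset.sum_apply]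
    refine Finset.sum_congr rfl fun j _ => ?_
    rw [Module.End.mul_apply, jw_apply, if_pos rfl, lft_apply, iterate_of_homogeneous γ (ht (I p) j),
      neg_one_pow_mul_smul (F := F), smul_smul, ← pow_add, mul_add]
  · intro i _ hi
    rw [LinearMap.sum_apply, Finset.sum_apply, Finset.sum_eq_zero]
    intro j _
    rw [Module.End.mul_apply, jw_apply, if_neg hi.symm]
  · simp

/-- Each site occurs once, so its label passes from `I` to `J` in one step and a single word in the
entries contributes. -/
theorem prod_monOp_single_apply (l : List (Fin n × (Fin 3 → Fin 3 → A)))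
    (hl : (l.map Prod.fst).Nodup) (ht : ∀ x ∈ l, IsEven π γ x.2) (I J : Fin n → Fin 3) (v : V) :
    (l.map fun x => monOp F V π γ x.1 x.2).prod (Pi.single J v) I =
      if ∀ q ∉ l.map Prod.fst, I q = J q then ((-1 : F) ^ wordExponent π l I J) •
        (l.map fun x => x.2 (I x.1) (J x.1)).prod • v else 0 := by
  have hs := IsScalarTower.to_smulCommClass (R := F) (A := A) (M := V)
  induction l generalizing I with
  | nil =>
    simp only [List.map_nil, List.prod_nil, Module.End.one_apply, List.not_mem_nil, not_false_eq_true,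
      forall_const, wordExponent, pow_zero, one_smul, Pi.single_apply, funext_iff]
  | cons x l ih =>
    rw [List.map_cons, List.nodup_cons] at hl
    rw [List.map_cons, List.prod_cons, Module.End.mul_apply, monOp_apply π γ (ht x (by simp)),
      Finset.sum_eq_single (J x.1)]
    · rw [ih hl.2 fun y hy => ht y (by simp [hy])]
      have hiff : (∀ q ∉ l.map Prod.fst, Function.update I x.1 (J x.1) q = J q) ↔
          ∀ q ∉ (x :: l).map Prod.fst, I q = J q := by
        constructor
        · intro h q hq
          simp only [List.map_cons, List.mem_cons, not_or] at hq
          rw [← h q hq.2, Function.update_of_ne hq.1]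
        · intro h q hq
          by_cases hqx : q = x.1
          · rw [hqx, Function.update_self]
          · rw [Function.update_of_ne hqx]
            exact h q (by simpa [hqx] using hq)
      by_cases h : ∀ q ∉ (x :: l).map Prod.fst, I q = J q
      · rw [if_pos h, if_pos (hiff.2 h), smul_comm (x.2 _ _), smul_smul, ← pow_add, ← mul_smul,
          List.map_cons, List.prod_cons, wordExponent]
        congr 4
        refine List.map_congr_left fun y hy => ?_
        rw [Function.update_of_ne]
        exact fun h => hl.1 (List.mem_map.2 ⟨y, hy, h⟩)
      · rw [if_neg h, if_neg (mt hiff.1 h), smul_zero, smul_zero]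
    · intro j _ hj
      rw [ih hl.2 fun y hy => ht y (by simp [hy]), if_neg, smul_zero, smul_zero]
      intro h
      have := h x.1 hl.1
      rw [Function.update_self] at this
      exact hj this
    · simp

theorem wordExponent_zero (l : List (Fin n × (Fin 3 → Fin 3 → A))) (I J : Fin n → Fin 3) :
    wordExponent (fun _ => 0) l I J = 0 := by
  induction l generalizing I with
  | nil => rfl
  | cons x l ih => rw [wordExponent, ih]; simp

theorem wordExponent_eq_zero (l : List (Fin n × (Fin 3 → Fin 3 → A)))
    (hl : (l.map Prod.fst).Nodup) (I J : Fin n → Fin 3)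
    (hI : ∀ x ∈ l, π (I x.1) = 0) (hJ : ∀ x ∈ l, π (J x.1) = 0) : wordExponent π l I J = 0 := by
  induction l generalizing I with
  | nil => rfl
  | cons x l ih =>
    rw [List.map_cons, List.nodup_cons] at hl
    rw [wordExponent, ih hl.2, hI x (by simp), hJ x (by simp)]
    · simp
    · intro y hy
      rw [Function.update_of_ne fun h => hl.1 (List.mem_map.2 ⟨y, hy, h⟩)]
      exact hI y (by simp [hy])
    · exact fun y hy => hJ y (by simp [hy])

/-- The sites of `l` turn odd from left to right. When `p` turns odd, all odd labels present lie to
its left, so its exponent is twice their number plus one, and each site of `l` contributes -1. -/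
theorem neg_one_pow_wordExponent (l l' : List (Fin n × (Fin 3 → Fin 3 → A)))
    (hl : (l.map Prod.fst).Pairwise (· < ·)) (hl' : (l'.map Prod.fst).Nodup)
    (hd : ∀ x ∈ l, ∀ y ∈ l', x.1 ≠ y.1) (I J : Fin n → Fin 3)
    (hI : ∀ x ∈ l, π (I x.1) = 0) (hJ : ∀ x ∈ l, π (J x.1) = 1)
    (hI' : ∀ x ∈ l', π (I x.1) = 0) (hJ' : ∀ x ∈ l', π (J x.1) = 0)
    (hlt : ∀ x ∈ l, ∀ q, π (I q) ≠ 0 → q < x.1) :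
    (-1 : F) ^ wordExponent π (l ++ l') I J = (-1) ^ l.length := by
  induction l generalizing I with
  | nil => rw [List.nil_append, wordExponent_eq_zero π l' hl' I J hI' hJ', List.length_nil]
  | cons x l ih =>
    rw [List.map_cons, List.pairwise_cons] at hl
    have hne : ∀ y ∈ l, x.1 < y.1 := fun y hy => hl.1 _ (List.mem_map.2 ⟨y, hy, rfl⟩)
    have h1 : parTotal π (Function.update I x.1 (J x.1)) = parTotal π I + 1 := by
      have := parTotal_update π I x.1 (J x.1)
      rwa [hI x (by simp), hJ x (by simp), add_zero] at this
    have h2 : parBelow π I x.1 = parTotal π I := by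
      refine Finset.sum_subset (Finset.subset_univ _) fun q _ hq => ?_
      by_contra h
      exact hq (Finset.mem_filter.2 ⟨Finset.mem_univ _, hlt x (by simp) q h⟩)
    rw [List.cons_append, wordExponent, pow_add, ih hl.2, h1, h2, hI x (by simp), hJ x (by simp),
      List.length_cons, zero_add, one_mul, ← add_assoc, ← two_mul, pow_succ, pow_mul, neg_one_sq,
      one_pow, one_mul, pow_succ']
    · exact fun y hy => hd y (by simp [hy])
    · intro y hy
      rw [Function.update_of_ne (hne y hy).ne']
      exact hI y (by simp [hy])
    · exact fun y hy => hJ y (by simp [hy])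
    · intro y hy
      rw [Function.update_of_ne (hd x (by simp) y hy).symm]
      exact hI' y hy
    · intro y hy q hq
      by_cases hqx : q = x.1
      · rw [hqx]; exact hne y hy
      · rw [Function.update_of_ne hqx] at hq
        exact (hlt x (by simp) q hq).trans (hne y hy)

/-! ### Transposition of products of `R`-matrices -/

/-- The matrix of `X` on the states satisfying `Q` is scalar, and the transpose of that of `Y`. -/
def IsTransposePair (Q : (Fin n → Fin 3) → Prop) (X Y : Module.End F ((Fin n → Fin 3) → V)) : Prop :=
  ∃ r : (Fin n → Fin 3) → (Fin n → Fin 3) → F, (∀ I J, Q I → r I J ≠ 0 → Q J) ∧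
    (∀ ψ I, Q I → X ψ I = ∑ J, r I J • ψ J) ∧
    ∀ I x, Q I → Y (Pi.single I x) = ∑ J, r I J • Pi.single J x

variable {Q : (Fin n → Fin 3) → Prop}

theorem IsTransposePair.one : IsTransposePair (F := F) (V := V) Q 1 1 := by
  refine ⟨fun I J => if J = I then 1 else 0, fun I J hI hJ => ?_, fun ψ I _ => ?_, fun I x _ => ?_⟩
  · rw [ite_ne_right_iff] at hJ
    rwa [hJ.1]
  · simp
  · simp

theorem IsTransposePair.mul {X Y X' Y' : Module.End F ((Fin n → Fin 3) → V)}
    (h : IsTransposePair Q X Y) (h' : IsTransposePair Q X' Y') :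
    IsTransposePair Q (X * X') (Y' * Y) := by
  obtain ⟨r, h1, h2, h3⟩ := h
  obtain ⟨r', h1', h2', h3'⟩ := h'
  refine ⟨fun I K => ∑ J, r I J * r' J K, fun I K hI hK => ?_, fun ψ I hI => ?_, fun I x hI => ?_⟩
  · obtain ⟨J, _, hJ⟩ := Finset.exists_ne_zero_of_sum_ne_zero hK
    exact h1' J K (h1 I J hI (left_ne_zero_of_mul hJ)) (right_ne_zero_of_mul hJ)
  · rw [Module.End.mul_apply, h2 _ I hI]
    simp only [Finset.sum_smul]
    rw [Finset.sum_comm]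
    refine Finset.sum_congr rfl fun J _ => ?_
    by_cases hJ : r I J = 0
    · simp [hJ]
    · rw [h2' ψ J (h1 I J hI hJ), Finset.smul_sum]
      simp only [smul_smul]
  · rw [Module.End.mul_apply, h3 I x hI, map_sum]
    simp only [Finset.sum_smul]
    rw [Finset.sum_comm]
    refine Finset.sum_congr rfl fun J _ => ?_
    by_cases hJ : r I J = 0
    · simp [hJ]
    · rw [map_smul, h3' J x (h1 I J hI hJ), Finset.smul_sum]
      simp only [smul_smul]

theorem IsTransposePair.list_prod {ι : Type*} (l : List ι)
    {X Y : ι → Module.End F ((Fin n → Fin 3) → V)} (h : ∀ i ∈ l, IsTransposePair Q (X i) (Y i)) :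
    IsTransposePair Q (l.map X).prod (l.reverse.map Y).prod := by
  induction l with
  | nil => exact IsTransposePair.one
  | cons i l ih =>
    rw [List.map_cons, List.prod_cons, List.reverse_cons, List.map_append, List.prod_append,
      List.map_cons, List.map_nil, List.prod_cons, List.prod_nil, mul_one]
    exact (h i (by simp)).mul (ih fun j hj => h j (by simp [hj]))

theorem permOp_apply {p q : Fin n} (hpq : p ≠ q) (ψ : (Fin n → Fin 3) → V) {I : Fin n → Fin 3}
    (hp : π (I p) = 0) (hq : π (I q) = 0) :
    permOp F V π p q ψ I = ψ (I ∘ Equiv.swap p q) := by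
  have hsw : Function.update (Function.update I p (I q)) q (I p) = I ∘ Equiv.swap p q := by
    funext x
    by_cases hxq : x = q
    · subst hxq; simp
    · rw [Function.update_of_ne hxq]
      by_cases hxp : x = p
      · subst hxp; simp
      · rw [Function.update_of_ne hxp, Function.comp_apply, Equiv.swap_apply_of_ne_of_ne hxp hxq]
  rw [permOp, LinearMap.sum_apply, Finset.sum_apply, Finset.sum_eq_single (I p)]
  · rw [LinearMap.sum_apply, Finset.sum_apply, Finset.sum_eq_single (I q)]
    · rw [LinearMap.smul_apply, Pi.smul_apply, Module.End.mul_apply, jw_apply, if_pos rfl, jw_apply,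
        Function.update_of_ne hpq.symm, if_pos rfl, hsw, hp, hq]
      simp
    · intro j _ hj
      rw [LinearMap.smul_apply, Pi.smul_apply, Module.End.mul_apply, jw_apply, if_pos rfl, jw_apply,
        Function.update_of_ne hpq.symm, if_neg hj.symm, smul_zero, smul_zero]
    · simp
  · intro i _ hi
    rw [LinearMap.sum_apply, Finset.sum_apply, Finset.sum_eq_zero]
    intro j _
    rw [LinearMap.smul_apply, Pi.smul_apply, Module.End.mul_apply, jw_apply, if_neg hi.symm, smul_zero]
  · simp

/-- On even labels the graded permutation merely interchanges two labels, as the ungraded one does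
everywhere; its matrix is symmetric and preserves evenness. -/
theorem isTransposePair_rOp (G : F) {p q : Fin n} (hpq : p ≠ q) :
    IsTransposePair (V := V) (fun I => ∀ p, π (I p) = 0) (rOp V π G p q)
      (rOp V (fun _ => 0) G p q) := by
  have hswap : ∀ I : Fin n → Fin 3, (I ∘ Equiv.swap p q) ∘ Equiv.swap p q = I := fun I => by
    funext x; simp
  refine ⟨fun I J => (if J = I then 1 else 0) + G * (if J = I ∘ Equiv.swap p q then 1 else 0),
    fun I J hI hJ => ?_, fun ψ I hI => ?_, fun I x _ => ?_⟩
  · by_cases h1 : J = I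
    · rwa [h1]
    · by_cases h2 : J = I ∘ Equiv.swap p q
      · rw [h2]; exact fun x => hI _
      · simp [h1, h2] at hJ
  · rw [rOp, LinearMap.add_apply, Pi.add_apply, LinearMap.smul_apply, Pi.smul_apply,
      permOp_apply π hpq ψ (hI p) (hI q)]
    simp [add_smul, Finset.sum_add_distrib, mul_ite, ite_smul]
  · rw [rOp, LinearMap.add_apply, LinearMap.smul_apply]
    have h : permOp F V (fun _ => 0) p q (Pi.single I x) = Pi.single (I ∘ Equiv.swap p q) x := by
      funext J
      rw [permOp_apply _ hpq _ rfl rfl, Pi.single_apply, Pi.single_apply]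
      congr 1
      refine propext ⟨fun h => ?_, fun h => ?_⟩
      · rw [← h, hswap]
      · rw [h, hswap]
    rw [h]
    simp [add_smul, Finset.sum_add_distrib, mul_ite, ite_smul]

/-- The row word is even, so the R-matrices on the left are scalar and can be transposed to ungraded
ones acting on the right. A matrix element of the monodromy matrices is one word in their entries at
distinct sites; transposition exchanges the indices of each entry but not the order of the word, and
the graded sign is -1 per odd label of `J`. -/
theorem prod_rOp_mul_prod_monOp_apply {κ κ' : Type*} (G : κ → κ' → F) (s : κ' → Fin n)
    (s' : κ → Fin n) (t : κ → Fin 3 → Fin 3 → A) (t' : κ' → Fin 3 → Fin 3 → A)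
    (ht : ∀ k, IsEven π γ (t k)) (ht' : ∀ y, IsEven π γ (t' y)) (l : List κ) (l' : List κ')
    (hs' : (l.map s').Nodup) (hs : (l'.map s).Pairwise (· < ·))
    (hd : ∀ k ∈ l, ∀ y ∈ l', s' k ≠ s y) (hcov : ∀ q, q ∈ l'.map s ∨ q ∈ l.map s')
    (I J : Fin n → Fin 3) (hI : ∀ q, π (I q) = 0) (hJ : ∀ y ∈ l', π (J (s y)) = 1)
    (hJ' : ∀ k ∈ l, π (J (s' k)) = 0) (Ω : V) :
    ((l'.map fun y => (l.reverse.map fun k => rOp V π (G k y) (s y) (s' k)).prod).prod *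
      ((l'.map fun y => monOp F V π γ (s y) (t' y)).prod *
        (l.map fun k => monOp F V π γ (s' k) (t k)).prod)) (Pi.single J Ω) I =
      (-1 : F) ^ l'.length •
        ((l'.map fun y => monOp F V (fun _ => 0) (RingHom.id A) (s y) fun i j => t' y j i).prod *
          (l.map fun k => monOp F V (fun _ => 0) (RingHom.id A) (s' k) fun i j => t k j i).prod *
          (l.map fun k => (l'.reverse.map fun y =>
            rOp V (fun _ => 0) (G k y) (s' k) (s y)).prod).prod) (Pi.single I Ω) J := by
  have hnd := hs.imp fun h => h.ne
  have hinj' : ∀ k ∈ l, ∀ k' ∈ l, k ≠ k' → s' k ≠ s' k' := fun k hk k' hk' hne h =>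
    hne (List.inj_on_of_nodup_map hs' hk hk' h)
  have hinj : ∀ k ∈ l', ∀ k' ∈ l', k ≠ k' → s k ≠ s k' := fun k hk k' hk' hne h =>
    hne (List.inj_on_of_nodup_map hnd hk hk' h)
  have hpair : IsTransposePair (F := F) (V := V) (fun I => ∀ p, π (I p) = 0)
      (l'.map fun y => (l.reverse.map fun k => rOp V π (G k y) (s y) (s' k)).prod).prod
      (l'.reverse.map fun y => (l.map fun k => rOp V (fun _ => 0) (G k y) (s y) (s' k)).prod).prod := by
    refine IsTransposePair.list_prod l' fun y hy => ?_
    have h := IsTransposePair.list_prod (F := F) (V := V) (Q := fun I => ∀ p, π (I p) = 0) l.reverse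
      (X := fun k => rOp V π (G k y) (s y) (s' k))
      (Y := fun k => rOp V (fun _ => 0) (G k y) (s y) (s' k))
      fun k hk => isTransposePair_rOp π _ (hd k (List.mem_reverse.1 hk) y hy).symm
    rwa [List.reverse_reverse] at h
  -- Transposition reverses the R-matrices; they are regrouped by the sites `s' k`, the form
  -- required by `prod_monOp_mul_prod_rOp_apply`.
  have hY : (l'.reverse.map fun y =>
      (l.map fun k => rOp V (fun _ => 0) (G k y) (s y) (s' k)).prod).prod =
      (l.map fun k => (l'.reverse.map fun y =>
            rOp V (fun _ => 0) (G k y) (s' k) (s y)).prod).prod := by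
    rw [prod_map_prod_comm l'.reverse l (List.nodup_reverse.2 (List.Nodup.of_map _ hnd))
      (List.Nodup.of_map _ hs')]
    · congr 1
      refine List.map_congr_left fun k hk => ?_
      congr 1
      refine List.map_congr_left fun y hy => ?_
      rw [rOp_comm _ _ (hd k hk y (List.mem_reverse.1 hy))]
    · intro y hy y' hy' k hk k' hk' hne hne'
      rw [List.mem_reverse] at hy hy'
      exact commute_rOp_rOp _ _ _ (hinj y hy y' hy' hne) (hd k hk y' hy') (hd k' hk' y hy).symm
        (hinj' k hk k' hk' hne')
  have hword : ∀ K : Fin n → Fin 3, (∀ q, π (K q) = 0) →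
      ((l'.map fun y => monOp F V π γ (s y) (t' y)).prod *
        (l.map fun k => monOp F V π γ (s' k) (t k)).prod) (Pi.single J Ω) K =
      (-1 : F) ^ l'.length •
        ((l'.map fun y => monOp F V (fun _ => 0) (RingHom.id A) (s y) fun i j => t' y j i).prod *
          (l.map fun k => monOp F V (fun _ => 0) (RingHom.id A) (s' k) fun i j => t k j i).prod)
          (Pi.single K Ω) J := by
    intro K hK
    have h1 := prod_monOp_single_apply (F := F) π γ
      ((l'.map fun y => (s y, t' y)) ++ l.map fun k => (s' k, t k))
      (by
        simp only [List.map_append, List.map_map, Function.comp_def]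
        exact List.nodup_append.2 ⟨hnd, hs', by
          rintro _ ha _ hb rfl
          obtain ⟨y, hy, rfl⟩ := List.mem_map.1 ha
          obtain ⟨k, hk, h⟩ := List.mem_map.1 hb
          exact hd k hk y hy h⟩)
      (by
        intro x hx
        rcases List.mem_append.1 hx with hx | hx <;> obtain ⟨y, _, rfl⟩ := List.mem_map.1 hx
        · exact ht' y
        · exact ht y) K J Ω
    have h2 := prod_monOp_single_apply (F := F) (fun _ => 0) (RingHom.id A)
      ((l'.map fun y => (s y, fun i j => t' y j i)) ++ l.map fun k => (s' k, fun i j => t k j i))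
      (by
        simp only [List.map_append, List.map_map, Function.comp_def]
        exact List.nodup_append.2 ⟨hnd, hs', by
          rintro _ ha _ hb rfl
          obtain ⟨y, hy, rfl⟩ := List.mem_map.1 ha
          obtain ⟨k, hk, h⟩ := List.mem_map.1 hb
          exact hd k hk y hy h⟩)
      (fun x _ i j => by simp) J K Ω
    have h3 : ∀ q, q ∈ (l'.map s) ++ (l.map s') := fun q => List.mem_append.2 (hcov q)
    have h4 := neg_one_pow_wordExponent (F := F) π (l'.map fun y => (s y, t' y))
      (l.map fun k => (s' k, t k)) (by simpa only [List.map_map, Function.comp_def] using hs)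
      (by simpa only [List.map_map, Function.comp_def] using hs')
      (by
        intro x hx y hy
        obtain ⟨y', hy', rfl⟩ := List.mem_map.1 hx
        obtain ⟨k, hk, rfl⟩ := List.mem_map.1 hy
        exact (hd k hk y' hy').symm) K J (fun x _ => hK _)
      (by
        intro x hx
        obtain ⟨y', hy', rfl⟩ := List.mem_map.1 hx
        exact hJ y' hy') (fun x _ => hK _)
      (by
        intro x hx
        obtain ⟨y', hy', rfl⟩ := List.mem_map.1 hx
        exact hJ' y' hy') (fun x _ q hq => absurd (hK q) hq)
    rw [if_pos (fun q hq => absurd (by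
      simpa only [List.map_append, List.map_map, Function.comp_def] using h3 q) hq), h4] at h1
    rw [if_pos (fun q hq => absurd (by
      simpa only [List.map_append, List.map_map, Function.comp_def] using h3 q) hq),
      wordExponent_zero, pow_zero, one_smul] at h2
    simp only [List.map_append, List.map_map, Function.comp_def, List.prod_append,
      List.length_map] at h1 h2
    rw [h1, h2]
  obtain ⟨r, hr1, hr2, hr3⟩ := hpair
  rw [← hY]
  simp only [Module.End.mul_apply] at hword ⊢
  rw [hr2 _ I hI, hr3 I Ω hI, map_sum, map_sum, Finset.sum_apply, Finset.smul_sum]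
  refine Finset.sum_congr rfl fun K _ => ?_
  by_cases hK : r I K = 0
  · simp [hK]
  · rw [hword K (hr1 I K hI hK), map_smul, map_smul, Pi.smul_apply, smul_comm]

end Transpose

end SuperBethe
end

/-! ### Nested vectors coincide with the sums over partitions -/

noncomputable section
namespace SuperBethe

section Comparison

variable {κ κ' F A V : Type*} [LinearOrder κ] [LinearOrder κ'] [Field F] [Ring A] [Algebra F A]
  [AddCommGroup V] [Module A V] [Module F V] [IsScalarTower F A V]

theorem exchCoeff_neg_one {c : F} (hc : c ≠ 0) {z : κ → F} (hz : Function.Injective z) (j : κ)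
    (W : Finset κ) :
    exchCoeff (-1) (fun k l => gF c (z k) (z l)) j W = (∏ k ∈ W.erase j, gF c (z k) (z j)) *
      ∏ k ∈ W.erase j, if k < j then hF c (z j) (z k) else hF c (z k) (z j) := by
  rw [exchCoeff, ← Finset.prod_mul_distrib]
  refine Finset.prod_congr rfl fun k hk => ?_
  have hne := hz.ne (Finset.ne_of_mem_erase hk)
  have hne' := sub_ne_zero.2 hne
  split_ifs
  · rw [gF, hF]
    field_simp
    ring
  · exact fF_eq_mul hc hne

theorem partitionSum₁_empty (c : F) (zu : κ → F) (zv : κ' → F) (t₁₂ t₁₃ : κ → A) (t₂₃ : κ' → A)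
    (lam : κ' → F) (Ω : V) (W : Finset κ') :
    partitionSum₁ c zu zv t₁₂ t₁₃ t₂₃ lam Ω ∅ W =
      nprod (fun i k => hF c (zv i) (zv k)) t₂₃ W • Ω := by
  rw [partitionSum₁, Finset.powerset_empty, Finset.sum_singleton, Finset.sum_eq_single ∅]
  · simp [coeff₁, nprod, setH]
  · intro R _ hR
    rw [if_neg]
    simpa using hR
  · simp

theorem partitionSum₂_empty (c : F) (zu : κ → F) (zv : κ' → F) (t₁₂ : κ → A) (t₁₃ t₂₃ : κ' → A)
    (lam : κ → F) (Ω : V) (U : Finset κ) :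
    partitionSum₂ c zu zv t₁₂ t₁₃ t₂₃ lam Ω U ∅ = sprod t₁₂ U • Ω := by
  rw [partitionSum₂, Finset.sum_eq_single ∅]
  · have h : setK c zu zv ∅ ∅ = 1 := by
      rw [setK_eq (m := 0) c zu zv rfl (fun i => i.elim0) (fun i => i.elim0) (by simp)]
      simp [kernelF, setH]
    simp [coeff₂, h, nprod, setH]
  · intro S _ hS
    rw [Finset.powerset_empty, Finset.sum_singleton, if_neg]
    simpa [eq_comm] using hS
  · simp

section

variable {n : ℕ} (π : Fin 3 → ℕ) (γ : A →+* A) (hγ : ∀ s : F, γ (algebraMap F A s) = algebraMap F A s)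
  {c : F} (hc : c ≠ 0) {zu : κ → F} {zv : κ' → F}
  (hu : Function.Injective zu) (hv : Function.Injective zv) (huv : ∀ i j, zu i ≠ zv j)
  {tu : κ → Fin 3 → Fin 3 → A} {tv : κ' → Fin 3 → Fin 3 → A}
  (htu : ∀ k, IsEven π γ (tu k)) (htv : ∀ k, IsEven π γ (tv k)) (Ω : V)
include hγ hc hu hv huv htu htv

/-- Induction on the u-sites: both sides satisfy the same recursion. The normalisation by `H`
absorbs the order dependence of `exchCoeff`. -/
theorem nestedVector_eq_partitionSum₁ (huu : ∀ i j, i ≠ j → hF c (zu i) (zu j) ≠ 0)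
    (hvv : ∀ i j, i ≠ j → hF c (zv i) (zv j) ≠ 0) {α β δ : Fin 3} (hα : π α = 0) (hβ : π β = 0)
    (hβδ : β ≠ δ) (hσ : (-1 : F) ^ π δ = -1)
    (hE : IsExchange (-1) 1 (fun k l => gF c (zv k) (zv l)) (fun k => tv k β δ) (fun k => tv k β β))
    (hD : ∀ k l, tv k β β * tv l β β = tv l β β * tv k β β)
    (hE' : IsExchange (-1) 1 (fun k l => gF c (zu k) (zu l)) (fun k => tu k α δ)
      (fun k => tu k α β))
    (hD' : ∀ k l, tu k α β * tu l α β = tu l α β * tu k α β)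
    {lam : κ' → F} (hΩ : ∀ k, tv k β β • Ω = lam k • Ω) (s : κ → Fin n) (l : List κ)
    (hl : l.Pairwise (· < ·)) (hs : (l.map s).Nodup) (W : Finset κ') :
    (setH (fun i k => hF c (zv i) (zv k)) W)⁻¹ •
        nestedVector π γ (-1) (fun j i => gF c (zv j) (zu i)) s tv tu α β δ Ω l W =
      partitionSum₁ c zu zv (fun k => tu k α β) (fun k => tu k α δ) (fun k => tv k β δ) lam Ω
        l.toFinset W := by
  have hsm := IsScalarTower.to_smulCommClass (R := F) (A := A) (M := V)
  induction l generalizing W with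
  | nil => rw [nestedVector_nil _ _ _ _ _ _ _ _ _ _ _ hβ, List.toFinset_nil, partitionSum₁_empty, nprod,
      smul_assoc]
  | cons y l ih =>
    rw [List.pairwise_cons] at hl
    have hs' := hs
    rw [List.map_cons, List.nodup_cons] at hs'
    have hH := setH_ne_zero (h := fun i k => hF c (zv i) (zv k)) hvv
    rw [List.toFinset_cons, partitionSum₁_insert hc hu hv huv huu _ hE' hD' _ _ _
        (fun k hk => hl.1 k (List.mem_toFinset.1 hk)),
      nestedVector_cons π γ (-1) _ s tv tu Ω hα hβ hβδ hσ hγ htv htu hE hD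
        (fun k l => gF_anti _ _ _) (isCross_div c zv hv) (fun y j k hjk => ?_) hΩ y l hs W,
      smul_add, smul_comm, ih hl.2 hs'.2, smul_comm]
    · congr 2
      rw [Finset.smul_sum]
      refine Finset.sum_congr rfl fun j hj => ?_
      rw [← ih hl.2 hs'.2, smul_smul, smul_smul, exchCoeff_neg_one hc hv, setH_erase _ W j hj]
      congr 1
      have h1 := hH (W.erase j)
      have h2 : ∏ k ∈ W.erase j, (if k < j then hF c (zv j) (zv k) else hF c (zv k) (zv j)) ≠ 0 :=
        Finset.prod_ne_zero_iff.2 fun k hk => by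
          have := Finset.ne_of_mem_erase hk
          split_ifs
          · exact hvv _ _ this.symm
          · exact hvv _ _ this
      have h3 : ∏ i ∈ l.toFinset, fF c (zv j) (zu i) = (l.map fun y => 1 + gF c (zv j) (zu y)).prod :=
        List.prod_toFinset (fun i => fF c (zv j) (zu i)) (hl.2.imp fun h => h.ne)
      rw [h3]
      field_simp
    · have e1 := sub_ne_zero.2 (huv y j).symm
      have e2 := sub_ne_zero.2 (huv y k).symm
      have e3 := sub_ne_zero.2 (hv.ne hjk)
      simp only [gF]
      field_simp
      ring

/-- The same induction over the v-sites. The arguments of g among the u's are reversed because the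
exchange relations now come from a column of the original matrix. -/
theorem nestedVector_eq_partitionSum₂ (hvu' : ∀ i j, zv j - zu i + c ≠ 0)
    (hvv : ∀ i j, i ≠ j → hF c (zv i) (zv j) ≠ 0) {α β δ : Fin 3} (hα : π α = 0) (hβ : π β = 0)
    (hβδ : β ≠ δ) (hσ : (-1 : F) ^ π δ = 1)
    (hE : IsExchange 1 1 (fun k l => gF c (zu l) (zu k)) (fun k => tu k β δ) (fun k => tu k β β))
    (hD : ∀ k l, tu k β β * tu l β β = tu l β β * tu k β β)
    (hE' : IsExchange (-1) (-1) (fun k l => gF c (zv k) (zv l)) (fun k => tv k α δ)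
      (fun k => tv k α β))
    (hD' : ∀ k l, k ≠ l → hF c (zv k) (zv l) • (tv k α β * tv l α β) =
      hF c (zv l) (zv k) • (tv l α β * tv k α β))
    {lam : κ → F} (hΩ : ∀ k, tu k β β • Ω = lam k • Ω) (s : κ' → Fin n) (l : List κ')
    (hl : l.Pairwise (· < ·)) (hs : (l.map s).Nodup) (U : Finset κ) :
    (setH (fun i k => hF c (zv i) (zv k)) l.toFinset)⁻¹ •
        nestedVector π γ 1 (fun i j => gF c (zv j) (zu i)) s tu tv α β δ Ω l U =
      partitionSum₂ c zu zv (fun k => tu k β δ) (fun k => tv k α δ) (fun k => tv k α β) lam Ω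
        U l.toFinset := by
  have hsm := IsScalarTower.to_smulCommClass (R := F) (A := A) (M := V)
  induction l generalizing U with
  | nil => rw [nestedVector_nil _ _ _ _ _ _ _ _ _ _ _ hβ, List.toFinset_nil, partitionSum₂_empty]; simp [setH]
  | cons y l ih =>
    rw [List.pairwise_cons] at hl
    have hs' := hs
    rw [List.map_cons, List.nodup_cons] at hs'
    have hy : ∀ k ∈ l.toFinset, y < k := fun k hk => hl.1 k (List.mem_toFinset.1 hk)
    have hH := setH_ne_zero (h := fun i k => hF c (zv i) (zv k)) hvv
    have hp : ∏ k ∈ l.toFinset, hF c (zv k) (zv y) ≠ 0 :=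
      Finset.prod_ne_zero_iff.2 fun k hk => hvv _ _ (hy k hk).ne'
    have hrec := partitionSum₂_insert hc hu hv huv hvu' hvv (fun k => tu k β δ) hE' hD' lam Ω U hy
    rw [List.toFinset_cons, setH_insert_min _ hy, mul_inv, mul_smul, inv_smul_eq_iff₀ hp, hrec,
      nestedVector_cons π γ 1 _ s tu tv Ω hα hβ hβδ hσ hγ htu htv hE hD
        (fun k l => gF_anti _ _ _) ?_ (fun y j k hjk => ?_) hΩ y l hs U,
      smul_add, smul_comm, ih hl.2 hs'.2, smul_comm]
    · congr 2
      rw [Finset.smul_sum]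
      refine Finset.sum_congr rfl fun j hj => ?_
      rw [← ih hl.2 hs'.2, smul_smul, smul_smul]
      congr 1
      have h3 : ∏ i ∈ l.toFinset, fF c (zv i) (zu j) = (l.map fun y => 1 + gF c (zv y) (zu j)).prod :=
        List.prod_toFinset (fun i => fF c (zv i) (zu j)) (hl.2.imp fun h => h.ne)
      -- For σ = 1 the two branches coincide, so no normalisation is needed for the u's.
      have h4 : exchCoeff 1 (fun k l => gF c (zu l) (zu k)) j U =
          ∏ k ∈ U.erase j, fF c (zu j) (zu k) :=
        Finset.prod_congr rfl fun k _ => ite_self _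
      rw [h3, h4]
      ring
    · intro x m j h1 h2 h3
      have e1 := sub_ne_zero.2 (hu.ne h1)
      have e2 := sub_ne_zero.2 (hu.ne h2)
      have e3 := sub_ne_zero.2 (hu.ne h3)
      have e4 := sub_ne_zero.2 (hu.ne h1.symm)
      have e5 := sub_ne_zero.2 (hu.ne h2.symm)
      have e6 := sub_ne_zero.2 (hu.ne h3.symm)
      simp only [gF]
      field_simp
      ring
    · have e1 := sub_ne_zero.2 (huv j y).symm
      have e2 := sub_ne_zero.2 (huv k y).symm
      have e3 := sub_ne_zero.2 (hu.ne hjk.symm)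
      simp only [gF]
      field_simp
      ring

end

end Comparison

end SuperBethe
end

/-! ### Exchange relations read off from the RTT relation; explicit expressions over finite sets -/

noncomputable section
namespace SuperBethe

namespace MonodromyData

set_option linter.unusedSectionVars false

variable {P F A : Type*} [Field F] [Ring A] [Algebra F A] {M : MonodromyData P F A} {D : Set P}
  {κ : Type*} {x : κ → P}

theorem IsMonodromy.rtt_smul (hM : M.IsMonodromy D) (hs : ∀ s, M.scal s = algebraMap F A s)
    {p q : P} (hp : p ∈ D) (hq : q ∈ D) (hz : M.z p ≠ M.z q) (i j k l : Fin 3) :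
    M.T p i j * M.T q k l
        - (-1) ^ ((par i + par j) * (par k + par l)) * (M.T q k l * M.T p i j)
      = (-1) ^ (par l * (par i + par j) + par i * par j) *
          (gF M.c (M.z p) (M.z q) • (M.T p i l * M.T q k j - M.T q i l * M.T p k j)) := by
  rw [hM.rtt p hp q hq hz, hs, ← Algebra.smul_def]
  rfl

theorem par_zero : par 0 = 0 := rfl
theorem par_one : par 1 = 0 := rfl
theorem par_two : par 2 = 1 := rfl

theorem IsMonodromy.isExchange_row (hM : M.IsMonodromy D) (hs : ∀ s, M.scal s = algebraMap F A s)
    (hx : ∀ k, x k ∈ D) (hz : Function.Injective fun k => M.z (x k)) {i : Fin 3} (hi : par i = 0) :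
    IsExchange (-1) 1 (fun k l => gF M.c (M.z (x k)) (M.z (x l))) (fun k => M.T (x k) i 2)
      (fun k => M.T (x k) i 1) := by
  constructor
  · intro k l hkl
    have h := hM.rtt_smul hs (hx k) (hx l) (hz.ne hkl) i 2 i 2
    simp only [hi, par_two, zero_add, mul_one, add_zero, pow_one, neg_one_mul] at h
    linear_combination (norm := module) h
  · intro k l hkl
    have h := hM.rtt_smul hs (hx k) (hx l) (hz.ne hkl) i 1 i 2
    simp only [hi, par_two, par_one, zero_add, mul_zero, add_zero, pow_zero, one_mul,
      mul_one] at h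
    have ha := gF_anti M.c (M.z (x l)) (M.z (x k))
    simp only [ha]
    linear_combination (norm := module) h

/-- The RTT relation says that `1 - g` times the commutator vanishes; `1 - g` is nonzero as the
points do not differ by c. -/
theorem IsMonodromy.commute_row (hM : M.IsMonodromy D) (hs : ∀ s, M.scal s = algebraMap F A s)
    (hx : ∀ k, x k ∈ D) (hz : Function.Injective fun k => M.z (x k))
    (hc : ∀ k l, k ≠ l → M.z (x k) - M.z (x l) ≠ M.c) {i : Fin 3} (hi : par i = 0) (k l : κ) :
    M.T (x k) i 1 * M.T (x l) i 1 = M.T (x l) i 1 * M.T (x k) i 1 := by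
  rcases eq_or_ne k l with rfl | hkl
  · rfl
  have h := hM.rtt_smul hs (hx k) (hx l) (hz.ne hkl) i 1 i 1
  simp only [hi, par_one, mul_zero, add_zero, pow_zero, one_mul] at h
  have hg : 1 - gF M.c (M.z (x k)) (M.z (x l)) ≠ 0 := by
    rw [gF, sub_ne_zero, ne_comm, Ne, div_eq_one_iff_eq (sub_ne_zero.2 (hz.ne hkl))]
    exact (hc k l hkl).symm
  have h2 : (1 - gF M.c (M.z (x k)) (M.z (x l))) • (M.T (x k) i 1 * M.T (x l) i 1) =
      (1 - gF M.c (M.z (x k)) (M.z (x l))) • (M.T (x l) i 1 * M.T (x k) i 1) := by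
    linear_combination (norm := module) h
  exact smul_right_injective A hg h2

theorem IsMonodromy.isExchange_column (hM : M.IsMonodromy D) (hs : ∀ s, M.scal s = algebraMap F A s)
    (hx : ∀ k, x k ∈ D) (hz : Function.Injective fun k => M.z (x k)) :
    IsExchange 1 1 (fun k l => gF M.c (M.z (x l)) (M.z (x k))) (fun k => M.T (x k) 0 1)
      (fun k => M.T (x k) 1 1) := by
  constructor
  · intro k l hkl
    have h := hM.rtt_smul hs (hx k) (hx l) (hz.ne hkl) 0 1 0 1
    simp only [par_zero, par_one, mul_zero, add_zero, pow_zero, one_mul] at h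
    have ha := gF_anti M.c (M.z (x l)) (M.z (x k))
    simp only [ha]
    linear_combination (norm := module) h
  · intro k l hkl
    have h := hM.rtt_smul hs (hx l) (hx k) (hz.ne hkl.symm) 0 1 1 1
    simp only [par_zero, par_one, mul_zero, add_zero, pow_zero, one_mul] at h
    have ha := gF_anti M.c (M.z (x k)) (M.z (x l))
    simp only [ha]
    linear_combination (norm := module) -h

theorem IsMonodromy.isExchange_last_column (hM : M.IsMonodromy D)
    (hs : ∀ s, M.scal s = algebraMap F A s)
    (hx : ∀ k, x k ∈ D) (hz : Function.Injective fun k => M.z (x k)) :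
    IsExchange (-1) (-1) (fun k l => gF M.c (M.z (x k)) (M.z (x l))) (fun k => M.T (x k) 0 2)
      (fun k => M.T (x k) 1 2) := by
  refine ⟨(hM.isExchange_row hs hx hz par_zero).BB, fun k l hkl => ?_⟩
  have h := hM.rtt_smul hs (hx l) (hx k) (hz.ne hkl.symm) 0 2 1 2
  simp only [par_zero, par_one, par_two, zero_add, mul_one, add_zero, pow_one,
    neg_one_mul] at h
  have ha := gF_anti M.c (M.z (x k)) (M.z (x l))
  simp only [ha]
  linear_combination (norm := module) h

/-- The relation `BB` multiplied by (z_k - z_l)/c. -/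
theorem IsMonodromy.hF_smul_mul (hM : M.IsMonodromy D) (hs : ∀ s, M.scal s = algebraMap F A s)
    (hc : M.c ≠ 0) (hx : ∀ k, x k ∈ D) (hz : Function.Injective fun k => M.z (x k)) {i : Fin 3}
    (hi : par i = 0) (k l : κ) (hkl : k ≠ l) :
    hF M.c (M.z (x k)) (M.z (x l)) • (M.T (x k) i 2 * M.T (x l) i 2) =
      hF M.c (M.z (x l)) (M.z (x k)) • (M.T (x l) i 2 * M.T (x k) i 2) := by
  have h := (hM.isExchange_row hs hx hz hi).BB k l hkl
  have hne := sub_ne_zero.2 (hz.ne hkl)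
  beta_reduce at hne
  have h1 : hF M.c (M.z (x k)) (M.z (x l)) =
      ((M.z (x k) - M.z (x l)) / M.c) * (1 + gF M.c (M.z (x k)) (M.z (x l))) := by
    rw [hF, gF]; field_simp
  have h2 : hF M.c (M.z (x l)) (M.z (x k)) =
      ((M.z (x k) - M.z (x l)) / M.c) * (-1 + gF M.c (M.z (x k)) (M.z (x l))) := by
    rw [hF, gF]; field_simp; ring
  rw [h1, h2, mul_smul, mul_smul, h]

/-! ### The explicit expressions as sums over finite sets -/

/-- The size ℓ is determined by `S`, and ℓ ≤ min(a, b) holds automatically when both parts have that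
size. -/
theorem sum_range_subtype {a b : ℕ} {N : Type*} [AddCommMonoid N]
    (ψ : Finset (Fin a) → Finset (Fin b) → N)
    (φ : ∀ ℓ, {S : Finset (Fin a) // S.card = ℓ} → {R : Finset (Fin b) // R.card = ℓ} → N)
    (h : ∀ (S : Finset (Fin a)) (R : Finset (Fin b)) (hR : R.card = S.card),
      φ S.card ⟨S, rfl⟩ ⟨R, hR⟩ = ψ S R) :
    ∑ ℓ ∈ Finset.range (min a b + 1), ∑ S, ∑ R, φ ℓ S R =
      ∑ S ∈ (Finset.univ : Finset (Fin a)).powerset, ∑ R ∈ (Finset.univ : Finset (Fin b)).powerset,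
        if R.card = S.card then ψ S R else 0 := by
  have h1 : ∀ ℓ, ∑ S, ∑ R, φ ℓ S R = ∑ S : Finset (Fin a), ∑ R : Finset (Fin b),
      if S.card = ℓ then (if R.card = S.card then ψ S R else 0) else 0 := by
    intro ℓ
    have e : ∀ S R, φ ℓ S R = ψ S.1 R.1 := by
      rintro ⟨S, rfl⟩ ⟨R, hR⟩
      exact h S R hR
    simp only [e]
    have e2 : ∀ S : {S : Finset (Fin a) // S.card = ℓ},
        ∑ R : {R : Finset (Fin b) // R.card = ℓ}, ψ S.1 R.1 =
          ∑ R : Finset (Fin b), if R.card = S.1.card then ψ S.1 R else 0 := by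
      rintro ⟨S, rfl⟩
      rw [← Finset.sum_filter]
      exact (Finset.sum_subtype _ (by simp) (fun R => ψ S R)).symm
    simp only [e2]
    rw [← Finset.sum_subtype (Finset.univ.filter fun S : Finset (Fin a) => S.card = ℓ) (by simp)
      (fun S => ∑ R : Finset (Fin b), if R.card = S.card then ψ S R else 0), Finset.sum_filter]
    refine Finset.sum_congr rfl fun S _ => ?_
    split_ifs <;> simp
  simp only [h1, Finset.powerset_univ]
  rw [Finset.sum_comm]
  refine Finset.sum_congr rfl fun S _ => ?_
  rw [Finset.sum_comm]
  refine Finset.sum_congr rfl fun R _ => ?_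
  rw [Finset.sum_ite_eq]
  split_ifs with h2 h3 h3
  · rfl
  · rfl
  · refine absurd (Finset.mem_range.2 (Nat.lt_succ_of_le (le_min ?_ ?_))) h2
    · simpa using S.card_le_univ
    · rw [← h3]; simpa using R.card_le_univ
  · rfl

variable {m ℓ : ℕ} (M)

theorem sort_eq_ofFn {κ : Type*} [LinearOrder κ] (S : Finset κ) {ℓ : ℕ} (h : S.card = ℓ) :
    S.sort (· ≤ ·) = List.ofFn fun p => S.orderEmbOfFin h p := by
  refine List.ext_getElem (by simp [h]) fun i h1 h2 => ?_
  simp [Finset.orderEmbOfFin_apply]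

theorem TT_eq_sprod {a : ℕ} (i j : Fin 3) (w : Fin a → P) (S : Finset (Fin a)) (h : S.card = ℓ) :
    M.TT i j (fun p => w (S.orderEmbOfFin h p)) = sprod (fun k => M.T (w k) i j) S := by
  rw [TT, oprod, sprod, sort_eq_ofFn S h, List.map_ofFn]
  rfl

theorem H_eq_setH {a : ℕ} (w : Fin a → P) (S : Finset (Fin a)) (h : S.card = ℓ) :
    M.H (fun p => w (S.orderEmbOfFin h p)) =
      setH (fun i k => hF M.c (M.z (w i)) (M.z (w k))) S := by
  have := setH_map (fun i k => hF M.c (M.z (w i)) (M.z (w k))) (S.orderEmbOfFin h) Finset.univ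
  rw [Finset.map_orderEmbOfFin_univ] at this
  rw [this]
  rfl

theorem TTn_eq_nprod (hs : ∀ s, M.scal s = algebraMap F A s) {a : ℕ} (i j : Fin 3) (w : Fin a → P)
    (S : Finset (Fin a)) (h : S.card = ℓ) :
    M.TTn i j (fun p => w (S.orderEmbOfFin h p)) =
      nprod (fun i k => hF M.c (M.z (w i)) (M.z (w k))) (fun k => M.T (w k) i j) S := by
  rw [TTn, TT_eq_sprod, H_eq_setH, hs, ← Algebra.smul_def, nprod]

theorem dprod_eq {a b : ℕ} (φ : P → P → F) (w : Fin a → P) (S : Finset (Fin a)) (h : S.card = ℓ)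
    (w' : Fin b → P) (R : Finset (Fin b)) (h' : R.card = m) :
    dprod φ (fun p => w (S.orderEmbOfFin h p)) (fun p => w' (R.orderEmbOfFin h' p)) =
      ∏ i ∈ S, ∏ j ∈ R, φ (w i) (w' j) := by
  rw [dprod, ← prod_orderEmbOfFin h fun i => ∏ j ∈ R, φ (w i) (w' j)]
  exact Finset.prod_congr rfl fun p _ =>
    prod_orderEmbOfFin h' fun j => φ (w (S.orderEmbOfFin h p)) (w' j)

variable {V : Type*} [AddCommGroup V] [Module A V] [Module F V] [IsScalarTower F A V] {a b : ℕ}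

theorem scal_mul_mul_scal_smul (hs : ∀ s, M.scal s = algebraMap F A s) (p q : F) (X : A) (Ω : V) :
    (M.scal p * X * M.scal q) • Ω = (p * q) • X • Ω := by
  rw [hs, hs, mul_assoc, ← Algebra.commutes q X, ← mul_assoc, ← map_mul, mul_smul, algebraMap_smul]

theorem explicitVector₁_eq (hs : ∀ s, M.scal s = algebraMap F A s) (lam : P → F) (u : Fin a → P)
    (v : Fin b → P) (Ω : V) :
    M.explicitVector₁ lam u v Ω =
      partitionSum₁ M.c (fun k => M.z (u k)) (fun k => M.z (v k)) (fun k => M.T (u k) 0 1)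
        (fun k => M.T (u k) 0 2) (fun k => M.T (v k) 1 2) (fun k => lam (v k)) Ω Finset.univ
        Finset.univ := by
  rw [explicitVector₁, partitionSum₁]
  refine sum_range_subtype _ _ fun S R hR => ?_
  rw [M.scal_mul_mul_scal_smul hs]
  unfold part compl
  simp only [TT_eq_sprod, M.TTn_eq_nprod hs, dprod_eq,
    prod_orderEmbOfFin hR fun j => lam (v j), Finset.compl_eq_univ_sdiff]
  rfl

theorem explicitVector₂_eq (hs : ∀ s, M.scal s = algebraMap F A s) (lam : P → F) (u : Fin a → P)
    (v : Fin b → P) (Ω : V) :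
    M.explicitVector₂ lam u v Ω =
      partitionSum₂ M.c (fun k => M.z (u k)) (fun k => M.z (v k)) (fun k => M.T (u k) 0 1)
        (fun k => M.T (v k) 0 2) (fun k => M.T (v k) 1 2) (fun k => lam (u k)) Ω Finset.univ
        Finset.univ := by
  rw [explicitVector₂, partitionSum₂]
  refine sum_range_subtype _ _ fun S R hR => ?_
  rw [M.scal_mul_mul_scal_smul hs]
  have hK : M.K (part v ⟨R, hR⟩) (part u ⟨S, rfl⟩) =
      setK M.c (fun k => M.z (u k)) (fun k => M.z (v k)) R S := by
    rw [setK, dif_pos hR]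
    rfl
  rw [hK]
  unfold part compl
  simp only [TT_eq_sprod, M.TTn_eq_nprod hs, dprod_eq,
    prod_orderEmbOfFin (rfl : S.card = S.card) fun j => lam (u j), Finset.compl_eq_univ_sdiff]
  rfl

end MonodromyData

end SuperBethe
end

/-! ### The two identities over an arbitrary field of scalars -/

noncomputable section
namespace SuperBethe

namespace MonodromyData

section

set_option linter.unusedSectionVars false

variable {P F A V : Type*} [Field F] [Ring A] [Algebra F A] {M : MonodromyData P F A} {D : Set P}
  [AddCommGroup V] [Module A V] [Module F V] [IsScalarTower F A V] {a b : ℕ}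

theorem rrOp_eq (u : Fin a → P) (v : Fin b → P) :
    M.rrOp V u v = ((List.finRange b).map fun j => ((List.finRange a).reverse.map fun k =>
      rOp V par (gF M.c (M.z (v j)) (M.z (u k))) (Fin.natAdd a j) (Fin.castAdd b k)).prod).prod := by
  have h : (List.finRange a).reverse = List.ofFn (Fin.rev : Fin a → Fin a) := by
    refine List.ext_getElem (by simp) fun i h1 h2 => ?_
    simp only [List.getElem_reverse, List.getElem_finRange, List.getElem_ofFn]
    ext
    simp [Fin.rev]
    omega
  simp only [rrOp, h, List.map_ofFn, List.ofFn_eq_map (n := b)]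
  rfl

theorem relabel_castAdd (a b : ℕ) :
    relabel (fun _ => 1) ((List.finRange a).map (Fin.castAdd b)) 0 = rowState a b := by
  funext q
  refine Fin.addCases (fun i => ?_) (fun i => ?_) q
  · simp [relabel, rowState]
  · have h : ∀ x : Fin a, Fin.castAdd b x ≠ Fin.natAdd a i := fun x h => by
      have := congrArg Fin.val h
      simp at this
      omega
    simp [relabel, rowState, h]

theorem relabel_natAdd (a b : ℕ) :
    relabel (fun _ => 1) ((List.finRange b).map (Fin.natAdd a)) 2 = colState a b := by
  funext q
  refine Fin.addCases (fun i => ?_) (fun i => ?_) q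
  · have h : ∀ x : Fin b, Fin.natAdd a x ≠ Fin.castAdd b i := fun x h => by
      have := congrArg Fin.val h
      simp at this
      omega
    simp [relabel, colState, h]
  · simp [relabel, colState]

theorem castAdd_ne_natAdd {a b : ℕ} (i : Fin a) (j : Fin b) : Fin.castAdd b i ≠ Fin.natAdd a j :=
  fun h => by
    have := congrArg Fin.val h
    simp at this
    omega

variable (hM : M.IsMonodromy D) (hs : ∀ s, M.scal s = algebraMap F A s) (hc : M.c ≠ 0)
  {lam : Fin 3 → P → F} {Ω : V} (hΩ : M.IsSingularOn D lam Ω) {u : Fin a → P} {v : Fin b → P}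
  (huD : ∀ k, u k ∈ D) (hvD : ∀ k, v k ∈ D) (hu : Function.Injective fun k => M.z (u k))
  (hv : Function.Injective fun k => M.z (v k)) (huv : ∀ i j, M.z (u i) ≠ M.z (v j))
  (huc : ∀ i j, i ≠ j → M.z (u i) - M.z (u j) ≠ M.c)
  (hvc : ∀ i j, i ≠ j → M.z (v i) - M.z (v j) ≠ M.c)
include hM hs hc hΩ huD hvD hu hv huv huc hvc

/-- Nesting with (α, β, δ) the labels (1, 2, 3) and σ = -1. The factor σ^b cancels the (-1)^b in the
definition of the Bethe vector. -/
theorem betheVector_eq_explicitVector₁ : M.betheVector u v Ω = M.explicitVector₁ (lam 1) u v Ω := by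
  have hgs : ∀ s, M.grade (algebraMap F A s) = algebraMap F A s := fun s => by
    rw [← hs, hM.grade_scal]
  have hh : ∀ {x y : F}, y - x ≠ M.c → hF M.c x y ≠ 0 := fun {x y} h h0 => by
    rw [hF, div_eq_zero_iff, or_iff_left hc] at h0
    exact h (by linear_combination -h0)
  have hsort := List.pairwise_lt_finRange
  have htu : ∀ k, IsEven par M.grade (M.T (u k)) := fun k => hM.grade_T _ (huD k)
  have htv : ∀ k, IsEven par M.grade (M.T (v k)) := fun k => hM.grade_T _ (hvD k)
  have hH : M.H v = setH (fun i k => hF M.c (M.z (v i)) (M.z (v k))) Finset.univ := rfl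
  rw [M.betheVector_eq hs hM.grade_grade hM.grade_scal, rrOp_eq, List.ofFn_eq_map, List.ofFn_eq_map,
    ← relabel_castAdd, ← relabel_natAdd,
    prod_monOp_mul_prod_rOp_apply (G := fun j k => gF M.c (M.z (v j)) (M.z (u k))) (σ := -1)
      (t := fun j => M.T (v j)) (t' := fun k => M.T (u k)) (α := 0) (β := 1) (δ := 2) par M.grade
      (Fin.castAdd b) (Fin.natAdd a) Ω par_one (by decide) (by decide) (by decide) (by simp [par_two])
      htv htu _ _ (hsort b) ?_ ?_ ?_,
    smul_smul, List.length_finRange, div_mul_eq_mul_div, ← mul_pow, neg_one_mul, neg_neg, one_pow,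
    one_div, List.toFinset_finRange, hH,
    nestedVector_eq_partitionSum₁ par M.grade hgs hc hu hv huv htu htv Ω
      (fun i j h => hh (huc j i h.symm)) (fun i j h => hh (hvc j i h.symm)) par_zero par_one
      (by decide) (by simp [par_two]) (hM.isExchange_row hs hvD hv par_one)
      (hM.commute_row hs hvD hv hvc par_one) (hM.isExchange_row hs huD hu par_zero)
      (hM.commute_row hs huD hu huc par_zero) (lam := fun k => lam 1 (v k)) ?_ _ _ (hsort a) ?_,
    List.toFinset_finRange, M.explicitVector₁_eq hs]
  · intro k
    rw [(hΩ _ (hvD k)).1 1, hs, algebraMap_smul]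
  · exact (List.nodup_finRange a).map (Fin.castAdd_injective a b)
  · exact List.pairwise_map.2 ((hsort b).imp fun h => by simpa using h)
  · exact (List.nodup_finRange a).map (Fin.castAdd_injective a b)
  · exact fun k _ y _ => (castAdd_ne_natAdd y k).symm

/-- After the RTT exchange and transposition, nesting takes place with trivial grading, (α, β, δ)
the labels (3, 2, 1) and σ = 1; here the transposition supplies the (-1)^b. The additional condition
u_i - v_j ≠ c keeps the denominators h(v_j, u_i) in K nonzero. -/
theorem betheVector_eq_explicitVector₂ (huvc : ∀ i j, M.z (u i) - M.z (v j) ≠ M.c) :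
    M.betheVector u v Ω = M.explicitVector₂ (lam 1) u v Ω := by
  have hgs : ∀ s, M.grade (algebraMap F A s) = algebraMap F A s := fun s => by
    rw [← hs, hM.grade_scal]
  have hh : ∀ {x y : F}, y - x ≠ M.c → hF M.c x y ≠ 0 := fun {x y} h h0 => by
    rw [hF, div_eq_zero_iff, or_iff_left hc] at h0
    exact h (by linear_combination -h0)
  have hsort := List.pairwise_lt_finRange
  have htu : ∀ k, IsEven par M.grade (M.T (u k)) := fun k => hM.grade_T _ (huD k)
  have htv : ∀ k, IsEven par M.grade (M.T (v k)) := fun k => hM.grade_T _ (hvD k)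
  have heven : ∀ t : Fin 3 → Fin 3 → A, IsEven (fun _ => 0) (RingHom.id A) t := fun t i j => by simp
  have hH : M.H v = setH (fun i k => hF M.c (M.z (v i)) (M.z (v k))) Finset.univ := rfl
  have hndu := (List.nodup_finRange a).map (Fin.castAdd_injective a b)
  have hndv := (List.nodup_finRange b).map (Fin.natAdd_injective b a)
  have hpv : ((List.finRange b).map (Fin.natAdd a)).Pairwise (· < ·) :=
    List.pairwise_map.2 ((hsort b).imp fun h => by simpa using h)
  rw [M.betheVector_eq hs hM.grade_grade hM.grade_scal, rrOp_eq, List.ofFn_eq_map, List.ofFn_eq_map,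
    prod_mul_prod_mul_prod_prod (List.finRange a) (List.finRange b) (List.nodup_finRange a)
      (List.nodup_finRange b)
      (fun k => monOp F V par M.grade (Fin.castAdd b k) (M.T (u k)))
      (fun j => monOp F V par M.grade (Fin.natAdd a j) (M.T (v j)))
      (fun j k => rOp V par (gF M.c (M.z (v j)) (M.z (u k))) (Fin.natAdd a j) (Fin.castAdd b k))
      ?_ ?_ ?_,
    prod_rOp_mul_prod_monOp_apply par M.grade (fun k j => gF M.c (M.z (v j)) (M.z (u k)))
      (Fin.natAdd a) (Fin.castAdd b) (fun k => M.T (u k)) (fun j => M.T (v j)) htu htv _ _ hndu hpv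
      (fun k _ y _ => castAdd_ne_natAdd k y) ?_ _ _ ?_ ?_ ?_,
    ← relabel_castAdd, ← relabel_natAdd,
    prod_monOp_mul_prod_rOp_apply (G := fun k j => gF M.c (M.z (v j)) (M.z (u k))) (σ := 1)
      (t := fun k i j => M.T (u k) j i) (t' := fun k i j => M.T (v k) j i) (α := 2) (β := 1)
      (δ := 0) (fun _ => 0) (RingHom.id A) (Fin.natAdd a) (Fin.castAdd b) Ω rfl (by decide)
      (by decide) (by decide) (by simp) (fun _ => heven _) (fun _ => heven _) _ _ (hsort a)
      (List.pairwise_map.2 ((hsort a).imp fun h => Fin.strictMono_castAdd b h)) hndv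
      (fun k _ y _ => castAdd_ne_natAdd k y),
    one_pow, one_smul,
    smul_smul, List.length_finRange, div_mul_eq_mul_div, ← mul_pow, neg_one_mul, neg_neg, one_pow,
    one_div, List.toFinset_finRange, hH, ← List.toFinset_finRange b,
    nestedVector_eq_partitionSum₂ (α := 2) (β := 1) (δ := 0)
      (tu := fun k i j => M.T (u k) j i) (tv := fun k i j => M.T (v k) j i) (fun _ => 0) (RingHom.id A) (fun _ => rfl) hc hu hv huv
      (fun _ => heven _) (fun _ => heven _) Ω ?_
      (fun i j h => hh (hvc j i h.symm)) rfl rfl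
      (by decide) (by simp) (hM.isExchange_column hs huD hu)
      (hM.commute_row hs huD hu huc par_one) (hM.isExchange_last_column hs hvD hv)
      (hM.hF_smul_mul hs hc hvD hv par_one) (lam := fun k => lam 1 (u k)) ?_ _ _ (hsort b) hndv,
    List.toFinset_finRange, M.explicitVector₂_eq hs]
  · intro i j h0
    exact huvc i j (by linear_combination -h0)
  · intro k
    rw [(hΩ _ (huD k)).1 1, hs, algebraMap_smul]
  · intro q
    refine Fin.addCases (fun i => Or.inr ?_) (fun i => Or.inl ?_) q
    · exact List.mem_map_of_mem (List.mem_finRange i)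
    · exact List.mem_map_of_mem (List.mem_finRange i)
  · intro q
    refine Fin.addCases (fun i => ?_) (fun i => ?_) q <;> simp [rowState, par_zero, par_one]
  · intro y _
    simp [colState, par_two]
  · intro k _
    simp [colState, par_one]
  · intro i _ j _
    have hg := gF_anti M.c (M.z (v j)) (M.z (u i))
    rw [rOp_comm par _ (castAdd_ne_natAdd i j).symm, hg]
    exact monOp_mul_monOp_mul_rOp par M.grade (htu i) (htv j) hgs _
      (hM.rtt_smul hs (huD i) (hvD j) (huv i j)) (castAdd_ne_natAdd i j)
  · intro i _ k _ j _ hik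
    exact commute_rOp_monOp par M.grade _ (htu k) (castAdd_ne_natAdd k j).symm
      ((Fin.castAdd_injective a b).ne hik)
  · intro i _ j _ k _ hjk
    exact commute_rOp_monOp par M.grade _ (htv k) ((Fin.natAdd_injective b a).ne hjk)
      (castAdd_ne_natAdd i k)

end

/-- The two explicit expressions for the Bethe vectors over an arbitrary field of scalars. -/
theorem betheVector_eq_explicitVector {P F A V : Type*} [Field F] [Ring A] (M : MonodromyData P F A)
    {D : Set P} (hc : M.c ≠ 0) (hM : M.IsMonodromy D) [AddCommGroup V] [Module A V]
    {lam : Fin 3 → P → F} {Ω : V} (hΩ : M.IsSingularOn D lam Ω) {a b : ℕ} (u : Fin a → P)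
    (v : Fin b → P) (hD : ∀ k, Fin.append u v k ∈ D)
    (hne : ∀ k l, k ≠ l → M.z (Fin.append u v k) - M.z (Fin.append u v l) ≠ 0 ∧
      M.z (Fin.append u v k) - M.z (Fin.append u v l) ≠ M.c) :
    M.betheVector u v Ω = M.explicitVector₁ (lam 1) u v Ω ∧
      M.betheVector u v Ω = M.explicitVector₂ (lam 1) u v Ω := by
  -- The central homomorphism `scal` supplies the algebra and module structures used so far.
  let _ : Algebra F A := M.scal.toAlgebra' hM.scal_central
  let _ : Module F V := Module.compHom V M.scal
  have _ : IsScalarTower F A V := ⟨fun s y w => mul_smul (M.scal s) y w⟩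
  have hs : ∀ s, M.scal s = algebraMap F A s := fun _ => rfl
  have huD : ∀ k, u k ∈ D := fun k => by simpa using hD (Fin.castAdd b k)
  have hvD : ∀ k, v k ∈ D := fun k => by simpa using hD (Fin.natAdd a k)
  have huu : ∀ i j, i ≠ j → M.z (u i) - M.z (u j) ≠ 0 ∧ M.z (u i) - M.z (u j) ≠ M.c :=
    fun i j h => by simpa using hne _ _ ((Fin.castAdd_injective a b).ne h)
  have hvv : ∀ i j, i ≠ j → M.z (v i) - M.z (v j) ≠ 0 ∧ M.z (v i) - M.z (v j) ≠ M.c :=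
    fun i j h => by simpa using hne _ _ ((Fin.natAdd_injective b a).ne h)
  have huv : ∀ i j, M.z (u i) - M.z (v j) ≠ 0 ∧ M.z (u i) - M.z (v j) ≠ M.c :=
    fun i j => by simpa using hne _ _ (castAdd_ne_natAdd i j)
  have hu : Function.Injective fun k => M.z (u k) := fun i j h => by
    by_contra hij
    exact (huu i j hij).1 (sub_eq_zero.2 h)
  have hv : Function.Injective fun k => M.z (v k) := fun i j h => by
    by_contra hij
    exact (hvv i j hij).1 (sub_eq_zero.2 h)
  exact ⟨betheVector_eq_explicitVector₁ hM hs hc hΩ huD hvD hu hv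
      (fun i j => sub_ne_zero.1 (huv i j).1) (fun i j h => (huu i j h).2) fun i j h => (hvv i j h).2,
    betheVector_eq_explicitVector₂ hM hs hc hΩ huD hvD hu hv
      (fun i j => sub_ne_zero.1 (huv i j).1) (fun i j h => (huu i j h).2)
      (fun i j h => (hvv i j h).2) fun i j => (huv i j).2⟩

end MonodromyData

end SuperBethe
end

noncomputable section
namespace SuperBethe

/-! ### Coefficients of formal series -/

section Series

variable {n : ℕ} {R : Type*}

/-- The coefficients of a series in the non-positive powers of the `k`-th and `l`-th variables. -/
def biCoeff [Zero R] (k l : Fin n) (Φ : ℕ → ℕ → R) (e : Expo n) : R :=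
  if (∀ i, i ≠ k → i ≠ l → ofLex e i = 0) ∧ 0 ≤ ofLex e k ∧ 0 ≤ ofLex e l then
    Φ (ofLex e k).toNat (ofLex e l).toNat else 0

theorem biCoeff_swap [Zero R] (k l : Fin n) (Φ : ℕ → ℕ → R) (e : Expo n) :
    biCoeff l k (fun r s => Φ s r) e = biCoeff k l Φ e := by
  have h : ((∀ i, i ≠ l → i ≠ k → ofLex e i = 0) ∧ 0 ≤ ofLex e l ∧ 0 ≤ ofLex e k) ↔
      ((∀ i, i ≠ k → i ≠ l → ofLex e i = 0) ∧ 0 ≤ ofLex e k ∧ 0 ≤ ofLex e l) :=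
    ⟨fun h => ⟨fun i hk hl => h.1 i hl hk, h.2.2, h.2.1⟩,
      fun h => ⟨fun i hk hl => h.1 i hl hk, h.2.2, h.2.1⟩⟩
  simp only [biCoeff, h]

theorem coeff_seriesAt [Semiring R] (k : Fin n) (f : ℕ → R) (r : ℕ) :
    (seriesAt k f).coeff (expoEmb k r) = f r := by
  rw [seriesAt, HahnSeries.embDomain_coeff, HahnSeries.coeff_toPowerSeries_symm,
    PowerSeries.coeff_mk]

theorem coeff_seriesAt_of_notMem [Semiring R] (k : Fin n) (f : ℕ → R) {e : Expo n}
    (he : e ∉ Set.range (expoEmb k)) : (seriesAt k f).coeff e = 0 :=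
  HahnSeries.embDomain_of_notMem_range he

theorem exists_of_mem_support_seriesAt [Semiring R] {k : Fin n} {f : ℕ → R} {e : Expo n}
    (he : e ∈ (seriesAt k f).support) : ∃ r, expoEmb k r = e := by
  by_contra h
  exact he (coeff_seriesAt_of_notMem k f h)

theorem ofLex_expoEmb (k : Fin n) (r : ℕ) : ofLex (expoEmb k r) = Pi.single k (r : ℤ) := rfl

theorem seriesAt_eq_of_map [Semiring R] {S : Type*} [Semiring S] (k : Fin n) (f : ℕ → R)
    (f' : ℕ → S) (φ : R → S) (h0 : φ 0 = 0) (h : ∀ r, φ (f r) = f' r) (e : Expo n) :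
    φ ((seriesAt k f).coeff e) = (seriesAt k f').coeff e := by
  by_cases he : e ∈ Set.range (expoEmb k)
  · obtain ⟨r, rfl⟩ := he
    rw [coeff_seriesAt, coeff_seriesAt, h]
  · rw [coeff_seriesAt_of_notMem k f he, coeff_seriesAt_of_notMem k f' he, h0]

/-- The two series live in different variables, so an exponent splits in at most one way. -/
theorem coeff_seriesAt_mul_seriesAt [Semiring R] {k l : Fin n} (hkl : k ≠ l) (f g : ℕ → R)
    (e : Expo n) :
    (seriesAt k f * seriesAt l g).coeff e = biCoeff k l (fun r s => f r * g s) e := by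
  rw [HahnSeries.coeff_mul, biCoeff]
  split_ifs with h
  · have hsum : expoEmb k (ofLex e k).toNat + expoEmb l (ofLex e l).toNat = e := by
      refine ofLex_inj.1 (funext fun i => ?_)
      rw [ofLex_add, Pi.add_apply, ofLex_expoEmb, ofLex_expoEmb, Int.toNat_of_nonneg h.2.1,
        Int.toNat_of_nonneg h.2.2]
      by_cases hk : i = k
      · subst hk; simp [hkl]
      · by_cases hl : i = l
        · subst hl; simp [hk]
        · simp [hk, hl, h.1 i hk hl]
    rw [Finset.sum_eq_single (expoEmb k (ofLex e k).toNat, expoEmb l (ofLex e l).toNat),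
      coeff_seriesAt, coeff_seriesAt]
    · rintro ⟨p, q⟩ hpq hne
      rw [Finset.mem_antidiagonal] at hpq
      obtain ⟨r, rfl⟩ := exists_of_mem_support_seriesAt hpq.1
      obtain ⟨s, rfl⟩ := exists_of_mem_support_seriesAt hpq.2.1
      refine absurd ?_ hne
      have he : expoEmb k r + expoEmb l s = e := hpq.2.2
      have hk : ofLex e k = r := by
        rw [← he, ofLex_add, Pi.add_apply, ofLex_expoEmb, ofLex_expoEmb]
        simp [hkl]
      have hl : ofLex e l = s := by
        rw [← he, ofLex_add, Pi.add_apply, ofLex_expoEmb, ofLex_expoEmb]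
        simp [hkl.symm]
      simp [hk, hl]
    · intro hmem
      rw [Finset.mem_antidiagonal] at hmem
      by_contra hne
      exact hmem ⟨left_ne_zero_of_mul hne, right_ne_zero_of_mul hne, hsum⟩
  · refine Finset.sum_eq_zero ?_
    rintro ⟨p, q⟩ hpq
    rw [Finset.mem_antidiagonal] at hpq
    obtain ⟨r, rfl⟩ := exists_of_mem_support_seriesAt hpq.1
    obtain ⟨s, rfl⟩ := exists_of_mem_support_seriesAt hpq.2.1
    refine absurd ?_ h
    have he : expoEmb k r + expoEmb l s = e := hpq.2.2
    simp only [← he, ofLex_add, Pi.add_apply, ofLex_expoEmb]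
    refine ⟨fun i hk hl => by simp [hk, hl], ?_, ?_⟩
    · simp [hkl]
    · simp [hkl.symm]

theorem coeff_seriesAt_mul_seriesAt_swap [Semiring R] {k l : Fin n} (hkl : k ≠ l) (f g : ℕ → R)
    (e : Expo n) :
    (seriesAt l g * seriesAt k f).coeff e = biCoeff k l (fun r s => g s * f r) e := by
  rw [coeff_seriesAt_mul_seriesAt hkl.symm, ← biCoeff_swap]

theorem ofLex_sub_single (e : Expo n) (k i : Fin n) :
    ofLex (e - toLex (Pi.single k (-1) : Fin n → ℤ)) i =
      ofLex e i + (Pi.single k 1 : Fin n → ℤ) i := by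
  rw [ofLex_sub, Pi.sub_apply, ofLex_toLex, Pi.single_neg, Pi.neg_apply, sub_neg_eq_add]

/-- A relation between neighbouring coefficients, at all exponents. -/
theorem biCoeff_add_sub_biCoeff_add [Ring R] {k l : Fin n} (hkl : k ≠ l) {Φ Ψ : ℕ → ℕ → R}
    (h : ∀ r s, Φ (r + 1) s - Φ r (s + 1) = Ψ r s) (h0 : ∀ r, Φ r 0 = 0) (h0' : ∀ s, Φ 0 s = 0)
    (e : Expo n) :
    biCoeff k l Φ (e - toLex (Pi.single k (-1) : Fin n → ℤ)) - biCoeff k l Φ (e - toLex (Pi.single l (-1) : Fin n → ℤ)) =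
      biCoeff k l Ψ e := by
  by_cases he : ∀ i, i ≠ k → i ≠ l → ofLex e i = 0
  · have hk : ∀ i, i ≠ k → i ≠ l → ofLex (e - toLex (Pi.single k (-1) : Fin n → ℤ)) i = 0 := fun i h1 h2 => by
      rw [ofLex_sub_single, he i h1 h2, Pi.single_eq_of_ne h1, add_zero]
    have hl : ∀ i, i ≠ k → i ≠ l → ofLex (e - toLex (Pi.single l (-1) : Fin n → ℤ)) i = 0 := fun i h1 h2 => by
      rw [ofLex_sub_single, he i h1 h2, Pi.single_eq_of_ne h2, add_zero]
    have e1 : ofLex (e - toLex (Pi.single k (-1) : Fin n → ℤ)) k = ofLex e k + 1 := by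
      rw [ofLex_sub_single, Pi.single_eq_same]
    have e2 : ofLex (e - toLex (Pi.single k (-1) : Fin n → ℤ)) l = ofLex e l := by
      rw [ofLex_sub_single, Pi.single_eq_of_ne hkl.symm, add_zero]
    have e3 : ofLex (e - toLex (Pi.single l (-1) : Fin n → ℤ)) k = ofLex e k := by
      rw [ofLex_sub_single, Pi.single_eq_of_ne hkl, add_zero]
    have e4 : ofLex (e - toLex (Pi.single l (-1) : Fin n → ℤ)) l = ofLex e l + 1 := by
      rw [ofLex_sub_single, Pi.single_eq_same]
    simp only [biCoeff, e1, e2, e3, e4, and_iff_right hk, and_iff_right hl, and_iff_right he]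
    clear e1 e2 e3 e4
    generalize ofLex e k = p
    generalize ofLex e l = q
    rcases le_or_gt 0 p with hp | hp <;> rcases le_or_gt 0 q with hq | hq
    · lift p to ℕ using hp
      lift q to ℕ using hq
      rw [if_pos (by omega), if_pos (by omega), if_pos (by omega), ← h]
      rfl
    -- The boundary case: the shift by one reaches the power zero although the right side is already
    -- zero, which is where `h0` is needed.
    · rcases eq_or_ne q (-1) with rfl | h1
      · rw [if_neg (by omega), if_pos (by omega), if_neg (by omega), sub_eq_zero]
        exact (h0 _).symm
      · rw [if_neg (by omega), if_neg (by omega), if_neg (by omega), sub_zero]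
    · rcases eq_or_ne p (-1) with rfl | h1
      · rw [if_pos (by omega), if_neg (by omega), if_neg (by omega), sub_zero]
        exact h0' _
      · rw [if_neg (by omega), if_neg (by omega), if_neg (by omega), sub_zero]
    · rw [if_neg (by omega), if_neg (by omega), if_neg (by omega), sub_zero]
  · have : ∀ j : Fin n, (j = k ∨ j = l) →
        ¬ ∀ i, i ≠ k → i ≠ l → ofLex (e - toLex (Pi.single j (-1) : Fin n → ℤ)) i = 0 := by
      intro j hj h
      refine he fun i h1 h2 => ?_
      have := h i h1 h2
      rwa [ofLex_sub_single, Pi.single_eq_of_ne (by rcases hj with rfl | rfl <;> assumption),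
        add_zero] at this
    rw [biCoeff, biCoeff, biCoeff, if_neg fun h => this k (.inl rfl) h.1,
      if_neg fun h => this l (.inr rfl) h.1, if_neg fun h => he h.1, sub_zero]

end Series

end SuperBethe
end

noncomputable section
namespace SuperBethe

/-! ### The universal monodromy matrix -/

theorem Yangian.grade_coeffT (i j : Fin 3) (r : ℕ) :
    Yangian.grade (Yangian.coeffT i j r) = (-1) ^ (par i + par j) * Yangian.coeffT i j r := by
  rw [Yangian.grade, Yangian.coeffT, RingQuot.liftAlgHom_mkAlgHom_apply, AlgHom.comp_apply,
    Yangian.freeGrade_freeT, map_mul, map_pow, map_neg, map_one]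

theorem neg_one_pow_mul_neg_one_pow_mul {R : Type*} [Ring R] (m : ℕ) (x : R) :
    (-1) ^ m * ((-1) ^ m * x) = x := by
  rw [← mul_assoc, ← pow_add, ← two_mul, pow_mul, neg_one_sq, one_pow, one_mul]

theorem Yangian.grade_grade (y : Yangian) : Yangian.grade (Yangian.grade y) = y := by
  suffices h : Yangian.grade.comp Yangian.grade = AlgHom.id ℂ Yangian from DFunLike.congr_fun h y
  refine RingQuot.ringQuot_ext' ℂ _ _ (FreeAlgebra.hom_ext (funext fun x => ?_))
  have h := Yangian.grade_coeffT x.1 x.2.1 (x.2.2 + 1)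
  have e : Yangian.coeffT x.1 x.2.1 (x.2.2 + 1) =
      RingQuot.mkAlgHom ℂ YangianRel (FreeAlgebra.ι ℂ x) := rfl
  rw [e] at h
  simp only [Function.comp_apply, AlgHom.comp_apply, AlgHom.id_apply, h, map_mul, map_pow, map_neg,
    map_one]
  exact neg_one_pow_mul_neg_one_pow_mul _ _

theorem Yangian.coeffT_zero (i j : Fin 3) : Yangian.coeffT i j 0 = if i = j then 1 else 0 := by
  rw [Yangian.coeffT, freeT]
  split_ifs <;> simp

theorem mapSeries_single {n : ℕ} {R S : Type*} [Ring R] [Ring S] (φ : R →+* S) (e : Expo n) (a : R) :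
    mapSeries φ (HahnSeries.single e a) = HahnSeries.single e (φ a) :=
  HahnSeries.map_single (φ : ZeroHom R S)

theorem coeff_neg_one_pow_mul {n : ℕ} {R : Type*} [Ring R] (m : ℕ) (x : HahnSeries (Expo n) R)
    (e : Expo n) : ((-1) ^ m * x).coeff e = (-1) ^ m * x.coeff e := by
  rcases Nat.even_or_odd m with hm | hm <;> simp [hm.neg_one_pow]

section SeriesData

variable {R : Type*} [Ring R]

/-- The graded commutator of two coefficients of a monodromy matrix. -/
def bracket (τ : Fin 3 → Fin 3 → ℕ → R) (i j k l : Fin 3) (r s : ℕ) : R :=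
  τ i j r * τ k l s - (-1) ^ ((par i + par j) * (par k + par l)) * (τ k l s * τ i j r)

variable (τ : Fin 3 → Fin 3 → ℕ → R)

/-- The coefficient of degree zero is the scalar δ_ij, and for i = j the sign in the graded
commutator is trivial. -/
theorem bracket_zero_left (h : ∀ i j, τ i j 0 = if i = j then 1 else 0) (i j k l : Fin 3) (s : ℕ) :
    bracket τ i j k l 0 s = 0 := by
  rw [bracket, h]
  split_ifs with h
  · subst h
    rw [← two_mul, mul_assoc, pow_mul, neg_one_sq, one_pow]
    simp
  · simp

theorem bracket_zero_right (h : ∀ i j, τ i j 0 = if i = j then 1 else 0) (i j k l : Fin 3) (r : ℕ) :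
    bracket τ i j k l r 0 = 0 := by
  rw [bracket, h]
  split_ifs with h
  · subst h
    rw [← two_mul, mul_left_comm, pow_mul, neg_one_sq, one_pow]
    simp
  · simp

variable [Algebra ℂ R] (c : ℂ) (n : ℕ) (γ : R →+* R)

/-- The monodromy matrix with coefficients `τ` at `n` independent formal spectral parameters. -/
def seriesData : MonodromyData (Fin n) (HahnSeries (Expo n) ℂ) (HahnSeries (Expo n) R) where
  c := HahnSeries.C c
  z k := HahnSeries.single (toLex (Pi.single k (-1))) 1
  scal := mapSeries (algebraMap ℂ R)
  grade := mapSeries γ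
  T k i j := seriesAt k fun r => (c ^ r) • τ i j r

/-- The RTT relation may be multiplied by w_k - w_l, the image of a nonzero element of a field.
Multiplication by a variable shifts exponents, so the coefficients become differences of
neighbouring brackets, that is, the relations assumed for `τ`. -/
theorem isMonodromy_seriesData (hγ : ∀ s, γ (algebraMap ℂ R s) = algebraMap ℂ R s)
    (hγγ : ∀ y, γ (γ y) = y) (hτ : ∀ i j r, γ (τ i j r) = (-1) ^ (par i + par j) * τ i j r)
    (h0 : ∀ i j, τ i j 0 = if i = j then 1 else 0)
    (hrtt : ∀ i j k l r s, bracket τ i j k l (r + 1) s - bracket τ i j k l r (s + 1) =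
      (-1) ^ (par l * (par i + par j) + par i * par j) * (τ i l r * τ k j s - τ i l s * τ k j r)) :
    (seriesData τ c n γ).IsMonodromy Set.univ := by
  have hcentral : ∀ s y, (seriesData τ c n γ).scal s * y = y * (seriesData τ c n γ).scal s := by
    intro s y
    ext e
    rw [HahnSeries.coeff_mul, HahnSeries.coeff_mul]
    refine Finset.sum_equiv (Equiv.prodComm _ _) (fun _ => Finset.swap_mem_antidiagonal.symm) ?_
    intro p _
    exact Algebra.commutes (s.coeff p.1) (y.coeff p.2)
  refine ⟨hcentral, ?_, ?_, ?_, ?_⟩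
  · intro s
    ext e
    exact hγ (s.coeff e)
  · intro y
    ext e
    exact hγγ _
  · intro k _ i j
    ext e
    rw [coeff_neg_one_pow_mul]
    refine (seriesAt_eq_of_map k _ (fun r => (-1) ^ (par i + par j) * c ^ r • τ i j r)
      γ (map_zero _) (fun r => ?_) e).trans
      (seriesAt_eq_of_map k _ _ (fun y => (-1) ^ (par i + par j) * y) (mul_zero _)
        (fun r => ?_) e).symm
    · rw [Algebra.smul_def, map_mul, hγ, hτ, ← mul_assoc, Algebra.commutes, mul_assoc]
    · rfl
  · intro k _ l _ hkl i j p q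
    have hne : k ≠ l := fun h => hkl (h ▸ rfl)
    have hz := sub_ne_zero.2 hkl
    have hunit : IsUnit ((seriesData τ c n γ).scal ((seriesData τ c n γ).z k - (seriesData τ c n γ).z l)) :=
      (IsUnit.mk0 _ hz).map _
    refine hunit.mul_left_cancel ?_
    have hsign : ∀ (m : ℕ) (x y : HahnSeries (Expo n) R), x * ((-1) ^ m * y) =
        (-1) ^ m * (x * y) := fun m x y => by
      rw [← mul_assoc, ((Commute.neg_one_right x).pow_right m).eq, mul_assoc]
    rw [hsign, ← mul_assoc ((seriesData τ c n γ).scal _), ← map_mul, mul_div_cancel₀ _ hz]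
    ext e
    have hL : ∀ e, ((seriesData τ c n γ).T k i j * (seriesData τ c n γ).T l p q -
        (-1) ^ ((par i + par j) * (par p + par q)) *
          ((seriesData τ c n γ).T l p q * (seriesData τ c n γ).T k i j)).coeff e =
        biCoeff k l (fun r s => c ^ (r + s) • bracket τ i j p q r s) e := by
      intro e
      rw [HahnSeries.coeff_sub, coeff_neg_one_pow_mul]
      refine (congrArg₂ (fun x y => x - (-1) ^ ((par i + par j) * (par p + par q)) * y)
        (coeff_seriesAt_mul_seriesAt hne _ _ e) (coeff_seriesAt_mul_seriesAt_swap hne _ _ e)).trans ?_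
      simp only [biCoeff, bracket]
      split_ifs
      · rw [smul_mul_smul_comm, smul_mul_smul_comm, mul_smul_comm, mul_comm (c ^ _) (c ^ _), ← pow_add,
          smul_sub, add_comm]
      · simp
    have hR : ((seriesData τ c n γ).T k i q * (seriesData τ c n γ).T l p j -
          (seriesData τ c n γ).T l i q * (seriesData τ c n γ).T k p j).coeff e =
        biCoeff k l (fun r s => c ^ (r + s) • (τ i q r * τ p j s -
          τ i q s * τ p j r)) e := by
      rw [HahnSeries.coeff_sub]
      refine (congrArg₂ (fun x y => x - y)
        (coeff_seriesAt_mul_seriesAt hne _ _ e) (coeff_seriesAt_mul_seriesAt_swap hne _ _ e)).trans ?_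
      simp only [biCoeff]
      split_ifs
      · rw [smul_mul_smul_comm, smul_mul_smul_comm, mul_comm (c ^ _) (c ^ _), ← pow_add,
          smul_sub, add_comm]
      · simp
    have hz' : ∀ k, (seriesData τ c n γ).scal ((seriesData τ c n γ).z k) =
        HahnSeries.single (toLex (Pi.single k (-1) : Fin n → ℤ)) 1 := fun k =>
      (mapSeries_single _ _ _).trans (by rw [map_one])
    have hC : (seriesData τ c n γ).scal (seriesData τ c n γ).c =
        HahnSeries.single 0 (algebraMap ℂ R c) :=
      mapSeries_single _ _ _
    -- After the shifts, the brackets at (r+1, s) and (r, s+1) both carry c^(r+s+1); on the other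
    -- side the extra power is the numerator of g.
    rw [map_sub, hz', hz', sub_mul, HahnSeries.coeff_sub, HahnSeries.coeff_single_mul,
      HahnSeries.coeff_single_mul, one_mul, one_mul, hL, hL, coeff_neg_one_pow_mul, hC,
      HahnSeries.coeff_single_mul, sub_zero, hR, biCoeff_add_sub_biCoeff_add hne (Ψ := fun r s =>
        c ^ (r + s + 1) • (bracket τ i j p q (r + 1) s - bracket τ i j p q r (s + 1)))]
    · simp only [biCoeff, hrtt]
      split_ifs
      · rw [← Algebra.smul_def, smul_smul, ← pow_succ', mul_smul_comm]
      · simp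
    · intro r s
      rw [smul_sub, add_right_comm, add_assoc r s 1]
    · intro r
      rw [bracket_zero_right τ h0, smul_zero]
    · intro s
      rw [bracket_zero_left τ h0, smul_zero]

end SeriesData

theorem isMonodromy_yangianData (c : ℂ) (n : ℕ) :
    (yangianData c n).IsMonodromy Set.univ := by
  refine isMonodromy_seriesData Yangian.coeffT c n Yangian.grade.toRingHom
    (fun s => Yangian.grade.commutes s) Yangian.grade_grade Yangian.grade_coeffT
    Yangian.coeffT_zero fun i j k l r s => ?_
  have h := RingQuot.mkAlgHom_rel ℂ (YangianRel.rtt i j k l r s)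
  simp only [freeBracket, map_sub, map_mul, map_pow, map_neg, map_one] at h
  exact h

variable {V : Type*} [AddCommGroup V] [Module Yangian V]

theorem coeff_smul_constVector {n : ℕ} (x : HahnSeries (Expo n) Yangian) (Ω : V) (e : Expo n) :
    ((HahnModule.of Yangian).symm (x • constVector n Ω)).coeff e = x.coeff e • Ω := by
  rw [HahnModule.coeff_smul, Finset.sum_eq_single (e, 0)]
  · simp [constVector]
  · rintro ⟨p, q⟩ hpq hne
    have hsum := (Finset.mem_vaddAntidiagonal _ _).1 hpq
    have hq : q ≠ 0 := fun h => hne (by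
      have := hsum.2.2
      simp only [h, vadd_eq_add, add_zero] at this
      rw [h, this])
    simp [constVector, HahnSeries.coeff_single_of_ne hq]
  · intro hmem
    rw [Finset.mem_vaddAntidiagonal] at hmem
    by_contra hne
    refine hmem ⟨fun h => hne ?_, fun h => hne ?_, by simp⟩
    · rw [h, zero_smul]
    · rw [h, smul_zero]

theorem isSingularOn_yangianData (c : ℂ) (n : ℕ) {wt : Fin 3 → ℕ → ℂ} {Ω : V}
    (hΩ : IsSingular wt Ω) :
    (yangianData c n).IsSingularOn Set.univ (fun i => weightSeries c (wt i)) (constVector n Ω) := by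
  have hsmul : ∀ (z : ℂ) (y : Yangian), z • y = algebraMap ℂ Yangian z * y := Algebra.smul_def
  refine fun k _ => ⟨fun i => ?_, fun i j hij => ?_⟩
  · refine HahnModule.ext _ _ (funext fun e => ?_)
    rw [coeff_smul_constVector, coeff_smul_constVector]
    change (seriesAt k fun r => c ^ r • Yangian.coeffT i i r).coeff e • Ω =
      algebraMap ℂ Yangian ((weightSeries c (wt i) k).coeff e) • Ω
    rw [weightSeries]
    by_cases he : e ∈ Set.range (expoEmb k)
    · obtain ⟨r, rfl⟩ := he
      rw [coeff_seriesAt, coeff_seriesAt]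
      cases r with
      | zero => simp [Yangian.coeffT_zero]
      | succ p => rw [hsmul, mul_smul, (hΩ p).1 i, ← mul_smul, ← map_mul]
    · rw [coeff_seriesAt_of_notMem k _ he, coeff_seriesAt_of_notMem k _ he, map_zero]
  · refine HahnModule.ext _ _ (funext fun e => ?_)
    rw [coeff_smul_constVector]
    change (seriesAt k fun r => c ^ r • Yangian.coeffT i j r).coeff e • Ω = 0
    by_cases he : e ∈ Set.range (expoEmb k)
    · obtain ⟨r, rfl⟩ := he
      rw [coeff_seriesAt]
      cases r with
      | zero => rw [Yangian.coeffT_zero, if_neg hij.ne', smul_zero, zero_smul]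
      | succ p => rw [hsmul, mul_smul, (hΩ p).2 i j hij, smul_zero]
    · rw [coeff_seriesAt_of_notMem k _ he, zero_smul]

/-- The monomial w_k occurs in w_k - w_l with coefficient 1, but neither in 0 nor in the constant c:
formal parameters are always generic. -/
theorem yangianData_z_sub_ne (c : ℂ) (n : ℕ) {k l : Fin n} (h : k ≠ l) :
    (yangianData c n).z k - (yangianData c n).z l ≠ 0 ∧
      (yangianData c n).z k - (yangianData c n).z l ≠ (yangianData c n).c := by
  have h1 : ((yangianData c n).z k - (yangianData c n).z l).coeff
      (toLex (Pi.single k (-1) : Fin n → ℤ)) = 1 := by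
    have hne : toLex (Pi.single k (-1) : Fin n → ℤ) ≠ toLex (Pi.single l (-1) : Fin n → ℤ) :=
      fun h' => by simpa [h] using congrFun (congrArg ofLex h') k
    simp [yangianData, hne]
  have h2 : (yangianData c n).c.coeff (toLex (Pi.single k (-1) : Fin n → ℤ)) = 0 := by
    have hne : toLex (Pi.single k (-1) : Fin n → ℤ) ≠ 0 :=
      fun h' => by simpa using congrFun (congrArg ofLex h') k
    simp [yangianData, HahnSeries.C_apply, hne]
  refine ⟨fun h' => ?_, fun h' => ?_⟩
  · simp [h'] at h1
  · simp [h', h2] at h1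

end SuperBethe
end

/-! ### Formal and complex parameters -/

theorem mainTheorem1 :
    -- the super-Yangian, with independent formal parameters `u₁, …, u_a, v₁, …, v_b`
    (∀ (c : ℂ) (_ : c ≠ 0) (V : Type*) [AddCommGroup V] [Module SuperBethe.Yangian V]
        (wt : Fin 3 → ℕ → ℂ) (Ω : V) (_ : SuperBethe.IsSingular wt Ω) (a b : ℕ),
      (SuperBethe.yangianData c (a + b)).betheVector (Fin.castAdd b) (Fin.natAdd a)
            (SuperBethe.constVector (a + b) Ω)
          = (SuperBethe.yangianData c (a + b)).explicitVector₁ (SuperBethe.weightSeries c (wt 1))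
              (Fin.castAdd b) (Fin.natAdd a) (SuperBethe.constVector (a + b) Ω) ∧
        (SuperBethe.yangianData c (a + b)).betheVector (Fin.castAdd b) (Fin.natAdd a)
            (SuperBethe.constVector (a + b) Ω)
          = (SuperBethe.yangianData c (a + b)).explicitVector₂ (SuperBethe.weightSeries c (wt 1))
              (Fin.castAdd b) (Fin.natAdd a) (SuperBethe.constVector (a + b) Ω)) ∧
    -- monodromy matrices depending on complex parameters, at generic parameters
    (∀ (P A : Type*) [Ring A] (M : SuperBethe.MonodromyData P ℂ A) (D : Set P)
        (_ : M.c ≠ 0) (_ : M.IsMonodromy D) (V : Type*) [AddCommGroup V] [Module A V]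
        (lam : Fin 3 → P → ℂ) (Ω : V) (_ : M.IsSingularOn D lam Ω) (a b : ℕ)
        (u : Fin a → P) (v : Fin b → P) (_ : ∀ k, Fin.append u v k ∈ D)
        (_ : ∀ k l, k ≠ l → M.z (Fin.append u v k) - M.z (Fin.append u v l) ≠ 0 ∧
          M.z (Fin.append u v k) - M.z (Fin.append u v l) ≠ M.c),
      M.betheVector u v Ω = M.explicitVector₁ (lam 1) u v Ω ∧
        M.betheVector u v Ω = M.explicitVector₂ (lam 1) u v Ω) := by
  refine ⟨?_, ?_⟩
  · intro c hc V _ _ wt Ω hΩ a b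
    have happ : Fin.append (Fin.castAdd b) (Fin.natAdd a) = (id : Fin (a + b) → Fin (a + b)) := by
      funext q
      refine Fin.addCases (fun i => ?_) (fun i => ?_) q <;> simp
    have hc' : (SuperBethe.yangianData c (a + b)).c ≠ 0 := fun h =>
      hc (HahnSeries.C_injective (h.trans (map_zero _).symm))
    refine (SuperBethe.yangianData c (a + b)).betheVector_eq_explicitVector hc'
      (SuperBethe.isMonodromy_yangianData c (a + b))
      (SuperBethe.isSingularOn_yangianData c (a + b) hΩ) _ _ (fun _ => trivial) fun k l hkl => ?_
    rw [happ]
    exact SuperBethe.yangianData_z_sub_ne c (a + b) hkl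
  · intro P A _ M D hc hM V _ _ lam Ω hΩ a b u v hD hne
    exact M.betheVector_eq_explicitVector hc hM hΩ u v hD hne
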